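/- Let $k$ be a field of characteristic $p>0$ (not necessarily algebraically closed), $G$ a finite group, $N\trianglelefteq G$. Let $A$ be a finite-dimensional interior $G$-algebra over $k$ that has a $k$-basis stable under left and right multiplication by $G$ and that is projective as a left and as a right $kN$-module. Let $C$ be an $N$-interior $G$-algebra which is a $p$-permutation $G$-algebra and is contained in $A$ (as a unital subalgebra, compatibly with the $G$-actions and with the maps from $N$). Let $c$ be a $G$-invariant primitive idempotent of $C^N$ with defect group $Q$ in $N$, and let $(Q,f_Q)$ be a $(C,c,G)$-Brauer pair such that $f_Q$ is primitive in $C(Q)^{C_N(Q)}$. Put $H=N_G(Q,f_Q)$, the stabilizer of $f_Q$ in $N_G(Q)$. Let $$X=\bigoplus_{\varphi\in\mathrm{Aut}(Q)} A^{\varphi}\Big/\sum_{R<Q}A^{\varphi}_R$$ be the extended Brauer quotient of $A$ at $Q$, where $A^{\varphi}=\{a\in A:\varphi(u)a=au\ \text{for all } u\in Q\}$ and $A^{\varphi}_R$ is the set of all $\sum_{u\in Q/R}\varphi(u)au^{-1}$ with $\varphi(v)a=av$ for all $v\in R$. It is an interior $N_G(Q)$-algebra, and $f_Q$ is viewed in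 it through $C(Q)\to A(Q)\subseteq X$, where $A(Q)$ is the component of $\varphi=1$. Notation. For a finite group $M$ acting on a $k$-algebra $B$ by automorphisms and $R\le L\le M$, $\mathrm{Tr}_R^L:B^R\to B^L$ is the relative trace and $\mathrm{Br}_L:B^L\to B(L)=B^L/\sum_{R<L}\mathrm{Tr}_R^L(B^R)$ is the Brauer map. A block of a ring is a primitive idempotent of its centre. A point of $L$ on $B$ is a $(B^L)^\times$-conjugacy class $\alpha$ of primitive idempotents of $B^L$; a defect group of $\alpha$ (or of an idempotent $e\in B^L$) in $L$ is a minimal $D\le L$ with $\alpha\subseteq\mathrm{Tr}_D^L(B^D)$ (or $e\in\mathrm{Tr}_D^L(B^D)$). For $L'\trianglelefteq L$ and an $L$-invariant idempotent $j\in B$ with defect group $Q$ in $L'$, a point $\alpha$ of $L$ on $B$ covers $j$ (with respect to $L'$ and $Q$) if there are $i\in\alpha$ with $ij=ji=i$ and a point $\varepsilon$ of $L'$ on $B$ with defect group $Q$ such that $if=fi=f$ and $jf_1=f_1j=f_1$ for some $f,f_1\in\varepsilon$. A $(B,b,L)$-Brauer pair $(R,e)$ consists of a $p$-subgroup $R\le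 L$ and a block $e$ of $B(R)$ with $\mathrm{Br}_R(b)e\ne0$; for two of them, $(R,e)\le(S,e')$ means that $R\le S$ and that $\mathrm{Br}_R(i)e\neq0$ for every primitive idempotent $i$ of $B^S$ with $\mathrm{Br}_S(i)e'\ne0$. Let $\gamma$ be a point of $H$ on $X$ with defect group $P$ that covers $f_Q$ (with respect to $QC_N(Q)$ and $Q$). Then: (1) $\gamma$ determines a point of $G$ on $A$ with defect group $P$ that covers $c$ (with respect to $N$ and $Q$), in the following sense: there is a point $\alpha$ of $G$ on $A$ with these two properties for which there are $l\in\gamma$ with $f_Ql=lf_Q=l$ and $i\in\alpha$ such that the image $w$ of $\mathrm{Br}_Q(i)\in A(Q)$ in $X$ satisfies $w\,\mathrm{Tr}_H^{N_G(Q)}(l)=\mathrm{Tr}_H^{N_G(Q)}(l)\,w=w$. (2) There is a block $f_P$ of $C(P)$ such that $(Q,f_Q)\le(P,f_P)$ both as $(C(Q),f_Q,H)$-Brauer pairs and as $(C,c,G)$-Brauer pairs, where $C(Q)(Q)$ is identified with $C(Q)$ and $C(Q)(P)$ with $C(P)$ through $\mathrm{Br}_P(\mathrm{Br}_Q(a))\leftrightarrow\mathrm{Br}_P(a)$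 for $a\in C^P$. -/

import Mathlib

namespace BrauerPoints

noncomputable section

/-! ### Idempotents, points and blocks -/

/-- A primitive idempotent of a ring: a nonzero idempotent that is not the sum of two nonzero
orthogonal idempotents. -/
def IsPrimitiveIdempotent {R : Type*} [Ring R] (e : R) : Prop :=
  IsIdempotentElem e ∧ e ≠ 0 ∧ ∀ a b : R, IsIdempotentElem a → IsIdempotentElem b →
    a * b = 0 → b * a = 0 → a + b = e → a = 0 ∨ b = 0

/-- A block of a ring: a primitive idempotent of its centre. -/
def IsBlock {R : Type*} [Ring R] (b : R) : Prop :=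
  ∃ h : b ∈ Subring.center R, IsPrimitiveIdempotent (⟨b, h⟩ : Subring.center R)

section Action

variable {k : Type*} [Field k] {M : Type*} [Group M] {B : Type*} [Ring B] [Algebra k B]

/-- `e` is a primitive idempotent of the subalgebra `S`. -/
def IsPrimitiveIn (S : Subalgebra k B) (e : B) : Prop :=
  ∃ h : e ∈ S, IsPrimitiveIdempotent (⟨e, h⟩ : S)

/-- The subalgebra `B^P` of `P`-fixed elements of the `M`-algebra `B`
(an `M`-algebra is a `k`-algebra with an action `ρ` of `M` by algebra automorphisms). -/
def fixedSubalgebra (ρ : M →* (B ≃ₐ[k] B)) (P : Subgroup M) : Subalgebra k B where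
  carrier := {b | ∀ g ∈ P, ρ g b = b}
  mul_mem' := fun ha hb g hg => by rw [map_mul, ha g hg, hb g hg]
  add_mem' := fun ha hb g hg => by rw [map_add, ha g hg, hb g hg]
  algebraMap_mem' := fun r g _ => AlgEquiv.commutes (ρ g) r

/-- The relative trace `Tr_R^P(a) = ∑_{x ∈ P/R} x a` (meant for `R ≤ P` and `a ∈ B^R`, where
it does not depend on the choice of coset representatives). -/
def relTrace (ρ : M →* (B ≃ₐ[k] B)) (R P : Subgroup M) (a : B) : B :=
  ∑ᶠ x : P ⧸ R.subgroupOf P, ρ ((x.out : P) : M) a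

theorem relTrace_eq (ρ : M →* (B ≃ₐ[k] B)) {R P : Subgroup M} {a : B}
    (ha : a ∈ fixedSubalgebra ρ R) (s : P ⧸ R.subgroupOf P → P)
    (hs : ∀ x, (QuotientGroup.mk (s x) : P ⧸ R.subgroupOf P) = x) :
    relTrace ρ R P a = ∑ᶠ x : P ⧸ R.subgroupOf P, ρ ((s x : P) : M) a := by
  refine finsum_congr fun x => ?_
  have h : (QuotientGroup.mk x.out : P ⧸ R.subgroupOf P) = QuotientGroup.mk (s x) := by
    rw [hs x]; exact Quotient.out_eq x
  rw [QuotientGroup.eq, Subgroup.mem_subgroupOf] at h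
  have h2 := ha _ h
  have h3 : ((s x : P) : M) = (x.out : P) * (((x.out : P)⁻¹ * s x : P) : M) := by
    push_cast; group
  rw [h3, map_mul, AlgEquiv.mul_apply, h2]

theorem exists_relTrace_conj [Finite M] (ρ : M →* (B ≃ₐ[k] B)) {P : Subgroup M} {m : M}
    (hm : m ∈ Subgroup.normalizer (P : Set M)) {R : Subgroup M} (hR : R < P) {a : B}
    (ha : a ∈ fixedSubalgebra ρ R) :
    ∃ R' < P, ∃ a' ∈ fixedSubalgebra ρ R', ρ m (relTrace ρ R P a) = relTrace ρ R' P a' := by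
  have hPm : P.map (MulAut.conj m).toMonoidHom = P := by
    ext x
    simp only [Subgroup.mem_map]
    constructor
    · rintro ⟨y, hy, rfl⟩
      exact (Subgroup.mem_normalizer_iff.1 hm y).1 hy
    · intro hx
      refine ⟨m⁻¹ * x * m, (Subgroup.mem_normalizer_iff.1 hm _).2 ?_, ?_⟩
      · have : m * (m⁻¹ * x * m) * m⁻¹ = x := by group
        rwa [this]
      · simp [mul_assoc]
  set R' := R.map (MulAut.conj m).toMonoidHom with hR'
  have hlt : R' < P := by
    have := (Subgroup.map_lt_map_iff_of_injective
      (f := (MulAut.conj m).toMonoidHom) (MulAut.conj m).injective).2 hR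
    rwa [hPm] at this
  have ha' : ρ m a ∈ fixedSubalgebra ρ R' := by
    rintro g ⟨y, hy, rfl⟩
    have : (MulAut.conj m).toMonoidHom y * m = m * y := by simp
    rw [← AlgEquiv.mul_apply, ← map_mul, this, map_mul, AlgEquiv.mul_apply, ha y hy]
  refine ⟨R', hlt, ρ m a, ha', ?_⟩
  have hmem : ∀ x : P, m * x * m⁻¹ ∈ P := fun x =>
    (Subgroup.mem_normalizer_iff.1 hm x).1 x.2
  have hmem' : ∀ x : P, m⁻¹ * x * m ∈ P := fun x => by
    refine (Subgroup.mem_normalizer_iff.1 hm _).2 ?_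
    have : m * (m⁻¹ * x * m) * m⁻¹ = x := by group
    rw [this]; exact x.2
  let e : (P ⧸ R.subgroupOf P) ≃ (P ⧸ R'.subgroupOf P) :=
    @Quotient.congr P P (QuotientGroup.leftRel _) (QuotientGroup.leftRel _)
      { toFun := fun x => (⟨m * x * m⁻¹, hmem x⟩ : P)
        invFun := fun x => (⟨m⁻¹ * x * m, hmem' x⟩ : P)
        left_inv := fun x => by ext; simp [mul_assoc]
        right_inv := fun x => by ext; simp [mul_assoc] }
      (by
        intro x y
        rw [QuotientGroup.leftRel_apply, QuotientGroup.leftRel_apply,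
          Subgroup.mem_subgroupOf, Subgroup.mem_subgroupOf]
        have : (((⟨m * x * m⁻¹, hmem x⟩ : P)⁻¹ * (⟨m * y * m⁻¹, hmem y⟩ : P) : P) : M)
            = (MulAut.conj m).toMonoidHom ((x⁻¹ * y : P) : M) := by
          simp [mul_assoc]
        change _ ↔ (((⟨m * x * m⁻¹, hmem x⟩ : P)⁻¹ * (⟨m * y * m⁻¹, hmem y⟩ : P) : P) : M) ∈ R'
        rw [this, hR', Subgroup.mem_map_iff_mem (MulAut.conj m).injective])
  rw [relTrace_eq ρ ha' (fun x => (⟨m * ((e.symm x).out : P) * m⁻¹, hmem _⟩ : P)) ?_]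
  · rw [relTrace]
    have := (ρ m).toAddEquiv.toAddMonoidHom.map_finsum
      (f := fun x : P ⧸ R.subgroupOf P => ρ ((x.out : P) : M) a) (Set.toFinite _)
    change ρ m _ = ∑ᶠ x : P ⧸ R.subgroupOf P, ρ m _ at this
    rw [this, ← finsum_comp_equiv e]
    refine finsum_congr fun x => ?_
    rw [Equiv.symm_apply_apply, ← AlgEquiv.mul_apply, ← AlgEquiv.mul_apply, ← map_mul, ← map_mul]
    simp
  · intro x
    have h1 : e (QuotientGroup.mk ((e.symm x).out)) = x := by
      have : (QuotientGroup.mk ((e.symm x).out) : P ⧸ R.subgroupOf P) = e.symm x :=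
        Quotient.out_eq _
      rw [this, Equiv.apply_symm_apply]
    exact h1

/-- A point of `L` on `B`: a conjugacy class, under the unit group of `B^L`, of primitive
idempotents of `B^L`. -/
def IsPoint (ρ : M →* (B ≃ₐ[k] B)) (L : Subgroup M) (α : Set B) : Prop :=
  ∃ i : fixedSubalgebra ρ L, IsPrimitiveIdempotent i ∧
    α = {j | ∃ u : (fixedSubalgebra ρ L)ˣ,
      j = ((u * i * (u⁻¹ : (fixedSubalgebra ρ L)ˣ) : fixedSubalgebra ρ L) : B)}

/-- `D` is a defect group of `e` in `L`: a minimal subgroup of `L` with `e ∈ Tr_D^L(B^D)`. -/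
def IsDefectGroup (ρ : M →* (B ≃ₐ[k] B)) (L D : Subgroup M) (e : B) : Prop :=
  D ≤ L ∧ (∃ a ∈ fixedSubalgebra ρ D, relTrace ρ D L a = e) ∧
    ∀ R < D, ¬ ∃ a ∈ fixedSubalgebra ρ R, relTrace ρ R L a = e

/-- `D` is a defect group of the point `α` of `L` on `B`, i.e. of its members. -/
def IsDefectGroupOfPoint (ρ : M →* (B ≃ₐ[k] B)) (L D : Subgroup M) (α : Set B) : Prop :=
  ∀ i ∈ α, IsDefectGroup ρ L D i

/-- The point `α` of `L` on `B` covers the `L`-fixed idempotent `j`, which is an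
idempotent with defect group `Q` for the normal subgroup `N` of `L`: some `i ∈ α` lies under `j`
and there is a point `ε` of `N` on `B` with defect group `Q` such that `i f = f i = f` and
`j f₁ = f₁ j = f₁` for some `f, f₁ ∈ ε`. -/
def Covers (ρ : M →* (B ≃ₐ[k] B)) (N Q : Subgroup M) (α : Set B) (j : B) : Prop :=
  ∃ i ∈ α, j * i = i ∧ i * j = i ∧
    ∃ ε : Set B, IsPoint ρ N ε ∧ IsDefectGroupOfPoint ρ N Q ε ∧
      (∃ f ∈ ε, i * f = f ∧ f * i = f) ∧ ∃ f₁ ∈ ε, j * f₁ = f₁ ∧ f₁ * j = f₁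

/-- `B` is a `p`-permutation `M`-algebra: for every `p`-subgroup `S` of `M` it has an `S`-stable
`k`-basis. -/
def IsPPermutation (p : ℕ) (ρ : M →* (B ≃ₐ[k] B)) : Prop :=
  ∀ S : Subgroup M, IsPGroup p S → ∃ s : Set B,
    LinearIndepOn k id s ∧ Submodule.span k s = ⊤ ∧ ∀ g ∈ S, ∀ b ∈ s, ρ g b ∈ s

/-- The stabilizer of an element of `B`. -/
def elemStabilizer (ρ : M →* (B ≃ₐ[k] B)) (b : B) : Subgroup M where
  carrier := {g | ρ g b = b}
  one_mem' := by simp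
  mul_mem' := fun {x y} (hx : ρ x b = b) (hy : ρ y b = b) => by
    change ρ (x * y) b = b
    rw [map_mul, AlgEquiv.mul_apply, hy, hx]
  inv_mem' := fun {x} (hx : ρ x b = b) => by
    change ρ x⁻¹ b = b
    conv_lhs => rw [← hx]
    rw [← AlgEquiv.mul_apply, ← map_mul]; simp

/-! ### The Brauer quotient -/

/-- The ideal `∑_{R < P} Tr_R^P(B^R)` of `B^P`, as the two-sided ideal generated by the relative
traces from proper subgroups. -/
def brauerIdeal (ρ : M →* (B ≃ₐ[k] B)) (P : Subgroup M) : TwoSidedIdeal (fixedSubalgebra ρ P) :=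
  TwoSidedIdeal.span {x | ∃ R < P, ∃ a ∈ fixedSubalgebra ρ R, (x : B) = relTrace ρ R P a}

/-- The Brauer quotient `B(P) = B^P / ∑_{R < P} Tr_R^P(B^R)`. -/
abbrev BrauerQuotient (ρ : M →* (B ≃ₐ[k] B)) (P : Subgroup M) : Type _ :=
  (brauerIdeal ρ P).ringCon.Quotient

/-- The Brauer homomorphism `Br_P : B^P → B(P)`. -/
def br (ρ : M →* (B ≃ₐ[k] B)) (P : Subgroup M) : fixedSubalgebra ρ P →ₐ[k] BrauerQuotient ρ P :=
  RingCon.mkₐ k (brauerIdeal ρ P).ringCon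

theorem br_eq_zero (ρ : M →* (B ≃ₐ[k] B)) (P : Subgroup M) {x : fixedSubalgebra ρ P}
    (hx : x ∈ brauerIdeal ρ P) : br ρ P x = 0 :=
  (RingCon.eq _).2 hx

/-- An algebra homomorphism killing a set of generators kills the two-sided ideal. -/
theorem span_ringCon_le {R S : Type*} [Ring R] [Ring S] [Algebra k R] [Algebra k S]
    (f : R →ₐ[k] S) {s : Set R} (h : ∀ x ∈ s, f x = 0) :
    (TwoSidedIdeal.span s).ringCon ≤ RingCon.ker f.toRingHom := by
  have : TwoSidedIdeal.span s ≤ TwoSidedIdeal.ker f.toRingHom :=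
    TwoSidedIdeal.span_le.2 fun x hx => (TwoSidedIdeal.mem_ker _).2 (h x hx)
  exact TwoSidedIdeal.ringCon_le_iff.1 this

/-- The action of `N_M(P)` on `B^P`. -/
def fixedEnd (ρ : M →* (B ≃ₐ[k] B)) (P : Subgroup M) (m : Subgroup.normalizer (P : Set M)) :
    fixedSubalgebra ρ P →ₐ[k] fixedSubalgebra ρ P :=
  (((ρ m : B ≃ₐ[k] B) : B →ₐ[k] B).comp (fixedSubalgebra ρ P).val).codRestrict
    (fixedSubalgebra ρ P) (fun x g hg => by
      change ρ g (ρ m x) = ρ m x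
      have h : (m : M)⁻¹ * g * m ∈ P := by
        refine (Subgroup.mem_normalizer_iff.1 m.2 _).2 ?_
        have : (m : M) * ((m : M)⁻¹ * g * m) * (m : M)⁻¹ = g := by group
        rwa [this]
      have h2 := x.2 _ h
      conv_rhs => rw [← h2]
      rw [← AlgEquiv.mul_apply, ← AlgEquiv.mul_apply, ← map_mul, ← map_mul]
      congr 2
      group)

/-- The endomorphism of `B(P)` induced by an element of `N_M(P)`. -/
def brauerEnd [Finite M] (ρ : M →* (B ≃ₐ[k] B)) (P : Subgroup M)
    (m : Subgroup.normalizer (P : Set M)) : BrauerQuotient ρ P →ₐ[k] BrauerQuotient ρ P :=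
  RingCon.liftₐ (brauerIdeal ρ P).ringCon ((br ρ P).comp (fixedEnd ρ P m))
    (span_ringCon_le _ (by
      rintro x ⟨R, hR, a, ha, hx⟩
      refine br_eq_zero ρ P (TwoSidedIdeal.subset_span ?_)
      obtain ⟨R', hR', a', ha', h⟩ := exists_relTrace_conj ρ m.2 hR ha
      refine ⟨R', hR', a', ha', ?_⟩
      change ρ m (x : B) = _
      rw [hx, h]))

/-- The action of `N_M(P)` on the Brauer quotient `B(P)`: `g · Br_P(b) = Br_P(g b)`. -/
def brauerAction [Finite M] (ρ : M →* (B ≃ₐ[k] B)) (P : Subgroup M) :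
    Subgroup.normalizer (P : Set M) →* (BrauerQuotient ρ P ≃ₐ[k] BrauerQuotient ρ P) :=
  (AlgEquiv.algHomUnitsEquiv k (BrauerQuotient ρ P)).toMonoidHom.comp
    (MonoidHom.toHomUnits
      { toFun := brauerEnd ρ P
        map_one' := by
          refine AlgHom.ext fun x => ?_
          induction x using Quotient.inductionOn with | _ x => ?_
          change br ρ P (fixedEnd ρ P 1 x) = br ρ P x
          congr 1
          ext
          change ρ ((1 : Subgroup.normalizer (P : Set M)) : M) (x : B) = x
          simp
        map_mul' := fun m n => by
          refine AlgHom.ext fun x => ?_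
          induction x using Quotient.inductionOn with | _ x => ?_
          change br ρ P (fixedEnd ρ P (m * n) x) = br ρ P (fixedEnd ρ P m (fixedEnd ρ P n x))
          congr 1
          ext
          change ρ ((m * n : Subgroup.normalizer (P : Set M)) : M) (x : B) = ρ m (ρ n x)
          rw [Subgroup.coe_mul, map_mul, AlgEquiv.mul_apply] })

theorem brauerAction_br [Finite M] (ρ : M →* (B ≃ₐ[k] B)) (P : Subgroup M)
    (m : Subgroup.normalizer (P : Set M)) (x : fixedSubalgebra ρ P) :
    brauerAction ρ P m (br ρ P x) = br ρ P (fixedEnd ρ P m x) := rfl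

/-! ### Brauer pairs -/

/-- `(P, f)` is a `(B, c, H)`-Brauer pair: `P` is a `p`-subgroup of `H` and `f` is a block of
`B(P)` with `Br_P(c) f ≠ 0` (where `c ∈ B^H`). -/
def IsBrauerPair (p : ℕ) (ρ : M →* (B ≃ₐ[k] B)) (H : Subgroup M) (c : B) (P : Subgroup M)
    (f : BrauerQuotient ρ P) : Prop :=
  P ≤ H ∧ IsPGroup p P ∧ IsBlock f ∧
    ∃ hc : c ∈ fixedSubalgebra ρ P, br ρ P ⟨c, hc⟩ * f ≠ 0

/-- `(Q, e) ≤ (P, f)` as `(B, c, H)`-Brauer pairs: both are `(B, c, H)`-Brauer pairs, `Q ≤ P`,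
and `Br_Q(i) e ≠ 0` for every primitive idempotent `i` of `B^P` with `Br_P(i) f ≠ 0`. -/
def BrauerPairLE (p : ℕ) (ρ : M →* (B ≃ₐ[k] B)) (H : Subgroup M) (c : B)
    (Q : Subgroup M) (e : BrauerQuotient ρ Q) (P : Subgroup M) (f : BrauerQuotient ρ P) : Prop :=
  IsBrauerPair p ρ H c Q e ∧ IsBrauerPair p ρ H c P f ∧ Q ≤ P ∧
    ∀ (i : B) (hP : i ∈ fixedSubalgebra ρ P) (hQ : i ∈ fixedSubalgebra ρ Q),
      IsPrimitiveIdempotent (⟨i, hP⟩ : fixedSubalgebra ρ P) →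
        br ρ P ⟨i, hP⟩ * f ≠ 0 → br ρ Q ⟨i, hQ⟩ * e ≠ 0

/-- A subgroup of `N_M(Q)`, regarded as a subgroup of `M`. -/
abbrev up (Q : Subgroup M) (P : Subgroup (Subgroup.normalizer (Q : Set M))) : Subgroup M :=
  P.map (Subgroup.normalizer (Q : Set M)).subtype

/-- A subgroup of `M` intersected with `N_M(Q)`, regarded as a subgroup of `N_M(Q)`. -/
abbrev down (Q : Subgroup M) (P : Subgroup M) : Subgroup (Subgroup.normalizer (Q : Set M)) :=
  P.subgroupOf (Subgroup.normalizer (Q : Set M))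

/-- The graph of the canonical identification of `B(P)` with `B(Q)(P)`, for a `p`-permutation
algebra `B` and `p`-subgroups `Q ≤ P ≤ N_M(Q)`: it matches `Br_P(a)` with
`Br_P^{B(Q)}(Br_Q(a))`, for `a ∈ B^P`. -/
def Corresponds [Finite M] (ρ : M →* (B ≃ₐ[k] B)) (Q : Subgroup M)
    (P : Subgroup (Subgroup.normalizer (Q : Set M)))
    (f : BrauerQuotient ρ (up Q P)) (f' : BrauerQuotient (brauerAction ρ Q) P) : Prop :=
  ∃ (a : B) (hP : a ∈ fixedSubalgebra ρ (up Q P)) (hQ : a ∈ fixedSubalgebra ρ Q)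
    (h : br ρ Q ⟨a, hQ⟩ ∈ fixedSubalgebra (brauerAction ρ Q) P),
    br ρ (up Q P) ⟨a, hP⟩ = f ∧ br (brauerAction ρ Q) P ⟨br ρ Q ⟨a, hQ⟩, h⟩ = f'

end Action

/-! ### Interior algebras and the extended Brauer quotient -/

section Interior

variable {k : Type*} [Field k] {G : Type*} [Group G] {A : Type*} [Ring A] [Algebra k A]

/-- The conjugation action of `G` on an interior `G`-algebra: `g a = ι(g) a ι(g)⁻¹`. -/
def conjAction (k : Type*) [Field k] {A : Type*} [Ring A] [Algebra k A]
    (ι : G →* Aˣ) : G →* (A ≃ₐ[k] A) where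
  toFun g :=
    { toFun := fun a => ι g * a * ((ι g)⁻¹ : Aˣ)
      invFun := fun a => ((ι g)⁻¹ : Aˣ) * a * ι g
      left_inv := fun a => by simp [mul_assoc]
      right_inv := fun a => by simp [mul_assoc]
      map_mul' := fun a b => by simp [mul_assoc]
      map_add' := fun a b => by simp [mul_add, add_mul]
      commutes' := fun r => by simp [← Algebra.commutes r, mul_assoc] }
  map_one' := by ext a; simp
  map_mul' g h := by ext a; simp [mul_assoc]

/-- `A` as a `k[N × 1]`-module: left multiplication by `N`. -/
def leftRep (k : Type*) [Field k] {A : Type*} [Ring A] [Algebra k A]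
    (ι : G →* Aˣ) (N : Subgroup G) : Representation k N A where
  toFun n := LinearMap.mulLeft k (ι n : A)
  map_one' := by ext; simp
  map_mul' m n := by ext; simp

/-- `A` as a `k[1 × N]`-module: `n` acts by right multiplication with `n⁻¹`. -/
def rightRep (k : Type*) [Field k] {A : Type*} [Ring A] [Algebra k A]
    (ι : G →* Aˣ) (N : Subgroup G) : Representation k N A where
  toFun n := LinearMap.mulRight k (((ι n)⁻¹ : Aˣ) : A)
  map_one' := by ext; simp
  map_mul' m n := by ext; simp [mul_assoc]

/-- The interior `G`-algebra `A` has a `k`-basis that is stable under left and right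
multiplication by `G`. -/
def HasBistableBasis (k : Type*) [Field k] {A : Type*} [Ring A] [Algebra k A]
    (ι : G →* Aˣ) : Prop :=
  ∃ s : Set A, LinearIndepOn k id s ∧ Submodule.span k s = ⊤ ∧
    ∀ g h : G, ∀ b ∈ s, (ι g : A) * b * ι h ∈ s

/-- The algebra `N_A(Q) = ⊕_φ {a ∈ A | φ(u) a = a u for all u ∈ Q}`, where `φ` runs over
`Aut(Q)` and the sum is external; it is realized inside the group algebra of `Aut(Q)` over `A`,
so that the product of `a` in degree `φ` with `b` in degree `ψ` is `a b` in degree `φψ`. -/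
def extNum (k : Type*) [Field k] {A : Type*} [Ring A] [Algebra k A]
    (ι : G →* Aˣ) (Q : Subgroup G) : Subalgebra k (MonoidAlgebra A (MulAut Q)) where
  carrier := {x | ∀ (φ : MulAut Q) (u : Q), (ι (φ u) : A) * x.coeff φ = x.coeff φ * ι u}
  mul_mem' := fun {x y} hx hy φ u => by
    rw [MonoidAlgebra.coeff_mul_apply_left, Finsupp.sum, Finset.mul_sum, Finset.sum_mul]
    refine Finset.sum_congr rfl fun ψ _ => ?_
    have h1 := hx ψ ((ψ⁻¹ * φ) u)
    have h2 := hy (ψ⁻¹ * φ) u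
    have h3 : ψ ((ψ⁻¹ * φ) u) = φ u := by
      rw [← MulAut.mul_apply, mul_inv_cancel_left]
    rw [h3] at h1
    rw [← mul_assoc, h1, mul_assoc, h2, mul_assoc]
  add_mem' := fun {x y} hx hy φ u => by
    simp only [MonoidAlgebra.coeff_add, Finsupp.add_apply, mul_add, add_mul, hx φ u, hy φ u]
  algebraMap_mem' := fun r φ u => by
    classical
    rw [MonoidAlgebra.coe_algebraMap]
    simp only [Function.comp_apply, MonoidAlgebra.coeff_single, Finsupp.single_apply]
    split_ifs with h
    · subst h
      simpa using (Algebra.commutes r _).symm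
    · simp

/-- The twisted relative trace `∑_{u ∈ Q/R} φ(u) a u⁻¹` (meant for `a` with `φ(u) a = a u` for all
`u ∈ R`). -/
def twistedTrace (ι : G →* Aˣ) (Q : Subgroup G) (φ : MulAut Q) (R : Subgroup Q) (a : A) : A :=
  ∑ᶠ x : Q ⧸ R, (ι (φ x.out) : A) * a * ((ι (x.out : Q))⁻¹ : Aˣ)

/-- The ideal of `N_A(Q)` which in degree `φ` is the sum over all `R < Q` of the
images of the twisted relative traces, as the two-sided ideal generated by these images. -/
def extIdeal (k : Type*) [Field k] {A : Type*} [Ring A] [Algebra k A]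
    (ι : G →* Aˣ) (Q : Subgroup G) : TwoSidedIdeal (extNum k ι Q) :=
  TwoSidedIdeal.span {x | ∃ (φ : MulAut Q) (R : Subgroup Q) (a : A), R < ⊤ ∧
    (∀ u ∈ R, (ι (φ u) : A) * a = a * ι (u : Q)) ∧
    (x : MonoidAlgebra A (MulAut Q)) = MonoidAlgebra.single φ (twistedTrace ι Q φ R a)}

/-- The extended Brauer quotient of the interior `G`-algebra `A` at `Q`, with respect to
`Aut(Q)`. -/
abbrev ExtBrauerQuotient (k : Type*) [Field k] {A : Type*} [Ring A] [Algebra k A]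
    (ι : G →* Aˣ) (Q : Subgroup G) : Type _ :=
  (extIdeal k ι Q).ringCon.Quotient

/-- The quotient map onto the extended Brauer quotient. -/
def extMk (k : Type*) [Field k] {A : Type*} [Ring A] [Algebra k A]
    (ι : G →* Aˣ) (Q : Subgroup G) : extNum k ι Q →ₐ[k] ExtBrauerQuotient k ι Q :=
  RingCon.mkₐ k (extIdeal k ι Q).ringCon

/-- `n ∈ N_G(Q)` as the element of `N_A(Q)` that is `ι(n)` in the degree of the automorphism
`u ↦ n u n⁻¹` of `Q`. -/
def extNormalizer (k : Type*) [Field k] {A : Type*} [Ring A] [Algebra k A]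
    (ι : G →* Aˣ) (Q : Subgroup G) :
    Subgroup.normalizer (Q : Set G) →* extNum k ι Q where
  toFun n := ⟨MonoidAlgebra.single (Q.normalizerMonoidHom n) (ι n : A), by
    classical
    intro φ u
    simp only [MonoidAlgebra.coeff_single, Finsupp.single_apply]
    split_ifs with h
    · subst h
      rw [← Units.val_mul, ← Units.val_mul, ← map_mul, ← map_mul]
      simp
    · simp⟩
  map_one' := by
    ext1
    simp [MonoidAlgebra.one_def]
  map_mul' m n := by
    ext1
    simp

/-- The structural homomorphism `N_G(Q) → X^×` of the extended Brauer quotient `X`, which makes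
`X` an interior `N_G(Q)`-algebra. -/
def extInterior (k : Type*) [Field k] {A : Type*} [Ring A] [Algebra k A]
    (ι : G →* Aˣ) (Q : Subgroup G) :
    Subgroup.normalizer (Q : Set G) →* (ExtBrauerQuotient k ι Q)ˣ :=
  ((extMk k ι Q : extNum k ι Q →* ExtBrauerQuotient k ι Q).comp
    (extNormalizer k ι Q)).toHomUnits

/-- The degree one inclusion `C^Q → A^Q → N_A(Q)`, for a homomorphism `j : C → A` of
`G`-algebras. -/
def degreeOne {C : Type*} [Ring C] [Algebra k C] (ι : G →* Aˣ) (Q : Subgroup G)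
    (ρ : G →* (C ≃ₐ[k] C)) (j : C →ₐ[k] A) (hj : ∀ g x, j (ρ g x) = conjAction k ι g (j x)) :
    fixedSubalgebra ρ Q →ₐ[k] extNum k ι Q :=
  (((MonoidAlgebra.singleOneAlgHom (R := k) (A := A) (M := MulAut Q)).comp j).comp
    (fixedSubalgebra ρ Q).val).codRestrict (extNum k ι Q) (fun x φ u => by
      classical
      change (ι (φ u) : A) * (MonoidAlgebra.single 1 (j x)).coeff φ
        = (MonoidAlgebra.single 1 (j x)).coeff φ * ι u
      simp only [MonoidAlgebra.coeff_single, Finsupp.single_apply]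
      split_ifs with h
      · subst h
        have h1 := hj u x
        rw [x.2 u u.2] at h1
        change j x = ι u * j x * ((ι u)⁻¹ : Aˣ) at h1
        rw [MulAut.one_apply]
        conv_rhs => rw [h1]
        simp [mul_assoc]
      · simp)

/-- The homomorphism `C(Q) → X` to the extended Brauer quotient `X` of `A` at `Q`, with image in
degree one, that is induced by a homomorphism `j : C → A` of `G`-algebras. -/
def toExt [Finite G] {C : Type*} [Ring C] [Algebra k C] (ι : G →* Aˣ) (Q : Subgroup G)
    (ρ : G →* (C ≃ₐ[k] C)) (j : C →ₐ[k] A) (hj : ∀ g x, j (ρ g x) = conjAction k ι g (j x)) :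
    BrauerQuotient ρ Q →ₐ[k] ExtBrauerQuotient k ι Q :=
  RingCon.liftₐ (brauerIdeal ρ Q).ringCon ((extMk k ι Q).comp (degreeOne ι Q ρ j hj))
    (span_ringCon_le _ (by
      rintro x ⟨R, hR, a, ha, hx⟩
      refine (RingCon.eq _).2 (TwoSidedIdeal.subset_span ?_)
      refine ⟨1, R.subgroupOf Q, j a, ?_, ?_, ?_⟩
      · rw [lt_top_iff_ne_top]
        intro h
        exact not_le_of_gt hR (Subgroup.subgroupOf_eq_top.1 h)
      · intro u hu
        have h1 := hj u a
        rw [ha u (Subgroup.mem_subgroupOf.1 hu)] at h1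
        change j a = ι u * j a * ((ι u)⁻¹ : Aˣ) at h1
        rw [MulAut.one_apply]
        conv_rhs => rw [h1]
        simp [mul_assoc]
      · change MonoidAlgebra.single 1 (j x) = _
        congr 1
        rw [hx, relTrace, twistedTrace]
        have := (j : C →+ A).map_finsum
          (f := fun x : Q ⧸ R.subgroupOf Q => ρ ((x.out : Q) : G) a) (Set.toFinite _)
        change j _ = ∑ᶠ x : Q ⧸ R.subgroupOf Q, j _ at this
        rw [this]
        refine finsum_congr fun y => ?_
        rw [hj]
        rfl))

/-- The composite `A^Q → A(Q) → X` of the Brauer homomorphism with the degree one inclusion. -/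
def extBr [Finite G] (k : Type*) [Field k] {A : Type*} [Ring A] [Algebra k A]
    (ι : G →* Aˣ) (Q : Subgroup G) :
    fixedSubalgebra (conjAction k ι) Q →ₐ[k] ExtBrauerQuotient k ι Q :=
  (toExt ι Q (conjAction k ι) (AlgHom.id k A) (fun _ _ => rfl)).comp (br (conjAction k ι) Q)

end Interior

end

end BrauerPoints

/-! The engine is that a `p`-group permuting a basis makes Brauer quotients computable: a fixed
element is a sum of proper traces exactly when its coordinates at the fixed basis elements vanish
(`mem_properTraces_iff`). Hence, for a permutation algebra `B` and `Q ≤ P ≤ N(Q)`, the map `B^P →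
B(Q)^P` is onto (`exists_br_eq`) and `B(P) = B(Q)(P)` (`mem_properTraces_iff_br`).

Reduction to degree one. Projectivity over `kN` makes `Q` act freely by left multiplication on the
bistable basis of `A` (`exists_bistable_basis`). If a basis element `b` of `X` of degree `φ` is
fixed under conjugation by `Q`, then `u b = b u = φ(u) b`, so `φ = 1`. Thus `X^Q` is `A(Q)` plus
proper traces (`sub_ofBrauer_mem_properTraces`). Those traces lie in the radical of `X`, because `Q`
acts trivially modulo the radical (`properTraces_le_jacobson`). So `γ` has a member `l` in `A(Q)^H`
lying under `fQ` (`exists_ofBrauer_mem`).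

Position of `P`. One has `Q ≤ P`, since otherwise `l`, a trace from `P`, would vanish in `A(Q)`.
Moreover `P ∩ N = Q`: the element `Br_Q(c)` is a trace from `Q` to `N_N(Q)` and fixes `l`, so a
larger intersection would make `l` a proper trace at its own defect group. As `N` is normal, every
element of `G` that conjugates `Q` into `P` normalizes `Q`.

Lifting. Distinct conjugates of the block `fQ` are orthogonal, so `T = Tr_H(l)` is an idempotent; it
is also a trace from `P` of an element of `A(Q)^P`. Lift that element to `A^P` and take its trace to
`G`: by Mackey's formula (`br_relTrace`) the image under `Br_Q` is `T`. Fitting's lemma turns this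
trace, cut by `c`, into an idempotent of `A^G` with image exactly `T`. A primitive constituent `i`
with `Br_P(i) ≠ 0` has defect group `P`, lies under `c`, and satisfies `Br_Q(i) ≠ 0`, whence it
covers `c`.

Brauer pairs. If `Br_P(fQ) = 0`, then `l = fQ l` would be a proper trace at `P`. So there is a block
of `C(Q)(P)` under `Br_P(fQ)`, and any such block gives both inclusions, since multiplying by it
absorbs `fQ` (`exists_brauerPairLE`). -/

namespace BrauerPoints

noncomputable section

/-! ### Relative traces in representations -/

section Trace

variable {k : Type*} [Field k] {S : Type*} [Group S] {V : Type*} [AddCommGroup V] [Module k V]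

/-- The sum of the translates of `a` under representatives of the cosets of `R`. -/
def cosetSum (τ : Representation k S V) (R : Subgroup S) (a : V) : V :=
  ∑ᶠ x : S ⧸ R, τ x.out a

/-- The sum of the images of the relative traces from the proper subgroups. -/
def properTraces (τ : Representation k S V) : AddSubgroup V :=
  AddSubgroup.closure {v | ∃ R < (⊤ : Subgroup S), ∃ a, (∀ r ∈ R, τ r a = a) ∧
    v = cosetSum τ R a}

theorem apply_eq_of_mk_eq (τ : Representation k S V) {R : Subgroup S} {a : V}
    (ha : ∀ r ∈ R, τ r a = a) {x y : S} (h : (x : S ⧸ R) = y) : τ x a = τ y a := by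
  rw [QuotientGroup.eq] at h
  have h3 : y = x * (x⁻¹ * y) := by group
  rw [h3, map_mul, Module.End.mul_apply, ha _ h]

theorem apply_out_mk (τ : Representation k S V) {R : Subgroup S} {a : V}
    (ha : ∀ r ∈ R, τ r a = a) (x : S) : τ ((x : S ⧸ R).out) a = τ x a :=
  apply_eq_of_mk_eq τ ha (Quotient.out_eq _)

theorem apply_inv_apply (τ : Representation k S V) (s : S) (v : V) : τ s⁻¹ (τ s v) = v := by
  rw [← Module.End.mul_apply, ← map_mul]; simp

theorem rep_injective (τ : Representation k S V) (s : S) : Function.Injective (τ s) :=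
  Function.LeftInverse.injective (g := τ s⁻¹) (apply_inv_apply τ s)

/-- Sum along orbits: an orbit with stabilizer `R` contributes the trace from `R` of one of its
values, which is a proper trace unless the orbit is a fixed point. Mackey-type statements below are
instances, with `Ω` a set of cosets. -/
theorem finsum_mem_properTraces [Finite S] (τ : Representation k S V) {Ω : Type*} [Finite Ω]
    [MulAction S Ω] (F : Ω → V) (hF : ∀ (s : S) x, F (s • x) = τ s (F x))
    (h0 : ∀ x, (∀ s : S, s • x = x) → F x = 0) : ∑ᶠ x, F x ∈ properTraces τ := by
  classical
  have := Fintype.ofFinite Ω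
  have := Fintype.ofFinite S
  rw [← finsum_comp_equiv (MulAction.selfEquivSigmaOrbitsQuotientStabilizer S Ω).symm,
    finsum_eq_sum_of_fintype, Fintype.sum_sigma]
  refine AddSubgroup.sum_mem _ fun ω _ => ?_
  have hfix : ∀ r ∈ MulAction.stabilizer S ω.out, τ r (F ω.out) = F ω.out := by
    intro r hr
    rw [← hF, MulAction.mem_stabilizer_iff.1 hr]
  have key : ∑ x : S ⧸ MulAction.stabilizer S ω.out,
      F ((MulAction.selfEquivSigmaOrbitsQuotientStabilizer S Ω).symm ⟨ω, x⟩)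
      = cosetSum τ (MulAction.stabilizer S ω.out) (F ω.out) := by
    rw [cosetSum, finsum_eq_sum_of_fintype]
    refine Finset.sum_congr rfl fun y _ => ?_
    induction y using QuotientGroup.induction_on with | H s => ?_
    rw [apply_out_mk τ hfix, ← hF]
    rfl
  rw [key]
  by_cases hR : MulAction.stabilizer S ω.out = ⊤
  · have : F ω.out = 0 := h0 _ fun s => by
      have : s ∈ MulAction.stabilizer S ω.out := by rw [hR]; trivial
      exact this
    rw [cosetSum, this]
    simp
  · exact AddSubgroup.subset_closure ⟨_, lt_top_iff_ne_top.2 hR, _, hfix, rfl⟩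

theorem cosetSum_fixed [Finite S] (τ : Representation k S V) {R : Subgroup S} {a : V}
    (ha : ∀ r ∈ R, τ r a = a) (s : S) : τ s (cosetSum τ R a) = cosetSum τ R a := by
  have h1 := (τ s).toAddMonoidHom.map_finsum
      (f := fun x : S ⧸ R => τ x.out a) (Set.toFinite _)
  change τ s (cosetSum τ R a) = ∑ᶠ x : S ⧸ R, τ s _ at h1
  rw [h1, cosetSum, ← finsum_comp_equiv (MulAction.toPerm s) (f := fun x : S ⧸ R => τ x.out a)]
  refine finsum_congr fun x => ?_
  induction x using QuotientGroup.induction_on with | H x => ?_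
  change _ = τ (((s * x : S) : S ⧸ R).out) a
  rw [apply_out_mk τ ha, apply_out_mk τ ha, map_mul, Module.End.mul_apply]

theorem properTraces_fixed [Finite S] (τ : Representation k S V) {v : V}
    (hv : v ∈ properTraces τ) (s : S) : τ s v = v := by
  induction hv using AddSubgroup.closure_induction with
  | mem x hx =>
    obtain ⟨R, _, a, ha, rfl⟩ := hx
    exact cosetSum_fixed τ ha s
  | zero => simp
  | add x y _ _ hx hy => rw [map_add, hx, hy]
  | neg x _ hx => rw [map_neg, hx]

/-- An invariant map to a vector space of characteristic `p` kills the proper traces of a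
`p`-group. -/
theorem map_properTraces_eq_zero [Finite S] (p : ℕ) [Fact p.Prime] [CharP k p] (hS : IsPGroup p S)
    (τ : Representation k S V) {W : Type*} [AddCommGroup W] [Module k W] (f : V →+ W)
    (hf : ∀ s v, f (τ s v) = f v) {v : V} (hv : v ∈ properTraces τ) : f v = 0 := by
  induction hv using AddSubgroup.closure_induction with
  | mem x hx =>
    obtain ⟨R, hR, a, ha, rfl⟩ := hx
    rw [cosetSum, f.map_finsum (Set.toFinite _)]
    simp only [hf]
    have := Fintype.ofFinite (S ⧸ R)
    rw [finsum_eq_sum_of_fintype, Finset.sum_const, Finset.card_univ, ← Nat.card_eq_fintype_card]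
    -- All translates have the same image, so the trace goes to `|S : R|` times it, and this index
    -- is a positive power of `p`.
    obtain ⟨n, hn⟩ := hS.index R
    change R.index • f a = 0
    rw [hn]
    have hn0 : n ≠ 0 := by
      rintro rfl
      rw [pow_zero, Subgroup.index_eq_one] at hn
      exact hR.ne hn
    rw [← Nat.cast_smul_eq_nsmul k, Nat.cast_pow, CharP.cast_eq_zero, zero_pow hn0, zero_smul]
  | zero => simp
  | add x y _ _ hx hy => rw [map_add, hx, hy, add_zero]
  | neg x _ hx => rw [map_neg, hx, neg_zero]

theorem map_cosetSum [Finite S] {k' : Type*} [Field k'] (τ : Representation k S V)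
    {W : Type*} [AddCommGroup W] [Module k' W] (σ : Representation k' S W) (f : V →+ W)
    (hf : ∀ s v, f (τ s v) = σ s (f v)) (R : Subgroup S) (a : V) :
    f (cosetSum τ R a) = cosetSum σ R (f a) := by
  rw [cosetSum, cosetSum, f.map_finsum (Set.toFinite _)]
  exact finsum_congr fun x => hf _ _

/-- Equivariant additive maps preserve proper traces. -/
theorem map_mem_properTraces [Finite S] {k' : Type*} [Field k'] (τ : Representation k S V)
    {W : Type*} [AddCommGroup W] [Module k' W] (σ : Representation k' S W) (f : V →+ W)
    (hf : ∀ s v, f (τ s v) = σ s (f v)) {v : V} (hv : v ∈ properTraces τ) :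
    f v ∈ properTraces σ := by
  induction hv using AddSubgroup.closure_induction with
  | mem x hx =>
    obtain ⟨R, hR, a, ha, rfl⟩ := hx
    rw [map_cosetSum τ σ f hf]
    exact AddSubgroup.subset_closure ⟨R, hR, f a, fun r hr => by rw [← hf, ha r hr], rfl⟩
  | zero => simp [zero_mem]
  | add x y _ _ hx hy => rw [map_add]; exact add_mem hx hy
  | neg x _ hx => rw [map_neg]; exact neg_mem hx

end Trace

/-! ### Permutation bases -/

section PermutationBasis

variable {k : Type*} [Field k] {S : Type*} [Group S] {V : Type*} [AddCommGroup V] [Module k V]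
  {κ : Type*}

/-- An injective linear map that permutes a basis preserves the coordinates at fixed basis
elements. -/
theorem repr_apply_of_permutes (b : Module.Basis κ k V) (f : V →ₗ[k] V)
    (hf : Function.Injective f) (hb : ∀ i, ∃ j, f (b i) = b j) {i j : κ} (hi : f (b i) = b j)
    (v : V) : b.repr (f v) j = b.repr v i := by
  classical
  suffices h : (b.coord j).comp f = b.coord i from LinearMap.congr_fun h v
  refine b.ext fun m => ?_
  obtain ⟨m', hm'⟩ := hb m
  rw [LinearMap.comp_apply, hm', Module.Basis.coord_apply, Module.Basis.coord_apply,
    Module.Basis.repr_self, Module.Basis.repr_self, Finsupp.single_apply, Finsupp.single_apply]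
  refine if_congr ?_ rfl rfl
  constructor
  · rintro rfl
    exact b.injective (hf (hm'.trans hi.symm))
  · rintro rfl
    exact b.injective (hm'.symm.trans hi)

theorem exists_mulAction_of_permutes (b : Module.Basis κ k V) (τ : Representation k S V)
    (hb : ∀ s i, ∃ j, τ s (b i) = b j) :
    ∃ _ : MulAction S κ, ∀ (s : S) i, b (s • i) = τ s (b i) := by
  choose f hf using hb
  refine ⟨{ smul := f, one_smul := fun i => ?_, mul_smul := fun s t i => ?_ }, fun s i => (hf s i).symm⟩
  · refine b.injective ?_
    change b (f (s * t) i) = b (f s (f t i))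
    rw [← hf, ← hf, ← hf, map_mul, Module.End.mul_apply]
  · refine b.injective ?_
    change b (f 1 i) = b i
    rw [← hf, map_one, Module.End.one_apply]

/-- The coordinate at a fixed basis element is an invariant functional, so it kills proper traces.
Conversely the coordinates of a fixed vector are constant on orbits, and only the one-point orbits
fail to give proper traces. -/
theorem mem_properTraces_iff [Finite S] [Finite κ] (p : ℕ) [Fact p.Prime] [CharP k p]
    (hS : IsPGroup p S) (b : Module.Basis κ k V) (τ : Representation k S V)
    (hb : ∀ s i, ∃ j, τ s (b i) = b j) {v : V} (hv : ∀ s, τ s v = v) :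
    v ∈ properTraces τ ↔ ∀ i, (∀ s, τ s (b i) = b i) → b.repr v i = 0 := by
  constructor
  · intro h i hi
    exact map_properTraces_eq_zero (W := k) p hS τ (b.coord i).toAddMonoidHom
      (fun s v => repr_apply_of_permutes b (τ s) (rep_injective τ s) (hb s) (hi s) v) h
  · intro h
    obtain ⟨_, hact⟩ := exists_mulAction_of_permutes b τ hb
    have := Fintype.ofFinite κ
    have h1 := finsum_mem_properTraces τ (fun i => b.repr v i • b i) (fun s i => ?_) (fun i hi => ?_)
    · rwa [finsum_eq_sum_of_fintype, b.sum_repr] at h1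
    · rw [hact, LinearMap.map_smul, ← repr_apply_of_permutes b (τ s) (rep_injective τ s) (hb s)
        (hact s i).symm v, hv]
    · rw [h i (fun s => by rw [← hact, hi]), zero_smul]

/-- A basis of a subquotient that is cut out by a set of coordinates. -/
theorem exists_basis_of_coordinates [Finite κ] (b : Module.Basis κ k V) (T : Set κ)
    {W : Type*} [AddCommGroup W] [Module k W] (i : W →ₗ[k] V) {Y : Type*} [AddCommGroup Y]
    [Module k Y] (q : W →ₗ[k] Y) (hq : Function.Surjective q)
    (hT : ∀ t ∈ T, ∃ w, i w = b t) (hker : ∀ w, q w = 0 ↔ ∀ t ∈ T, b.repr (i w) t = 0) :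
    ∃ c : Module.Basis T k Y, (∀ (t : T) w, i w = b t → c t = q w) ∧
      ∀ w (t : T), c.repr (q w) t = b.repr (i w) t := by
  classical
  choose! w₀ hw₀ using hT
  have := Fintype.ofFinite κ
  have hqw : ∀ w, q w = ∑ t : T, b.repr (i w) t • q (w₀ t) := by
    intro w
    -- Subtracting the chosen lifts `w₀ t` removes precisely the coordinates in `T`, so the
    -- difference is in the kernel of `q`.
    have h : q (w - ∑ t : T, b.repr (i w) t • w₀ t) = 0 := by
      rw [hker]
      intro t ht
      rw [map_sub, map_sum, map_sub, map_sum, Finsupp.sub_apply, Finsupp.finsetSum_apply,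
        Finset.sum_eq_single (⟨t, ht⟩ : T)]
      · rw [map_smul, map_smul, hw₀ t ht]
        simp
      · intro s _ hs
        rw [map_smul, map_smul, hw₀ s s.2, Module.Basis.repr_self, Finsupp.smul_apply,
          Finsupp.single_apply, if_neg, smul_zero]
        exact fun h => hs (Subtype.ext h)
      · simp
    rw [map_sub, sub_eq_zero] at h
    rw [h, map_sum]
    simp
  have hli : LinearIndependent k (fun t : T => q (w₀ t)) := by
    rw [Fintype.linearIndependent_iff]
    intro g hg t
    have h : q (∑ t : T, g t • w₀ t) = 0 := by rw [map_sum, ← hg]; simp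
    rw [hker] at h
    have h1 := h t t.2
    rw [map_sum, map_sum, Finsupp.finsetSum_apply, Finset.sum_eq_single t] at h1
    · rw [map_smul, map_smul, hw₀ t t.2] at h1
      simpa using h1
    · intro s _ hs
      rw [map_smul, map_smul, hw₀ s s.2, Module.Basis.repr_self, Finsupp.smul_apply,
        Finsupp.single_apply, if_neg, smul_zero]
      exact fun h => hs (Subtype.ext h)
    · simp
  let c : Module.Basis T k Y := Module.Basis.mk hli (by
    rintro y -
    obtain ⟨w, rfl⟩ := hq y
    rw [hqw w]
    exact Submodule.sum_mem _ fun t _ =>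
      Submodule.smul_mem _ _ (Submodule.subset_span (Set.mem_range_self t)))
  have hc : ∀ t, c t = q (w₀ t) := fun t => Module.Basis.mk_apply _ _ _
  have hrepr : ∀ w (t : T), c.repr (q w) t = b.repr (i w) t := by
    intro w t
    rw [hqw w]
    simp only [← hc]
    rw [c.repr_sum_self]
  refine ⟨c, fun t w hw => ?_, hrepr⟩
  apply c.repr.injective
  ext s
  rw [hrepr, hw, Module.Basis.repr_self, Module.Basis.repr_self, Finsupp.single_apply,
    Finsupp.single_apply]
  simp [Subtype.ext_iff]

end PermutationBasis

/-! ### Relative traces and Brauer quotients -/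

section RelTrace

variable {k : Type*} [Field k] {M : Type*} [Group M] {B : Type*} [Ring B] [Algebra k B]

/-- The `k`-linear representation of a subgroup on an algebra with action. -/
def resRep (ρ : M →* (B ≃ₐ[k] B)) (P : Subgroup M) : Representation k P B where
  toFun g := (ρ g).toLinearMap
  map_one' := by ext; simp
  map_mul' g h := by ext; simp

@[simp] theorem resRep_apply (ρ : M →* (B ≃ₐ[k] B)) (P : Subgroup M) (g : P) (b : B) :
    resRep ρ P g b = ρ g b := rfl

theorem act_mul (ρ : M →* (B ≃ₐ[k] B)) (g h : M) (b : B) : ρ (g * h) b = ρ g (ρ h b) := by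
  rw [map_mul, AlgEquiv.mul_apply]

theorem fixedSubalgebra_anti (ρ : M →* (B ≃ₐ[k] B)) {R P : Subgroup M} (h : R ≤ P) :
    fixedSubalgebra ρ P ≤ fixedSubalgebra ρ R := fun _ hx g hg => hx g (h hg)

theorem fixed_subgroupOf {ρ : M →* (B ≃ₐ[k] B)} {R P : Subgroup M} {a : B}
    (ha : a ∈ fixedSubalgebra ρ R) : ∀ r ∈ R.subgroupOf P, resRep ρ P r a = a :=
  fun r hr => ha r (Subgroup.mem_subgroupOf.1 hr)

theorem relTrace_mem [Finite M] (ρ : M →* (B ≃ₐ[k] B)) {R : Subgroup M} (P : Subgroup M) {a : B}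
    (ha : a ∈ fixedSubalgebra ρ R) : relTrace ρ R P a ∈ fixedSubalgebra ρ P :=
  fun g hg => cosetSum_fixed (resRep ρ P) (fixed_subgroupOf ha) ⟨g, hg⟩

theorem map_relTrace [Finite M] (ρ : M →* (B ≃ₐ[k] B)) {B' : Type*} [Ring B'] [Algebra k B']
    (σ : M →* (B' ≃ₐ[k] B')) (f : B →+ B') (P : Subgroup M)
    (hf : ∀ g ∈ P, ∀ b, f (ρ g b) = σ g (f b)) (R : Subgroup M) (a : B) :
    f (relTrace ρ R P a) = relTrace σ R P (f a) :=
  map_cosetSum (resRep ρ P) (resRep σ P) f (fun s v => hf s s.2 v) _ _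

theorem mul_relTrace [Finite M] (ρ : M →* (B ≃ₐ[k] B)) (R : Subgroup M) {P : Subgroup M} {y : B}
    (hy : y ∈ fixedSubalgebra ρ P) (a : B) : y * relTrace ρ R P a = relTrace ρ R P (y * a) :=
  map_relTrace ρ ρ (AddMonoidHom.mulLeft y) P (fun g hg b => by simp [hy g hg]) R a

theorem relTrace_mul [Finite M] (ρ : M →* (B ≃ₐ[k] B)) (R : Subgroup M) {P : Subgroup M} {y : B}
    (hy : y ∈ fixedSubalgebra ρ P) (a : B) : relTrace ρ R P a * y = relTrace ρ R P (a * y) :=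
  map_relTrace ρ ρ (AddMonoidHom.mulRight y) P (fun g hg b => by simp [hy g hg]) R a

theorem mul_mem_properTraces [Finite M] (ρ : M →* (B ≃ₐ[k] B)) {P : Subgroup M} {y v : B}
    (hy : y ∈ fixedSubalgebra ρ P) (hv : v ∈ properTraces (resRep ρ P)) :
    y * v ∈ properTraces (resRep ρ P) :=
  map_mem_properTraces _ _ (AddMonoidHom.mulLeft y) (fun s b => by simp [hy s s.2]) hv

theorem properTraces_mul_mem [Finite M] (ρ : M →* (B ≃ₐ[k] B)) {P : Subgroup M} {y v : B}
    (hy : y ∈ fixedSubalgebra ρ P) (hv : v ∈ properTraces (resRep ρ P)) :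
    v * y ∈ properTraces (resRep ρ P) :=
  map_mem_properTraces _ _ (AddMonoidHom.mulRight y) (fun s b => by simp [hy s s.2]) hv

theorem relTrace_mem_properTraces_of_lt (ρ : M →* (B ≃ₐ[k] B)) {R P : Subgroup M} (hR : R < P)
    {a : B} (ha : a ∈ fixedSubalgebra ρ R) : relTrace ρ R P a ∈ properTraces (resRep ρ P) :=
  AddSubgroup.subset_closure ⟨R.subgroupOf P,
    lt_top_iff_ne_top.2 fun h => hR.not_ge (Subgroup.subgroupOf_eq_top.1 h), a,
    fixed_subgroupOf ha, rfl⟩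

/-- The Brauer ideal is given as the two-sided ideal generated by proper traces. Multiplication by a
`P`-fixed element commutes with traces, so the additive span of proper traces is already an ideal
and nothing is added. -/
theorem br_eq_zero_iff [Finite M] (ρ : M →* (B ≃ₐ[k] B)) (P : Subgroup M)
    (x : fixedSubalgebra ρ P) : br ρ P x = 0 ↔ (x : B) ∈ properTraces (resRep ρ P) := by
  constructor
  · intro h
    let I : TwoSidedIdeal (fixedSubalgebra ρ P) :=
      TwoSidedIdeal.mk' {x | (x : B) ∈ properTraces (resRep ρ P)}
        (zero_mem (properTraces (resRep ρ P)))
        (fun {a b} ha hb => (add_mem ha hb : (a : B) + b ∈ properTraces (resRep ρ P)))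
        (fun {a} ha => (neg_mem ha : -(a : B) ∈ properTraces (resRep ρ P)))
        (fun {a b} hb => mul_mem_properTraces ρ a.2 hb)
        (fun {a b} ha => properTraces_mul_mem ρ b.2 ha)
    have hI : ∀ y, y ∈ I ↔ (y : B) ∈ properTraces (resRep ρ P) := fun y =>
      TwoSidedIdeal.mem_mk' _ _ _ _ _ _ y
    have h1 : x ∈ brauerIdeal ρ P := (RingCon.eq _).1 h
    rw [← hI]
    refine (TwoSidedIdeal.span_le (I := I)).2 ?_ h1
    rintro y ⟨R, hR, a, ha, hy⟩
    rw [SetLike.mem_coe, hI, hy]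
    exact relTrace_mem_properTraces_of_lt ρ hR ha
  · intro h
    suffices H : ∀ v ∈ properTraces (resRep ρ P), ∃ hv : v ∈ fixedSubalgebra ρ P,
        (⟨v, hv⟩ : fixedSubalgebra ρ P) ∈ brauerIdeal ρ P by
      obtain ⟨_, h1⟩ := H x h
      exact br_eq_zero ρ P h1
    intro v hv
    induction hv using AddSubgroup.closure_induction with
    | mem v hv =>
      obtain ⟨R, hR, a, ha, rfl⟩ := hv
      have hR' : R.map P.subtype < P := by
        refine lt_of_le_of_ne (Subgroup.map_subtype_le R) fun h => hR.ne ?_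
        rw [eq_top_iff]
        intro g _
        have hg : (g : M) ∈ R.map P.subtype := by rw [h]; exact g.2
        obtain ⟨g', hg', h2⟩ := hg
        rwa [← Subtype.ext h2]
      have ha' : a ∈ fixedSubalgebra ρ (R.map P.subtype) := by
        rintro _ ⟨g, hg, rfl⟩
        exact ha g hg
      have hrel : relTrace ρ (R.map P.subtype) P a = cosetSum (resRep ρ P) R a := by
        have : (R.map P.subtype).subgroupOf P = R :=
          Subgroup.comap_map_eq_self_of_injective (Subgroup.subtype_injective P) R
        change cosetSum (resRep ρ P) ((R.map P.subtype).subgroupOf P) a = _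
        rw [this]
      refine ⟨hrel ▸ relTrace_mem ρ P ha', TwoSidedIdeal.subset_span ⟨_, hR', a, ha', hrel.symm⟩⟩
    | zero => exact ⟨zero_mem _, zero_mem (brauerIdeal ρ P)⟩
    | add x y _ _ hx hy =>
      obtain ⟨hx, hx'⟩ := hx
      obtain ⟨hy, hy'⟩ := hy
      exact ⟨add_mem hx hy, add_mem hx' hy'⟩
    | neg x _ hx =>
      obtain ⟨hx, hx'⟩ := hx
      exact ⟨neg_mem hx, neg_mem hx'⟩

theorem br_eq_iff [Finite M] (ρ : M →* (B ≃ₐ[k] B)) (P : Subgroup M)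
    (x y : fixedSubalgebra ρ P) :
    br ρ P x = br ρ P y ↔ (x : B) - y ∈ properTraces (resRep ρ P) := by
  rw [← sub_eq_zero, ← map_sub, br_eq_zero_iff]; rfl

theorem br_surjective (ρ : M →* (B ≃ₐ[k] B)) (P : Subgroup M) : Function.Surjective (br ρ P) :=
  Quotient.mk_surjective

/-- A relative trace from a subgroup that contains no conjugate of `S` is killed by the Brauer
homomorphism at `S`. -/
theorem relTrace_mem_properTraces [Finite M] (ρ : M →* (B ≃ₐ[k] B)) {R S L : Subgroup M}
    (hSL : S ≤ L) {a : B} (ha : a ∈ fixedSubalgebra ρ R)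
    (h : ∀ g ∈ L, ¬ ∀ s ∈ S, g⁻¹ * s * g ∈ R) :
    relTrace ρ R L a ∈ properTraces (resRep ρ S) := by
  let _ : MulAction S (L ⧸ R.subgroupOf L) := MulAction.compHom _ (Subgroup.inclusion hSL)
  refine finsum_mem_properTraces (resRep ρ S) _ (fun s x => ?_) (fun x hx => ?_)
  · induction x using QuotientGroup.induction_on with | H x => ?_
    change resRep ρ L (((Subgroup.inclusion hSL s * x : L) : L ⧸ R.subgroupOf L).out) a
      = ρ s (resRep ρ L ((x : L ⧸ R.subgroupOf L).out) a)
    rw [apply_out_mk _ (fixed_subgroupOf ha), apply_out_mk _ (fixed_subgroupOf ha)]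
    exact act_mul ρ s x a
  · exfalso
    induction x using QuotientGroup.induction_on with | H x => ?_
    refine h x x.2 fun s hs => ?_
    have h1 : ((Subgroup.inclusion hSL ⟨s, hs⟩ * x : L) : L ⧸ R.subgroupOf L) = x := hx ⟨s, hs⟩
    rw [eq_comm, QuotientGroup.eq, Subgroup.mem_subgroupOf] at h1
    simpa [mul_assoc] using h1

/-- Used to show that a trace from a subgroup smaller than the proposed defect group dies in the
Brauer quotient there; comparing orders avoids any discussion of conjugacy. -/
theorem relTrace_mem_properTraces_of_card_lt [Finite M] (ρ : M →* (B ≃ₐ[k] B))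
    {R S L : Subgroup M} (hSL : S ≤ L) {a : B} (ha : a ∈ fixedSubalgebra ρ R)
    (h : Nat.card R < Nat.card S) : relTrace ρ R L a ∈ properTraces (resRep ρ S) := by
  refine relTrace_mem_properTraces ρ hSL ha fun g _ hg => h.not_ge ?_
  refine Nat.card_le_card_of_injective (fun s : S => (⟨g⁻¹ * s * g, hg s s.2⟩ : R)) ?_
  intro s t hst
  have := congrArg Subtype.val hst
  simpa using this

theorem relTrace_trans [Finite M] (ρ : M →* (B ≃ₐ[k] B)) {K H L : Subgroup M} (hKH : K ≤ H)
    (hHL : H ≤ L) {a : B} (ha : a ∈ fixedSubalgebra ρ K) :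
    relTrace ρ H L (relTrace ρ K H a) = relTrace ρ K L a := by
  let e : (L ⧸ H.subgroupOf L) × (H ⧸ K.subgroupOf H) → L ⧸ K.subgroupOf L :=
    fun z => ((z.1.out * Subgroup.inclusion hHL z.2.out : L) : L ⧸ K.subgroupOf L)
  have hkey : ∀ x x' : L ⧸ H.subgroupOf L, ∀ y y' : H ⧸ K.subgroupOf H,
      e (x, y) = e (x', y') → x = x' ∧ y = y' := by
    intro x x' y y' h
    rw [QuotientGroup.eq, Subgroup.mem_subgroupOf] at h
    have hx : x = x' := by
      rw [← Quotient.out_eq x, ← Quotient.out_eq x']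
      refine QuotientGroup.eq.2 (Subgroup.mem_subgroupOf.2 ?_)
      have h2 := H.mul_mem (H.mul_mem y.out.2 (hKH h)) (H.inv_mem y'.out.2)
      simpa [mul_assoc] using h2
    subst hx
    refine ⟨rfl, ?_⟩
    rw [← Quotient.out_eq y, ← Quotient.out_eq y']
    refine QuotientGroup.eq.2 (Subgroup.mem_subgroupOf.2 ?_)
    simpa [mul_assoc] using h
  have he : Function.Bijective e := by
    constructor
    · rintro ⟨x, y⟩ ⟨x', y'⟩ h
      obtain ⟨rfl, rfl⟩ := hkey x x' y y' h
      rfl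
    · intro z
      induction z using QuotientGroup.induction_on with | H g => ?_
      have h1 : (((g : L ⧸ H.subgroupOf L).out)⁻¹ * g : L) ∈ H.subgroupOf L :=
        QuotientGroup.eq.1 (Quotient.out_eq _)
      let h : H := ⟨_, Subgroup.mem_subgroupOf.1 h1⟩
      refine ⟨((g : L ⧸ H.subgroupOf L), (h : H ⧸ K.subgroupOf H)), ?_⟩
      refine QuotientGroup.eq.2 (Subgroup.mem_subgroupOf.2 ?_)
      have h2 : ((h : H ⧸ K.subgroupOf H).out)⁻¹ * h ∈ K.subgroupOf H :=
        QuotientGroup.eq.1 (Quotient.out_eq _)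
      simpa [h, mul_assoc, Subgroup.mem_subgroupOf] using h2
  have := Fintype.ofFinite (L ⧸ H.subgroupOf L)
  have := Fintype.ofFinite (H ⧸ K.subgroupOf H)
  change _ = ∑ᶠ x : L ⧸ K.subgroupOf L, resRep ρ L x.out a
  rw [← finsum_comp_equiv (Equiv.ofBijective e he), finsum_eq_sum_of_fintype,
    Fintype.sum_prod_type, relTrace, finsum_eq_sum_of_fintype]
  refine Finset.sum_congr rfl fun x _ => ?_
  rw [relTrace, finsum_eq_sum_of_fintype, map_sum]
  refine Finset.sum_congr rfl fun y _ => ?_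
  change _ = resRep ρ L ((e (x, y)).out) a
  rw [apply_out_mk _ (fixed_subgroupOf ha), ← act_mul]
  rfl

/-- A defect group of an idempotent of an algebra over a field of characteristic `p` is a
`p`-group. -/
theorem IsDefectGroup.isPGroup [Finite M] (p : ℕ) [Fact p.Prime] [CharP k p]
    {ρ : M →* (B ≃ₐ[k] B)} {L D : Subgroup M} {e : B} (h : IsDefectGroup ρ L D e) :
    IsPGroup p D := by
  obtain ⟨hDL, ⟨a, ha, hae⟩, hmin⟩ := h
  obtain ⟨S⟩ : Nonempty (Sylow p D) := inferInstance
  let R : Subgroup M := (S : Subgroup D).map D.subtype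
  have hRD : R ≤ D := Subgroup.map_subtype_le _
  have hRS : R.subgroupOf D = S :=
    Subgroup.comap_map_eq_self_of_injective (Subgroup.subtype_injective D) _
  -- The index of a Sylow subgroup is invertible in `k`, so every `D`-fixed `a` is the trace from it
  -- of `a` divided by the index. Minimality of `D` then forces `D` to be its own Sylow subgroup.
  have hidx : ((S : Subgroup D).index : k) ≠ 0 := by
    rw [Ne, CharP.cast_eq_zero_iff k p]
    exact S.not_dvd_index
  rcases hRD.eq_or_lt with hR | hR
  · rw [← hR]
    exact S.2.map _
  · exfalso
    have ha' : ((S : Subgroup D).index : k)⁻¹ • a ∈ fixedSubalgebra ρ D :=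
      Subalgebra.smul_mem _ ha _
    refine hmin R hR ⟨((S : Subgroup D).index : k)⁻¹ • a, fixedSubalgebra_anti ρ hRD ha', ?_⟩
    rw [← relTrace_trans ρ hRD hDL (fixedSubalgebra_anti ρ hRD ha'), ← hae]
    congr 1
    rw [relTrace]
    have : ∀ x : D ⧸ R.subgroupOf D, ρ (x.out : D) (((S : Subgroup D).index : k)⁻¹ • a)
        = ((S : Subgroup D).index : k)⁻¹ • a := fun x => ha' _ x.out.2
    simp only [this]
    have := Fintype.ofFinite (D ⧸ R.subgroupOf D)
    rw [finsum_eq_sum_of_fintype, Finset.sum_const, Finset.card_univ, ← Nat.card_eq_fintype_card]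
    change (R.subgroupOf D).index • _ = _
    rw [hRS, ← Nat.cast_smul_eq_nsmul k, smul_smul, mul_inv_cancel₀ hidx, one_smul]

/-- The Brauer homomorphism at `Q` of a relative trace from `D ≥ Q`, if only elements of `N_M(Q)`
conjugate `Q` into `D`. -/
theorem br_relTrace [Finite M] (ρ : M →* (B ≃ₐ[k] B)) {Q D L : Subgroup M} (hQD : Q ≤ D)
    (hDL : D ≤ L)
    (h : ∀ g ∈ L, (∀ s ∈ Q, g⁻¹ * s * g ∈ D) → g ∈ Subgroup.normalizer (Q : Set M))
    {a : B} (ha : a ∈ fixedSubalgebra ρ D) (haQ : a ∈ fixedSubalgebra ρ Q)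
    (ht : relTrace ρ D L a ∈ fixedSubalgebra ρ Q) :
    br ρ Q ⟨relTrace ρ D L a, ht⟩
      = relTrace (brauerAction ρ Q) (down Q D) (down Q L) (br ρ Q ⟨a, haQ⟩) := by
  classical
  have hQL := hQD.trans hDL
  have := Fintype.ofFinite (L ⧸ D.subgroupOf L)
  have := Fintype.ofFinite (down Q L ⧸ (down Q D).subgroupOf (down Q L))
  have hR : relTrace (brauerAction ρ Q) (down Q D) (down Q L) (br ρ Q ⟨a, haQ⟩)
      = br ρ Q (∑ x : down Q L ⧸ (down Q D).subgroupOf (down Q L),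
        fixedEnd ρ Q x.out ⟨a, haQ⟩) := by
    rw [relTrace, finsum_eq_sum_of_fintype, map_sum]
    rfl
  rw [hR, br_eq_iff]
  let _ : MulAction Q (L ⧸ D.subgroupOf L) := MulAction.compHom _ (Subgroup.inclusion hQL)
  have hsmul : ∀ (s : Q) (x : L), s • (x : L ⧸ D.subgroupOf L)
    = ((Subgroup.inclusion hQL s * x : L) : L ⧸ D.subgroupOf L) := fun _ _ => rfl
  have hfix : ∀ x : L, (∀ s : Q, s • (x : L ⧸ D.subgroupOf L) = x) ↔
      ∀ s ∈ Q, (x : M)⁻¹ * s * x ∈ D := by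
    intro x
    refine ⟨fun hx s hs => ?_, fun hx s => ?_⟩
    · have h1 := hx ⟨s, hs⟩
      rw [hsmul, eq_comm, QuotientGroup.eq, Subgroup.mem_subgroupOf] at h1
      simpa [mul_assoc] using h1
    · rw [hsmul, eq_comm, QuotientGroup.eq, Subgroup.mem_subgroupOf]
      simpa [mul_assoc] using hx s s.2
  let F : L ⧸ D.subgroupOf L → B := fun x => resRep ρ L x.out a
  have hFe : ∀ (s : Q) x, F (s • x) = ρ s (F x) := by
    intro s x
    induction x using QuotientGroup.induction_on with | H x => ?_
    change resRep ρ L (((Subgroup.inclusion hQL s * x : L) : L ⧸ D.subgroupOf L).out) a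
      = ρ s (resRep ρ L ((x : L ⧸ D.subgroupOf L).out) a)
    rw [apply_out_mk _ (fixed_subgroupOf ha), apply_out_mk _ (fixed_subgroupOf ha)]
    exact act_mul ρ s x a
  have hfs : ∀ (s : Q) (x : L ⧸ D.subgroupOf L),
      (∀ t : Q, t • s • x = s • x) ↔ ∀ t : Q, t • x = x := by
    refine fun s x => ⟨fun hx t => ?_, fun hx t => by rw [hx s, hx t]⟩
    have h1 := hx (s * t * s⁻¹)
    rw [smul_smul, inv_mul_cancel_right, mul_smul] at h1
    exact MulAction.injective s h1
  -- `Q` acts on the cosets of `D` in `L`. The non-fixed orbits give proper traces at `Q`; replacing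
  -- the summand by zero at fixed cosets isolates them.
  have h1 := finsum_mem_properTraces (resRep ρ Q)
    (fun x => if ∀ s : Q, s • x = x then 0 else F x)
    (fun s x => by
      simp only [hfs, hFe]
      split_ifs <;> simp) (fun x hx => if_pos hx)
  convert h1 using 1
  rw [finsum_eq_sum_of_fintype]
  change relTrace ρ D L a - _ = _
  rw [sub_eq_iff_eq_add]
  -- A coset `xD` is fixed by `Q` iff `x⁻¹Qx ≤ D`. By `h` these `x` normalize `Q`, so the fixed
  -- cosets are those of `D ∩ N(Q)` in `L ∩ N(Q)`.
  have h2 : ((∑ x : down Q L ⧸ (down Q D).subgroupOf (down Q L),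
      fixedEnd ρ Q x.out ⟨a, haQ⟩ : fixedSubalgebra ρ Q) : B)
      = ∑ x, if ∀ s : Q, s • x = x then F x else 0 := by
    rw [AddSubmonoidClass.coe_finsetSum]
    refine Fintype.sum_of_injective
      (fun x => ((⟨x.out, x.out.2⟩ : L) : L ⧸ D.subgroupOf L)) ?_ _ _ ?_ ?_
    · intro x y hxy
      have h3 := QuotientGroup.eq.1 hxy
      rw [← Quotient.out_eq x, ← Quotient.out_eq y]
      exact QuotientGroup.eq.2 h3
    · intro x hx
      rw [if_neg]
      intro hf
      induction x using QuotientGroup.induction_on with | H x => ?_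
      have hxQ := h x x.2 ((hfix x).1 hf)
      let y : down Q L := ⟨⟨x, hxQ⟩, Subgroup.mem_subgroupOf.2 x.2⟩
      refine hx ⟨(y : down Q L ⧸ (down Q D).subgroupOf (down Q L)), ?_⟩
      have h4 : ((y : down Q L ⧸ (down Q D).subgroupOf (down Q L)).out)⁻¹ * y
        ∈ (down Q D).subgroupOf (down Q L) := QuotientGroup.eq.1 (Quotient.out_eq _)
      exact QuotientGroup.eq.2 h4
    · intro x
      rw [if_pos]
      · change _ = resRep ρ L (((⟨x.out, x.out.2⟩ : L) : L ⧸ D.subgroupOf L).out) a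
        rw [apply_out_mk _ (fixed_subgroupOf ha)]
        rfl
      · rw [hfix]
        intro s hs
        refine hQD ((Subgroup.mem_normalizer_iff''.1 (x.out : down Q L).1.2 s).1 hs)
  rw [h2, ← Finset.sum_add_distrib, relTrace, finsum_eq_sum_of_fintype]
  refine Finset.sum_congr rfl fun x _ => ?_
  split_ifs
  · rw [zero_add]; rfl
  · rw [add_zero]; rfl

end RelTrace

/-! ### Permutation bases of Brauer quotients -/

section PermutationAlgebra

variable {k : Type*} [Field k] {M : Type*} [Group M] {B : Type*} [Ring B] [Algebra k B]
  {κ : Type*}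

/-- The subgroup `P` permutes the basis `b`. -/
def Permutes (ρ : M →* (B ≃ₐ[k] B)) (P : Subgroup M) (b : Module.Basis κ k B) : Prop :=
  ∀ g ∈ P, ∀ i, ∃ j, ρ g (b i) = b j

theorem Permutes.mono {ρ : M →* (B ≃ₐ[k] B)} {R P : Subgroup M} {b : Module.Basis κ k B}
    (h : Permutes ρ P b) (hR : R ≤ P) : Permutes ρ R b := fun g hg => h g (hR hg)

theorem mem_properTraces_iff_of_permutes [Finite M] [Finite κ] (p : ℕ) [Fact p.Prime] [CharP k p]
    {ρ : M →* (B ≃ₐ[k] B)} {P : Subgroup M} (hP : IsPGroup p P) {b : Module.Basis κ k B}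
    (hb : Permutes ρ P b) {x : B} (hx : x ∈ fixedSubalgebra ρ P) :
    x ∈ properTraces (resRep ρ P) ↔ ∀ i, (∀ g ∈ P, ρ g (b i) = b i) → b.repr x i = 0 := by
  rw [mem_properTraces_iff p hP b (resRep ρ P) (fun s i => hb s s.2 i) (fun s => hx s s.2)]
  simp

/-- A basis element fixed by `P` is fixed by `R`, so the vanishing conditions at `P` are among those
at `R`. -/
theorem properTraces_mono_of_permutes [Finite M] [Finite κ] (p : ℕ) [Fact p.Prime] [CharP k p]
    {ρ : M →* (B ≃ₐ[k] B)} {R P : Subgroup M} (hP : IsPGroup p P) (hRP : R ≤ P)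
    {b : Module.Basis κ k B} (hb : Permutes ρ P b) {x : B} (hx : x ∈ fixedSubalgebra ρ P)
    (h : x ∈ properTraces (resRep ρ R)) : x ∈ properTraces (resRep ρ P) := by
  rw [mem_properTraces_iff_of_permutes p hP hb hx]
  rw [mem_properTraces_iff_of_permutes p (hP.to_le hRP) (hb.mono hRP)
    (fixedSubalgebra_anti ρ hRP hx)] at h
  exact fun i hi => h i fun g hg => hi g (hRP hg)

theorem exists_basis_brauerQuotient [Finite M] [Finite κ] (p : ℕ) [Fact p.Prime] [CharP k p]
    {ρ : M →* (B ≃ₐ[k] B)} {Q : Subgroup M} (hQ : IsPGroup p Q) {b : Module.Basis κ k B}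
    (hb : Permutes ρ Q b) :
    ∃ c : Module.Basis {i | ∀ g ∈ Q, ρ g (b i) = b i} k (BrauerQuotient ρ Q),
      (∀ (t : {i : κ | ∀ g ∈ Q, ρ g (b i) = b i}) (h : b t ∈ fixedSubalgebra ρ Q), c t = br ρ Q ⟨b t, h⟩) ∧
      ∀ x t, c.repr (br ρ Q x) t = b.repr x t := by
  obtain ⟨c, hc1, hc2⟩ := exists_basis_of_coordinates b {i | ∀ g ∈ Q, ρ g (b i) = b i}
    (fixedSubalgebra ρ Q).val.toLinearMap (br ρ Q).toLinearMap (br_surjective ρ Q)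
    (fun t ht => ⟨⟨b t, ht⟩, rfl⟩)
    (fun w => by
      change br ρ Q w = 0 ↔ _
      rw [br_eq_zero_iff, mem_properTraces_iff_of_permutes p hQ hb w.2]
      rfl)
  exact ⟨c, fun t h => hc1 t ⟨b t, h⟩ rfl, hc2⟩

/-- The last clause keeps track of how the action on the basis of `B(Q)` comes from that on `B`; it
is needed to compare `P`-fixed basis elements in the two algebras. -/
theorem exists_permutes_brauerQuotient [Finite M] [Finite κ] (p : ℕ) [Fact p.Prime] [CharP k p]
    {ρ : M →* (B ≃ₐ[k] B)} {Q : Subgroup M} (hQ : IsPGroup p Q)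
    (P : Subgroup (Subgroup.normalizer (Q : Set M))) (hQP : Q ≤ up Q P) {b : Module.Basis κ k B}
    (hb : Permutes ρ (up Q P) b) :
    ∃ c : Module.Basis {i | ∀ g ∈ Q, ρ g (b i) = b i} k (BrauerQuotient ρ Q),
      (∀ x t, c.repr (br ρ Q x) t = b.repr x t) ∧ Permutes (brauerAction ρ Q) P c ∧
      ∀ (m : Subgroup.normalizer (Q : Set M)) (t s : {i : κ | ∀ g ∈ Q, ρ g (b i) = b i}), ρ m (b t) = b s →
        brauerAction ρ Q m (c t) = c s := by
  obtain ⟨c, hc1, hc2⟩ := exists_basis_brauerQuotient p hQ (hb.mono hQP)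
  have key : ∀ (m : Subgroup.normalizer (Q : Set M)) (t s : {i : κ | ∀ g ∈ Q, ρ g (b i) = b i}), ρ m (b t) = b s →
      brauerAction ρ Q m (c t) = c s := by
    intro m t s h
    rw [hc1 t t.2, hc1 s s.2, brauerAction_br]
    congr 1
    exact Subtype.ext h
  refine ⟨c, hc2, fun m hm t => ?_, key⟩
  obtain ⟨s, hs⟩ := hb m (Subgroup.mem_map_of_mem _ hm) t
  have hsQ : b s ∈ fixedSubalgebra ρ Q := by
    rw [← hs]
    exact (fixedEnd ρ Q m ⟨b t, t.2⟩).2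
  exact ⟨⟨s, hsQ⟩, key m t ⟨s, hsQ⟩ hs⟩

theorem mem_up {Q : Subgroup M} {P : Subgroup (Subgroup.normalizer (Q : Set M))}
    {m : Subgroup.normalizer (Q : Set M)} : (m : M) ∈ up Q P ↔ m ∈ P :=
  Subgroup.mem_map_iff_mem (Subgroup.subtype_injective _)

theorem br_mem_fixed [Finite M] (ρ : M →* (B ≃ₐ[k] B)) {Q : Subgroup M}
    {P : Subgroup (Subgroup.normalizer (Q : Set M))} {x : fixedSubalgebra ρ Q}
    (hx : (x : B) ∈ fixedSubalgebra ρ (up Q P)) :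
    br ρ Q x ∈ fixedSubalgebra (brauerAction ρ Q) P := by
  intro m hm
  rw [brauerAction_br]
  congr 1
  exact Subtype.ext (hx m (mem_up.2 hm))

/-- The kernel of `Br_P` on `B^P` agrees with that of `Br_P ∘ Br_Q`. -/
theorem mem_properTraces_iff_br [Finite M] [Finite κ] (p : ℕ) [Fact p.Prime] [CharP k p]
    {ρ : M →* (B ≃ₐ[k] B)} {Q : Subgroup M} (hQ : IsPGroup p Q)
    {P : Subgroup (Subgroup.normalizer (Q : Set M))} (hP : IsPGroup p P) (hQP : Q ≤ up Q P)
    {b : Module.Basis κ k B} (hb : Permutes ρ (up Q P) b) {x : fixedSubalgebra ρ Q}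
    (hx : (x : B) ∈ fixedSubalgebra ρ (up Q P)) :
    (x : B) ∈ properTraces (resRep ρ (up Q P)) ↔
      br ρ Q x ∈ properTraces (resRep (brauerAction ρ Q) P) := by
  obtain ⟨c, hc, hcP, hcact⟩ := exists_permutes_brauerQuotient p hQ P hQP hb
  rw [mem_properTraces_iff_of_permutes p (hP.map _) hb hx,
    mem_properTraces_iff_of_permutes p hP hcP (br_mem_fixed ρ hx)]
  -- Both sides concern the same coordinates: a basis element fixed by `P` is fixed by `Q ≤ P`, and
  -- its image is a `P`-fixed basis element of `B(Q)`; every `P`-fixed one arises so.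
  constructor
  · intro h i hi
    rw [hc]
    refine h i fun g hg => ?_
    obtain ⟨m, hm, rfl⟩ := hg
    obtain ⟨s, hs⟩ := hb m (Subgroup.mem_map_of_mem _ hm) i
    have hsQ : b s ∈ fixedSubalgebra ρ Q := by
      rw [← hs]
      exact (fixedEnd ρ Q m ⟨b i, i.2⟩).2
    have h1 := hcact m i ⟨s, hsQ⟩ hs
    rw [hi m hm] at h1
    have h2 := congrArg Subtype.val (c.injective h1)
    change (i : κ) = s at h2
    change ρ m (b i) = b i
    rw [hs, h2]
  · intro h i hi
    have hiQ : ∀ g ∈ Q, ρ g (b i) = b i := fun g hg => hi g (hQP hg)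
    have h1 := h ⟨i, hiQ⟩ fun m hm => hcact m _ _ (hi m (Subgroup.mem_map_of_mem _ hm))
    rwa [hc] at h1

/-- The Brauer homomorphism `B^P → B(Q)^P` is surjective. -/
theorem exists_br_eq [Finite M] [Finite κ] (p : ℕ) [Fact p.Prime] [CharP k p]
    {ρ : M →* (B ≃ₐ[k] B)} {Q : Subgroup M} (hQ : IsPGroup p Q)
    {P : Subgroup (Subgroup.normalizer (Q : Set M))} (hQP : Q ≤ up Q P)
    {b : Module.Basis κ k B} (hb : Permutes ρ (up Q P) b) {y : BrauerQuotient ρ Q}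
    (hy : y ∈ fixedSubalgebra (brauerAction ρ Q) P) :
    ∃ x : fixedSubalgebra ρ Q, (x : B) ∈ fixedSubalgebra ρ (up Q P) ∧ br ρ Q x = y := by
  classical
  obtain ⟨c, hc, hcP, hcact⟩ := exists_permutes_brauerQuotient p hQ P hQP hb
  have := Fintype.ofFinite κ
  -- The lift has the coordinates of `y` at the `Q`-fixed basis elements and zero elsewhere. It is
  -- `P`-fixed because `P` normalizes `Q` and so permutes the `Q`-fixed basis elements.
  let f : κ → k := fun i => if h : ∀ g ∈ Q, ρ g (b i) = b i then c.repr y ⟨i, h⟩ else 0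
  let x : B := ∑ i, f i • b i
  have hx : x ∈ fixedSubalgebra ρ (up Q P) := by
    rintro _ ⟨m, hm, rfl⟩
    apply b.repr.injective
    ext j
    obtain ⟨i, hi⟩ := hb _ (Subgroup.inv_mem _ (Subgroup.mem_map_of_mem _ hm)) j
    have hij : ρ m (b i) = b j := by
      rw [← hi, ← act_mul]
      simp
    have h1 := repr_apply_of_permutes b (ρ m).toLinearMap (ρ m).injective
      (hb m (Subgroup.mem_map_of_mem _ hm)) hij x
    change b.repr (ρ m x) j = _
    change b.repr (ρ m x) j = _ at h1
    rw [h1]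
    simp only [x, b.repr_sum_self]
    by_cases hiQ : ∀ g ∈ Q, ρ g (b i) = b i
    · have hjQ : ∀ g ∈ Q, ρ g (b j) = b j := by
        rw [← hij]
        exact (fixedEnd ρ Q m ⟨b i, hiQ⟩).2
      have h2 := repr_apply_of_permutes c (brauerAction ρ Q m).toLinearMap
        (brauerAction ρ Q m).injective (hcP m hm) (hcact m ⟨i, hiQ⟩ ⟨j, hjQ⟩ hij) y
      change c.repr (brauerAction ρ Q m y) _ = _ at h2
      rw [hy m hm] at h2
      simp only [f]
      rw [dif_pos hiQ, dif_pos hjQ, h2]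
    · have hjQ : ¬ ∀ g ∈ Q, ρ g (b j) = b j := by
        intro hjQ
        refine hiQ ?_
        rw [← hi]
        exact (fixedEnd ρ Q m⁻¹ ⟨b j, hjQ⟩).2
      simp only [f]
      rw [dif_neg hiQ, dif_neg hjQ]
  refine ⟨⟨x, fixedSubalgebra_anti ρ hQP hx⟩, hx, ?_⟩
  apply c.repr.injective
  ext t
  rw [hc]
  change b.repr (∑ i, f i • b i) t = _
  rw [b.repr_sum_self]
  exact dif_pos t.2

theorem IsPPermutation.exists_basis {p : ℕ} {ρ : M →* (B ≃ₐ[k] B)} (h : IsPPermutation p ρ)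
    {P : Subgroup M} (hP : IsPGroup p P) :
    ∃ (s : Set B) (b : Module.Basis s k B), Permutes ρ P b := by
  obtain ⟨s, hli, hsp, hst⟩ := h P hP
  have hb : ∀ i : s, Module.Basis.mk (v := fun i : s => (i : B)) hli (by simp [hsp]) i = i :=
    fun i => Module.Basis.mk_apply _ _ _
  refine ⟨s, Module.Basis.mk (v := fun i : s => (i : B)) hli (by simp [hsp]), fun g hg i => ?_⟩
  exact ⟨⟨ρ g i, hst g hg i i.2⟩, by rw [hb, hb]⟩

end PermutationAlgebra

/-! ### Idempotents in finite-dimensional algebras -/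

section Idempotents

variable {k : Type*} [Field k] {E : Type*} [Ring E] [Algebra k E]

/-- Fitting's lemma: a power of `t` is killed by the complement of an idempotent that is a
multiple of `t`. -/
theorem exists_fitting_idempotent [FiniteDimensional k E] (t : E) :
    ∃ (n : ℕ) (q : E), Commute t q ∧ IsIdempotentElem (t * q) ∧ t ^ n * (1 - t * q) = 0 := by
  have hint : IsIntegral k t := IsIntegral.of_finite k t
  have hm0 : minpoly k t ≠ 0 := minpoly.ne_zero hint
  obtain ⟨g, hg, hndvd⟩ := Polynomial.exists_eq_pow_rootMultiplicity_mul_and_not_dvd _ hm0 0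
  set n := (minpoly k t).rootMultiplicity 0
  rw [Polynomial.C_0, sub_zero] at hg hndvd
  -- With minimal polynomial `X^n g` and `g` prime to `X`, the Bézout relation for `X^(n+1)` and `g`
  -- splits `1` into two idempotents at `t`. The exponent `n + 1` instead of `n` makes the first a
  -- multiple of `t` even if `n = 0`.
  have hcop : IsCoprime (Polynomial.X ^ (n + 1) : Polynomial k) g :=
    (Polynomial.prime_X.irreducible.coprime_iff_not_dvd.2 hndvd).pow_left
  obtain ⟨a, c, hac⟩ := hcop
  have hte : Polynomial.aeval t (Polynomial.X ^ n * g) = 0 := by rw [← hg, minpoly.aeval]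
  have hz : Polynomial.aeval t (Polynomial.X ^ n * (c * g)) = 0 := by
    rw [mul_left_comm, map_mul, hte, mul_zero]
  let q := Polynomial.aeval t (Polynomial.X ^ n * a)
  have hq : t * q = Polynomial.aeval t (a * Polynomial.X ^ (n + 1)) := by
    rw [show a * Polynomial.X ^ (n + 1) = Polynomial.X * (Polynomial.X ^ n * a) by ring,
      map_mul, Polynomial.aeval_X]
  have h1 : 1 - t * q = Polynomial.aeval t (c * g) := by
    rw [hq, sub_eq_iff_eq_add', ← map_add, hac, map_one]
  have h2 : t ^ n * (1 - t * q) = 0 := by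
    rw [h1, ← hz, map_mul _ (Polynomial.X ^ n), map_pow, Polynomial.aeval_X]
  refine ⟨n, q, ?_, ?_, h2⟩
  · have h3 := Commute.all (Polynomial.X : Polynomial k) (Polynomial.X ^ n * a)
    have h4 := h3.map (Polynomial.aeval t)
    rwa [Polynomial.aeval_X] at h4
  · have h3 : t * q * (1 - t * q) = 0 := by
      rw [h1, hq, ← map_mul,
        show a * Polynomial.X ^ (n + 1) * (c * g)
          = a * Polynomial.X * (Polynomial.X ^ n * (c * g)) by ring, map_mul, hz, mul_zero]
    rw [mul_sub, mul_one, sub_eq_zero] at h3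
    exact h3.symm

/-- An element of the corner of a primitive idempotent `e` is nilpotent or has `e` as a
multiple. -/
theorem IsPrimitiveIdempotent.isNilpotent_or [FiniteDimensional k E] {e x : E}
    (he : IsPrimitiveIdempotent e) (hex : e * x = x) (hxe : x * e = x) :
    IsNilpotent x ∨ ∃ q, Commute x q ∧ e = x * q := by
  obtain ⟨n, q, hcomm, hid, hn⟩ := exists_fitting_idempotent (k := k) x
  have h1 : e * (x * q) = x * q := by rw [← mul_assoc, hex]
  have h2 : x * q * e = x * q := by rw [hcomm.eq, mul_assoc, hxe]
  rcases he.2.2 (x * q) (e - x * q) hid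
    (by
      change (e - x * q) * (e - x * q) = e - x * q
      rw [mul_sub, sub_mul, sub_mul, he.1.eq, h1, h2, hid.eq, sub_self, sub_zero])
    (by rw [mul_sub, h2, hid.eq, sub_self]) (by rw [sub_mul, h1, hid.eq, sub_self])
    (add_sub_cancel _ _) with h | h
  · left
    refine ⟨n, ?_⟩
    rwa [h, sub_zero, mul_one] at hn
  · exact Or.inr ⟨q, hcomm, sub_eq_zero.1 h⟩

/-- With `isNilpotent_add` this expresses that the corner of `e` is local. If `x y` were not
nilpotent, `x` would have a right inverse in the corner, and cancelling powers of the nilpotent `x`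
would give `e = 0`. -/
theorem IsPrimitiveIdempotent.isNilpotent_mul [FiniteDimensional k E] {e x y : E}
    (he : IsPrimitiveIdempotent e) (hex : e * x = x) (hey : e * y = y)
    (hye : y * e = y) (hx : IsNilpotent x) : IsNilpotent (x * y) := by
  rcases he.isNilpotent_or (k := k) (x := x * y) (by rw [← mul_assoc, hex])
    (by rw [mul_assoc, hye]) with h | ⟨q, -, hq⟩
  · exact h
  · exfalso
    have h0 : ∀ m, x ^ m * e = 0 → e = 0 := by
      intro m
      induction m with
      | zero => simp
      | succ m ih =>
        intro h
        refine ih ?_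
        have h1 : x ^ m * e = x ^ (m + 1) * e * y * q := by
          conv_lhs => rw [hq]
          rw [mul_assoc (x ^ (m + 1)), hey, pow_succ]
          simp only [mul_assoc]
        rw [h1, h, zero_mul, zero_mul]
    obtain ⟨n, hn⟩ := hx
    exact he.2.1 (h0 n (by rw [hn, zero_mul]))

/-- If `x + y` had an inverse `q'` in the corner, `x q'` and `y q'` would be nilpotent with sum `e`.
They then commute, so `e` would be nilpotent. -/
theorem IsPrimitiveIdempotent.isNilpotent_add [FiniteDimensional k E] {e x y : E}
    (he : IsPrimitiveIdempotent e) (hex : e * x = x) (hxe : x * e = x) (hey : e * y = y)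
    (hye : y * e = y) (hx : IsNilpotent x) (hy : IsNilpotent y) : IsNilpotent (x + y) := by
  rcases he.isNilpotent_or (k := k) (x := x + y) (by rw [mul_add, hex, hey])
    (by rw [add_mul, hxe, hye]) with h | ⟨q, -, hq⟩
  · exact h
  · exfalso
    have hq' : e = (x + y) * (e * q * e) := by
      rw [← mul_assoc, ← mul_assoc, add_mul x y e, hxe, hye, ← hq, he.1.eq]
    have hqe : e * (e * q * e) = e * q * e := by rw [← mul_assoc, ← mul_assoc, he.1.eq]
    have heq : e * q * e * e = e * q * e := by rw [mul_assoc, he.1.eq]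
    have h1 := he.isNilpotent_mul (k := k) hex hqe heq hx
    have h2 := he.isNilpotent_mul (k := k) hey hqe heq hy
    have h3 : y * (e * q * e) = e - x * (e * q * e) := by
      rw [eq_sub_iff_add_eq', ← add_mul, ← hq']
    have hcomm : Commute (x * (e * q * e)) (y * (e * q * e)) := by
      rw [h3]
      refine Commute.sub_right ?_ (Commute.refl _)
      change _ * e = e * _
      rw [mul_assoc x, heq, ← mul_assoc e x, hex]
    have h4 := hcomm.isNilpotent_add h1 h2
    rw [← add_mul, ← hq'] at h4
    obtain ⟨n, hn⟩ := h4
    refine he.2.1 ?_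
    rw [← he.1.pow_succ_eq n, pow_succ, hn, zero_mul]

/-- Rosenberg's lemma: if a primitive idempotent is a sum of elements of `S` and their negatives,
then it lies in the ideal generated by one of them. -/
theorem IsPrimitiveIdempotent.exists_of_mem_closure [FiniteDimensional k E] {e : E}
    (he : IsPrimitiveIdempotent e) {S : Set E} (h : e ∈ AddSubgroup.closure S) :
    ∃ x ∈ S, ∃ q, e = e * x * e * q := by
  by_contra! hcon
  have hl : ∀ x : E, e * (e * x * e) = e * x * e := fun x => by
    rw [← mul_assoc, ← mul_assoc, he.1.eq]
  have hr : ∀ x : E, e * x * e * e = e * x * e := fun x => by rw [mul_assoc, he.1.eq]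
  have key : ∀ v ∈ AddSubgroup.closure S, IsNilpotent (e * v * e) := by
    intro v hv
    induction hv using AddSubgroup.closure_induction with
    | mem x hx =>
      rcases he.isNilpotent_or (k := k) (hl x) (hr x) with h | ⟨q, -, hq⟩
      · exact h
      · exact absurd hq (hcon x hx q)
    | zero => simp
    | add x y _ _ hx hy =>
      rw [mul_add, add_mul]
      exact he.isNilpotent_add (k := k) (hl x) (hr x) (hl y) (hr y) hx hy
    | neg x _ hx => rw [mul_neg, neg_mul]; exact hx.neg
  obtain ⟨n, hn⟩ := key e h
  rw [he.1.eq, he.1.eq] at hn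
  refine he.2.1 ?_
  rw [← he.1.pow_succ_eq n, pow_succ, hn, zero_mul]

/-- An idempotent on which an additive map does not vanish has a primitive constituent on which
the map does not vanish. -/
theorem exists_primitive_le [FiniteDimensional k E] {W : Type*} [AddCommGroup W] (f : E →+ W)
    {e : E} (he : IsIdempotentElem e) (hf : f e ≠ 0) :
    ∃ i, IsPrimitiveIdempotent i ∧ e * i = i ∧ i * e = i ∧ f i ≠ 0 := by
  -- Induction on the dimension of the right ideal `eE`: if `e` splits as `a + b`, one summand still
  -- has non-zero image, and its right ideal is strictly smaller because the other summand is
  -- non-zero.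
  induction hn : Module.finrank k (LinearMap.range (LinearMap.mulLeft k e)) using
    Nat.strong_induction_on generalizing e with
  | _ n ih =>
    by_cases hprim : IsPrimitiveIdempotent e
    · exact ⟨e, hprim, he, he, hf⟩
    have he0 : e ≠ 0 := by
      rintro rfl
      exact hf (map_zero f)
    have hex : ∃ a b : E, IsIdempotentElem a ∧ a * b = 0 ∧ b * a = 0 ∧ a + b = e ∧ b ≠ 0 ∧
        f a ≠ 0 := by
      unfold IsPrimitiveIdempotent at hprim
      push Not at hprim
      obtain ⟨a, b, ha, hb, hab, hba, hsum, ha0, hb0⟩ := hprim he he0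
      by_cases hfa : f a = 0
      · refine ⟨b, a, hb, hba, hab, by rw [add_comm, hsum], ha0, fun hfb => hf ?_⟩
        rw [← hsum, map_add, hfa, hfb, add_zero]
      · exact ⟨a, b, ha, hab, hba, hsum, hb0, hfa⟩
    obtain ⟨a, b, ha, hab, hba, rfl, hb0, hfa⟩ := hex
    have h1 : (a + b) * a = a := by rw [add_mul, ha.eq, hba, add_zero]
    have h2 : a * (a + b) = a := by rw [mul_add, ha.eq, hab, add_zero]
    have hlt : LinearMap.range (LinearMap.mulLeft k a)
        < LinearMap.range (LinearMap.mulLeft k (a + b)) := by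
      refine lt_of_le_of_ne ?_ fun heq => ?_
      · rintro _ ⟨x, rfl⟩
        exact ⟨a * x, by simp [← mul_assoc, h1]⟩
      · have hb : b ∈ LinearMap.range (LinearMap.mulLeft k a) := by
          rw [heq]
          refine ⟨b, ?_⟩
          have h3 := he.eq
          rw [mul_add, h1] at h3
          exact add_left_cancel h3
        obtain ⟨x, hx⟩ := hb
        rw [LinearMap.mulLeft_apply] at hx
        refine hb0 ?_
        rw [← hx, ← ha.eq, mul_assoc, hx, hab]
    obtain ⟨i, hi, h3, h4, h5⟩ := ih _ (hn ▸ Submodule.finrank_lt_finrank_of_lt hlt) ha hfa rfl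
    refine ⟨i, hi, ?_, ?_, h5⟩
    · rw [← h3, ← mul_assoc, h1]
    · rw [← h4, mul_assoc, h2]

theorem exists_block_le [FiniteDimensional k E] {e : E} (he : IsIdempotentElem e)
    (hc : e ∈ Subring.center E) (h0 : e ≠ 0) : ∃ f : E, IsBlock f ∧ e * f = f := by
  obtain ⟨i, hi, h1, -, -⟩ := exists_primitive_le (k := k) (E := Subalgebra.center k E)
    (AddMonoidHom.id _) (e := ⟨e, hc⟩) (Subtype.ext he) (fun h => h0 (congrArg Subtype.val h))
  refine ⟨i, ⟨i.2, Subtype.ext (congrArg Subtype.val hi.1),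
    fun h => hi.2.1 (Subtype.ext (congrArg Subtype.val h)), fun a b ha hb hab hba hsum => ?_⟩,
    congrArg Subtype.val h1⟩
  rcases hi.2.2 ⟨a, a.2⟩ ⟨b, b.2⟩ (Subtype.ext (congrArg Subtype.val ha))
    (Subtype.ext (congrArg Subtype.val hb)) (Subtype.ext (congrArg Subtype.val hab))
    (Subtype.ext (congrArg Subtype.val hba)) (Subtype.ext (congrArg Subtype.val hsum)) with h | h
  · exact Or.inl (Subtype.ext (congrArg Subtype.val h))
  · exact Or.inr (Subtype.ext (congrArg Subtype.val h))

end Idempotents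

/-! ### Defect groups of primitive idempotents -/

section Defect

variable {k : Type*} [Field k] {M : Type*} [Group M] [Finite M] {B : Type*} [Ring B] [Algebra k B]
  [FiniteDimensional k B]

/-- The Brauer homomorphism at a defect group does not kill a primitive idempotent. -/
theorem IsDefectGroup.notMem_properTraces {ρ : M →* (B ≃ₐ[k] B)} {L D : Subgroup M}
    {e : fixedSubalgebra ρ L} (he : IsPrimitiveIdempotent e) (hD : IsDefectGroup ρ L D e) :
    (e : B) ∉ properTraces (resRep ρ D) := by
  intro hmem
  obtain ⟨hDL, ⟨a, ha, hae⟩, hmin⟩ := hD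
  let S : Set (fixedSubalgebra ρ L) := {z | ∃ R < D, ∃ a ∈ fixedSubalgebra ρ R,
    relTrace ρ R L a = z}
  let f : B →+ B :=
    { toFun := relTrace ρ D L
      map_zero' := by simp [relTrace]
      map_add' := fun x y => by
        simp only [relTrace, map_add]
        exact finsum_add_distrib (Set.toFinite _) (Set.toFinite _) }
  -- By transitivity, `Tr_D^L` sends proper traces at `D` to sums of traces from subgroups `R < D`.
  -- Applied to `e a`, where `Tr_D^L(a) = e`, this writes `e` as such a sum; Rosenberg's lemma then
  -- singles out one `R`, against minimality of `D`.
  have key : ∀ v ∈ properTraces (resRep ρ D), ∃ h : f v ∈ fixedSubalgebra ρ L,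
      (⟨f v, h⟩ : fixedSubalgebra ρ L) ∈ AddSubgroup.closure S := by
    intro v hv
    induction hv using AddSubgroup.closure_induction with
    | mem v hv =>
      obtain ⟨R, hR, a, ha, rfl⟩ := hv
      have hR' : R.map D.subtype < D := by
        refine lt_of_le_of_ne (Subgroup.map_subtype_le R) fun h => hR.ne ?_
        rw [eq_top_iff]
        intro g _
        have hg : (g : M) ∈ R.map D.subtype := by rw [h]; exact g.2
        obtain ⟨g', hg', h2⟩ := hg
        rwa [← Subtype.ext h2]
      have ha' : a ∈ fixedSubalgebra ρ (R.map D.subtype) := by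
        rintro _ ⟨g, hg, rfl⟩
        exact ha g hg
      have hrel : cosetSum (resRep ρ D) R a = relTrace ρ (R.map D.subtype) D a := by
        have : (R.map D.subtype).subgroupOf D = R :=
          Subgroup.comap_map_eq_self_of_injective (Subgroup.subtype_injective D) R
        change _ = cosetSum (resRep ρ D) ((R.map D.subtype).subgroupOf D) a
        rw [this]
      have htr : f (cosetSum (resRep ρ D) R a) = relTrace ρ (R.map D.subtype) L a := by
        rw [hrel]
        exact relTrace_trans ρ hR'.le hDL ha'
      exact ⟨htr ▸ relTrace_mem ρ L ha', AddSubgroup.subset_closure ⟨_, hR', a, ha', htr.symm⟩⟩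
    | zero =>
      refine ⟨by rw [map_zero]; exact zero_mem _, ?_⟩
      convert zero_mem (AddSubgroup.closure S)
      exact map_zero f
    | add x y _ _ hx hy =>
      obtain ⟨hx, hx'⟩ := hx
      obtain ⟨hy, hy'⟩ := hy
      refine ⟨by rw [map_add]; exact add_mem hx hy, ?_⟩
      convert add_mem hx' hy'
      exact map_add f x y
    | neg x _ hx =>
      obtain ⟨hx, hx'⟩ := hx
      refine ⟨by rw [map_neg]; exact neg_mem hx, ?_⟩
      convert neg_mem hx'
      exact map_neg f x
  obtain ⟨h1, h2⟩ := key _ (properTraces_mul_mem ρ ha hmem)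
  have h3 : (⟨f (e * a), h1⟩ : fixedSubalgebra ρ L) = e := by
    refine Subtype.ext ?_
    change relTrace ρ D L (e * a) = e
    rw [← mul_relTrace ρ D e.2, hae]
    exact congrArg Subtype.val he.1
  rw [h3] at h2
  obtain ⟨x, ⟨R, hR, b, hb, hx⟩, q, hq⟩ := he.exists_of_mem_closure (k := k) h2
  have hRL := hR.le.trans hDL
  refine hmin R hR ⟨e * b * e * q, mul_mem (mul_mem (mul_mem (fixedSubalgebra_anti ρ hRL e.2) hb)
    (fixedSubalgebra_anti ρ hRL e.2)) (fixedSubalgebra_anti ρ hRL q.2), ?_⟩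
  rw [← relTrace_mul ρ R q.2, ← relTrace_mul ρ R e.2, ← mul_relTrace ρ R e.2, hx]
  exact (congrArg Subtype.val hq).symm

end Defect

/-! ### Free actions from projectivity -/

section Free

variable {k : Type*} [Field k] {S : Type*} [Group S] [Finite S] {V : Type*} [AddCommGroup V]
  [Module k V]

/-- Higman's criterion for projective modules. -/
theorem exists_higman (τ : Representation k S V)
    (h : Module.Projective (MonoidAlgebra k S) τ.asModule) :
    ∃ θ : V → V, ∀ x, ∑ᶠ s : S, τ s (θ (τ s⁻¹ x)) = x := by
  classical
  have := Fintype.ofFinite S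
  obtain ⟨f, hf⟩ := h.out
  -- Here `f` is a section of the free module on `V` over `V`. The map `θ` keeps only the
  -- coefficient at the identity of the group; translating the argument by `s⁻¹` moves the
  -- coefficient at `s` to that place, so the translates of `θ` add up to the whole section.
  refine ⟨fun x => (f (τ.asModuleEquiv.symm x)).sum
    fun m y => y.coeff 1 • τ.asModuleEquiv m, fun x => ?_⟩
  have hcoeff : ∀ s : S, (f (τ.asModuleEquiv.symm (τ s⁻¹ x))).sum
      (fun m y => y.coeff 1 • τ.asModuleEquiv m)
      = (f (τ.asModuleEquiv.symm x)).sum fun m y => y.coeff s • τ.asModuleEquiv m := by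
    intro s
    rw [Representation.asModuleEquiv_symm_map_rho, map_smul, Finsupp.sum_smul_index']
    · refine Finsupp.sum_congr fun m _ => ?_
      rw [smul_eq_mul, MonoidAlgebra.of_apply, MonoidAlgebra.coeff_single_mul_apply]
      simp
    · simp
  simp only [hcoeff]
  have h1 := congrArg τ.asModuleEquiv (hf (τ.asModuleEquiv.symm x))
  rw [Finsupp.linearCombination_apply, map_finsuppSum] at h1
  rw [LinearEquiv.apply_symm_apply] at h1
  rw [finsum_eq_sum_of_fintype]
  conv_rhs => rw [← h1]
  simp only [map_finsuppSum]
  simp only [Finsupp.sum]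
  rw [Finset.sum_comm]
  refine Finset.sum_congr rfl fun m _ => ?_
  rw [Representation.asModuleEquiv_map_smul, Representation.asAlgebraHom_def,
    MonoidAlgebra.lift_apply, Finsupp.sum_fintype _ _ (by simp), LinearMap.sum_apply]
  simp

/-- A `p`-subgroup that fixes an element of a permutation basis of a projective module is
trivial. -/
theorem eq_one_of_projective (p : ℕ) [Fact p.Prime] [CharP k p] (τ : Representation k S V)
    (h : Module.Projective (MonoidAlgebra k S) τ.asModule) {κ : Type*} (b : Module.Basis κ k V)
    (hb : ∀ s i, ∃ j, τ s (b i) = b j) {D : Subgroup S} (hD : IsPGroup p D) {i : κ}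
    (hi : ∀ s ∈ D, τ s (b i) = b i) {s : S} (hs : s ∈ D) : s = 1 := by
  by_contra hne
  obtain ⟨θ, hθ⟩ := exists_higman τ h
  -- The values `F s` add up to the coordinate of `b i` at `i`, which is `1`. As `D` fixes `b i`,
  -- `F` is constant on the orbits of `D` on `S` by left translation. These are free, so a
  -- non-trivial `D` would make the sum zero in characteristic `p`.
  let F : S → k := fun s => b.repr (τ s (θ (τ s⁻¹ (b i)))) i
  have hF : ∀ (t : D) (x : S), F (t • x) = Representation.trivial k D k t (F x) := by
    intro t x
    change b.repr (τ (t * x) (θ (τ (t * x)⁻¹ (b i)))) i = b.repr (τ x (θ (τ x⁻¹ (b i)))) i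
    rw [map_mul, Module.End.mul_apply, mul_inv_rev, map_mul, Module.End.mul_apply,
      hi _ (D.inv_mem t.2), repr_apply_of_permutes b (τ t) (rep_injective τ t) (hb t) (hi t t.2)]
  have h1 := finsum_mem_properTraces (Representation.trivial k D k) F hF (fun x hx => by
    exact absurd (mul_eq_right.1 (hx ⟨s, hs⟩)) hne)
  have h2 := map_properTraces_eq_zero p hD _ (AddMonoidHom.id k) (fun _ _ => rfl) h1
  have h3 := (b.coord i).toAddMonoidHom.map_finsum
    (f := fun s : S => τ s (θ (τ s⁻¹ (b i)))) (Set.toFinite _)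
  change b.repr (∑ᶠ s : S, τ s (θ (τ s⁻¹ (b i)))) i = ∑ᶠ s, F s at h3
  rw [hθ, b.repr_self, Finsupp.single_eq_same] at h3
  rw [← h3] at h2
  exact one_ne_zero h2

end Free

/-! ### A `p`-group acts trivially modulo the radical -/

section Radical

/-- The orbit of a non-zero vector spans a finite `P`-stable space over `ZMod p`. Its order is
divisible by `p`, hence so is its number of fixed points, and zero is not the only one. -/
theorem exists_fixed_ne_zero (p : ℕ) [Fact p.Prime] {P : Type*} [Group P] [Finite P]
    (hP : IsPGroup p P) {M : Type*} [AddCommGroup M] [Nontrivial M] [DistribMulAction P M]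
    [Module (ZMod p) M] : ∃ m : M, m ≠ 0 ∧ ∀ u : P, u • m = m := by
  obtain ⟨v, hv⟩ := exists_ne (0 : M)
  let W : Submodule (ZMod p) M := Submodule.span (ZMod p) (Set.range fun u : P => u • v)
  have hW : ∀ (u : P) (w : M), w ∈ W → u • w ∈ W := by
    intro u w hw
    induction hw using Submodule.span_induction with
    | mem x hx =>
      obtain ⟨t, rfl⟩ := hx
      exact Submodule.subset_span ⟨u * t, mul_smul u t v⟩
    | zero => rw [smul_zero]; exact zero_mem _
    | add x y _ _ hx hy => rw [smul_add]; exact add_mem hx hy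
    | smul a x _ hx =>
      have := ZMod.map_smul (DistribSMul.toAddMonoidHom M u) a x
      change u • a • x = a • u • x at this
      rw [this]
      exact Submodule.smul_mem _ _ hx
  have : Module.Finite (ZMod p) W := Module.Finite.span_of_finite _ (Set.finite_range _)
  have : Finite W := Module.finite_of_finite (ZMod p)
  let _ : MulAction P W :=
    { smul := fun u w => ⟨u • (w : M), hW u w w.2⟩
      one_smul := fun w => Subtype.ext (one_smul P (w : M))
      mul_smul := fun s t w => Subtype.ext (mul_smul s t (w : M)) }
  have hvW : v ∈ W := Submodule.subset_span ⟨1, one_smul P v⟩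
  have hord : addOrderOf (⟨v, hvW⟩ : W) = p :=
    addOrderOf_eq_prime (Subtype.ext (ZModModule.char_nsmul_eq_zero p v)) (fun h => hv (congrArg Subtype.val h))
  have hdvd : p ∣ Nat.card W := hord.symm.dvd.trans (addOrderOf_dvd_natCard _)
  obtain ⟨w, hw, hw0⟩ := hP.exists_fixed_point_of_prime_dvd_card_of_fixed_point W hdvd (a := 0)
    (fun u => Subtype.ext (smul_zero u))
  exact ⟨w, fun h => hw0 (Subtype.ext h.symm), fun u => congrArg Subtype.val (hw u)⟩

/-- A `p`-group of units that is normalized by a set of additive generators acts trivially modulo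
the radical. -/
theorem sub_one_mem_jacobson {k : Type*} [Field k] (p : ℕ) [Fact p.Prime] [CharP k p]
    {P : Type*} [Group P] [Finite P] (hP : IsPGroup p P) {R : Type*} [Ring R] [Algebra k R]
    (η : P →* Rˣ)
    (hspan : AddSubgroup.closure {x : R | ∀ u : P, ∃ u' : P, η u * x = x * η u'} = ⊤) (u : P) :
    ((η u : R) - 1) ∈ Ring.jacobson R := by
  rw [Ring.jacobson, Module.jacobson, Submodule.mem_sInf]
  intro I hI
  have : IsSimpleModule R (R ⧸ I) := isSimpleModule_iff_isCoatom.2 hI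
  have : Nontrivial (R ⧸ I) := IsSimpleModule.nontrivial R _
  let _ : DistribMulAction P (R ⧸ I) := DistribMulAction.compHom _ ((Units.coeHom R).comp η)
  have hsm : ∀ (u : P) (m : R ⧸ I), u • m = (η u : R) • m := fun _ _ => rfl
  let _ : Module (ZMod p) (R ⧸ I) := AddCommGroup.zmodModule fun m => by
    rw [← Nat.cast_smul_eq_nsmul R, ← map_natCast (algebraMap k R), CharP.cast_eq_zero, map_zero,
      zero_smul]
  obtain ⟨m, hm, hfix⟩ := exists_fixed_ne_zero p hP (M := R ⧸ I)
  -- A normalizing element `x` sends the fixed vector `m` to a fixed vector, since `u x m = x u' m =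
  -- x m`. Such elements generate `R` additively and `m` generates the simple module, so the group
  -- fixes all of `R ⧸ I`, in particular the class of `1`.
  have htop : ∀ r : R, ∀ u : P, (η u : R) • r • m = r • m := by
    intro r
    have hr : r ∈ AddSubgroup.closure {x : R | ∀ u : P, ∃ u' : P, (η u : R) * x = x * η u'} := by
      rw [hspan]; trivial
    induction hr using AddSubgroup.closure_induction with
    | mem x hx =>
      intro u
      obtain ⟨u', hu'⟩ := hx u
      rw [smul_smul, hu', ← smul_smul, ← hsm, hfix]
    | zero => simp
    | add x y _ _ hx hy => intro u; rw [add_smul, smul_add, hx, hy]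
    | neg x _ hx => intro u; rw [neg_smul, smul_neg, hx]
  obtain ⟨r, hr⟩ := Submodule.mem_span_singleton.1
    (show Submodule.Quotient.mk 1 ∈ Submodule.span R {m} by
      rw [IsSimpleModule.span_singleton_eq_top R hm]; trivial)
  have h1 := htop r u
  rw [hr, ← Submodule.Quotient.mk_smul, smul_eq_mul, mul_one] at h1
  exact (Submodule.Quotient.eq I).1 h1

end Radical

/-! ### The extended Brauer quotient -/

section Extended

variable {k : Type*} [Field k] {G : Type*} [Group G] {A : Type*} [Ring A] [Algebra k A]

theorem conjAction_apply (ι : G →* Aˣ) (g : G) (a : A) :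
    conjAction k ι g a = ι g * a * ((ι g)⁻¹ : Aˣ) := rfl

/-- The action `u ↦ (a ↦ φ(u) a u⁻¹)` of `Q` on `A`. -/
def twistRep (k : Type*) [Field k] {A : Type*} [Ring A] [Algebra k A] (ι : G →* Aˣ)
    (Q : Subgroup G) (φ : MulAut Q) : Representation k Q A where
  toFun u := LinearMap.mulLeft k (ι (φ u) : A) ∘ₗ LinearMap.mulRight k (((ι u)⁻¹ : Aˣ) : A)
  map_one' := by ext; simp
  map_mul' u v := by ext; simp [mul_assoc]

theorem twistRep_apply (ι : G →* Aˣ) (Q : Subgroup G) (φ : MulAut Q) (u : Q) (a : A) :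
    twistRep k ι Q φ u a = ι (φ u) * a * ((ι u)⁻¹ : Aˣ) := by
  simp [twistRep, mul_assoc]

theorem twistRep_eq_self_iff (ι : G →* Aˣ) (Q : Subgroup G) (φ : MulAut Q) (u : Q) (a : A) :
    twistRep k ι Q φ u a = a ↔ ι (φ u) * a = a * ι u := by
  rw [twistRep_apply, Units.mul_inv_eq_iff_eq_mul]

theorem twistedTrace_eq (ι : G →* Aˣ) (Q : Subgroup G) (φ : MulAut Q) (R : Subgroup Q) (a : A) :
    twistedTrace ι Q φ R a = cosetSum (twistRep k ι Q φ) R a :=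
  finsum_congr fun _ => (twistRep_apply ι Q φ _ a).symm

theorem mem_extNum_single_iff (ι : G →* Aˣ) (Q : Subgroup G) (φ : MulAut Q) (a : A) :
    MonoidAlgebra.single φ a ∈ extNum k ι Q ↔ ∀ u : Q, (ι (φ u) : A) * a = a * ι u := by
  classical
  constructor
  · intro h u
    have := h φ u
    simpa using this
  · intro h ψ u
    simp only [MonoidAlgebra.coeff_single, Finsupp.single_apply]
    split_ifs with hψ
    · subst hψ
      exact h u
    · simp

theorem coeff_fixed {ι : G →* Aˣ} {Q : Subgroup G} (x : extNum k ι Q) (φ : MulAut Q) (u : Q) :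
    twistRep k ι Q φ u ((x : MonoidAlgebra A (MulAut Q)).coeff φ)
      = (x : MonoidAlgebra A (MulAut Q)).coeff φ :=
  (twistRep_eq_self_iff ι Q φ u _).2 (x.2 φ u)

theorem mul_mem_properTraces_twistRep [Finite G] {ι : G →* Aˣ} {Q : Subgroup G} {ψ φ : MulAut Q}
    {a v : A} (ha : ∀ u : Q, (ι (ψ u) : A) * a = a * ι u)
    (hv : v ∈ properTraces (twistRep k ι Q φ)) : a * v ∈ properTraces (twistRep k ι Q (ψ * φ)) :=
  map_mem_properTraces _ _ (AddMonoidHom.mulLeft a) (fun s b => by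
    rw [twistRep_apply, twistRep_apply, MulAut.mul_apply]
    simp only [AddMonoidHom.coe_mulLeft]
    rw [← mul_assoc, ← mul_assoc, ← mul_assoc, ha]) hv

/-- Unlike left multiplication, right multiplication by an element of degree `ψ` is equivariant only
up to `ψ`: a twisted trace from `R` becomes one from `ψ⁻¹(R)`, with the cosets reindexed by `ψ`. -/
theorem properTraces_twistRep_mul_mem [Finite G] {ι : G →* Aˣ} {Q : Subgroup G} {ψ φ : MulAut Q}
    {a v : A} (ha : ∀ u : Q, (ι (ψ u) : A) * a = a * ι u)
    (hv : v ∈ properTraces (twistRep k ι Q φ)) : v * a ∈ properTraces (twistRep k ι Q (φ * ψ)) := by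
  have hinv : ∀ u : Q, (((ι (ψ u))⁻¹ : Aˣ) : A) * a = a * ((ι u)⁻¹ : Aˣ) := by
    intro u
    rw [Units.inv_mul_eq_iff_eq_mul, ← mul_assoc, ha, mul_assoc, Units.mul_inv, mul_one]
  induction hv using AddSubgroup.closure_induction with
  | mem x hx =>
    obtain ⟨R, hR, b, hb, rfl⟩ := hx
    have hpre : ∀ r ∈ R.comap ψ.toMonoidHom, twistRep k ι Q (φ * ψ) r (b * a) = b * a := by
      intro r hr
      rw [twistRep_eq_self_iff, MulAut.mul_apply, mul_assoc, ← ha, ← mul_assoc, ← mul_assoc,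
        (twistRep_eq_self_iff ι Q φ (ψ r) b).1 (hb _ hr)]
    refine AddSubgroup.subset_closure ⟨R.comap ψ.toMonoidHom, ?_, b * a, hpre, ?_⟩
    · refine lt_top_iff_ne_top.2 fun h => hR.ne ?_
      rw [eq_top_iff]
      intro u _
      have h1 : ψ⁻¹ u ∈ R.comap ψ.toMonoidHom := by rw [h]; trivial
      have h2 : ψ (ψ⁻¹ u) ∈ R := h1
      rwa [MulAut.apply_inv_self] at h2
    · let e : Q ⧸ R.comap ψ.toMonoidHom → Q ⧸ R := fun x => ((ψ x.out : Q) : Q ⧸ R)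
      have he : Function.Bijective e := by
        constructor
        · intro x y hxy
          rw [← Quotient.out_eq x, ← Quotient.out_eq y]
          refine QuotientGroup.eq.2 ?_
          have := QuotientGroup.eq.1 hxy
          rw [← map_inv, ← map_mul] at this
          exact this
        · intro y
          induction y using QuotientGroup.induction_on with | H u => ?_
          refine ⟨((ψ⁻¹ u : Q) : Q ⧸ R.comap ψ.toMonoidHom), QuotientGroup.eq.2 ?_⟩
          have h1 : (((ψ⁻¹ u : Q) : Q ⧸ R.comap ψ.toMonoidHom).out)⁻¹ * ψ⁻¹ u
            ∈ R.comap ψ.toMonoidHom := QuotientGroup.eq.1 (Quotient.out_eq _)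
          have h2 : ψ ((((ψ⁻¹ u : Q) : Q ⧸ R.comap ψ.toMonoidHom).out)⁻¹ * ψ⁻¹ u) ∈ R := h1
          rwa [map_mul, map_inv, MulAut.apply_inv_self] at h2
      have h3 := (AddMonoidHom.mulRight a).map_finsum
        (f := fun x : Q ⧸ R => twistRep k ι Q φ x.out b) (Set.toFinite _)
      change cosetSum (twistRep k ι Q φ) R b * a
        = ∑ᶠ x : Q ⧸ R, twistRep k ι Q φ x.out b * a at h3
      rw [h3, ← finsum_comp_equiv (Equiv.ofBijective e he)]
      refine finsum_congr fun x => ?_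
      change twistRep k ι Q φ ((ψ x.out : Q) : Q ⧸ R).out b * a = _
      rw [apply_out_mk _ hb, twistRep_apply, twistRep_apply, MulAut.mul_apply, mul_assoc, hinv]
      simp only [mul_assoc]
  | zero => rw [zero_mul]; exact zero_mem _
  | add x y _ _ hx hy => rw [add_mul]; exact add_mem hx hy
  | neg x _ hx => rw [neg_mul]; exact neg_mem hx

theorem single_mem_extIdeal [Finite G] (ι : G →* Aˣ) (Q : Subgroup G) (φ : MulAut Q) {v : A}
    (hv : v ∈ properTraces (twistRep k ι Q φ)) :
    ∃ h : MonoidAlgebra.single φ v ∈ extNum k ι Q,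
      (⟨MonoidAlgebra.single φ v, h⟩ : extNum k ι Q) ∈ extIdeal k ι Q := by
  have hmem : ∀ v ∈ properTraces (twistRep k ι Q φ),
      MonoidAlgebra.single φ v ∈ extNum k ι Q := fun v hv =>
    (mem_extNum_single_iff ι Q φ v).2 fun u =>
      (twistRep_eq_self_iff ι Q φ u v).1 (properTraces_fixed _ hv u)
  refine ⟨hmem v hv, ?_⟩
  induction hv using AddSubgroup.closure_induction with
  | mem v hv =>
    obtain ⟨R, hR, a, ha, rfl⟩ := hv
    refine TwoSidedIdeal.subset_span ⟨φ, R, a, hR,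
      fun u hu => (twistRep_eq_self_iff ι Q φ u a).1 (ha u hu), ?_⟩
    rw [twistedTrace_eq (k := k)]
  | zero =>
    convert zero_mem (extIdeal k ι Q)
    simp
  | add x y hx' hy' hx hy =>
    convert add_mem hx hy
    simp [MonoidAlgebra.single_add]
  | neg x hx' hx =>
    convert neg_mem hx
    simp

/-- The elements that are proper traces in every degree already form a two-sided ideal, so the
generated ideal is homogeneous and is described degree by degree. -/
theorem extMk_eq_zero_iff [Finite G] (ι : G →* Aˣ) (Q : Subgroup G) (x : extNum k ι Q) :
    extMk k ι Q x = 0 ↔ ∀ φ, (x : MonoidAlgebra A (MulAut Q)).coeff φ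
      ∈ properTraces (twistRep k ι Q φ) := by
  classical
  constructor
  · intro h
    let J : Set (extNum k ι Q) := {x | ∀ φ, (x : MonoidAlgebra A (MulAut Q)).coeff φ
      ∈ properTraces (twistRep k ι Q φ)}
    let I : TwoSidedIdeal (extNum k ι Q) := TwoSidedIdeal.mk' J
      (fun φ => zero_mem (properTraces (twistRep k ι Q φ)))
      (fun {x y} hx hy φ => add_mem (hx φ) (hy φ))
      (fun {x} hx φ => neg_mem (hx φ))
      (fun {x y} hy φ => by
        change ((x : MonoidAlgebra A (MulAut Q)) * (y : MonoidAlgebra A (MulAut Q))).coeff φ ∈ _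
        rw [MonoidAlgebra.coeff_mul_apply_left, Finsupp.sum]
        refine sum_mem fun ψ _ => ?_
        have := mul_mem_properTraces_twistRep (fun u => x.2 ψ u) (hy (ψ⁻¹ * φ))
        rwa [mul_inv_cancel_left] at this)
      (fun {x y} hx φ => by
        change ((x : MonoidAlgebra A (MulAut Q)) * (y : MonoidAlgebra A (MulAut Q))).coeff φ ∈ _
        rw [MonoidAlgebra.coeff_mul_apply_left, Finsupp.sum]
        refine sum_mem fun ψ _ => ?_
        have := properTraces_twistRep_mul_mem (fun u => y.2 (ψ⁻¹ * φ) u) (hx ψ)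
        rwa [mul_inv_cancel_left] at this)
    have hI : ∀ y, y ∈ I ↔ y ∈ J := fun y => TwoSidedIdeal.mem_mk' _ _ _ _ _ _ y
    have h1 : x ∈ extIdeal k ι Q := (RingCon.eq _).1 h
    refine (hI x).1 ((TwoSidedIdeal.span_le (I := I)).2 ?_ h1)
    rintro y ⟨φ, R, a, hR, ha, hy⟩
    rw [SetLike.mem_coe, hI]
    intro ψ
    rw [hy, MonoidAlgebra.coeff_single, Finsupp.single_apply]
    split_ifs with hφ
    · subst hφ
      rw [twistedTrace_eq (k := k)]
      exact AddSubgroup.subset_closure ⟨R, hR, a,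
        fun r hr => (twistRep_eq_self_iff ι Q φ r a).2 (ha r hr), rfl⟩
    · exact zero_mem _
  · intro h
    have hx : x = ∑ φ ∈ (x : MonoidAlgebra A (MulAut Q)).coeff.support,
        ⟨_, (single_mem_extIdeal ι Q φ (h φ)).1⟩ := by
      refine Subtype.ext ?_
      rw [AddSubmonoidClass.coe_finsetSum]
      exact (MonoidAlgebra.sum_coeff_single _).symm
    refine (RingCon.eq _).2 ?_
    change x ∈ extIdeal k ι Q
    rw [hx]
    exact sum_mem fun φ _ => (single_mem_extIdeal ι Q φ (h φ)).2

theorem extMk_surjective (ι : G →* Aˣ) (Q : Subgroup G) : Function.Surjective (extMk k ι Q) :=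
  Quotient.mk_surjective

instance finiteDimensional_extBrauerQuotient [Finite G] [FiniteDimensional k A] (ι : G →* Aˣ)
    (Q : Subgroup G) : FiniteDimensional k (ExtBrauerQuotient k ι Q) := by
  have : FiniteDimensional k (MonoidAlgebra A (MulAut Q)) :=
    Module.Finite.equiv (MonoidAlgebra.coeffLinearEquiv k (S := A) (M := MulAut Q)).symm
  exact Module.Finite.of_surjective (extMk k ι Q).toLinearMap (extMk_surjective ι Q)

theorem extInterior_val (ι : G →* Aˣ) (Q : Subgroup G) (n : Subgroup.normalizer (Q : Set G)) :
    (extInterior k ι Q n : ExtBrauerQuotient k ι Q) = extMk k ι Q (extNormalizer k ι Q n) := rfl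

theorem conjAction_extMk (ι : G →* Aˣ) (Q : Subgroup G) (n : Subgroup.normalizer (Q : Set G))
    (x : extNum k ι Q) :
    conjAction k (extInterior k ι Q) n (extMk k ι Q x)
      = extMk k ι Q (extNormalizer k ι Q n * x * extNormalizer k ι Q n⁻¹) := by
  rw [conjAction_apply, ← map_inv, extInterior_val, extInterior_val, map_mul, map_mul]

theorem coeff_conj (ι : G →* Aˣ) (Q : Subgroup G) (n : Subgroup.normalizer (Q : Set G))
    (x : extNum k ι Q) (φ : MulAut Q) :
    (extNormalizer k ι Q n * x * extNormalizer k ι Q n⁻¹ : extNum k ι Q).1.coeff φ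
      = conjAction k ι n (x.1.coeff
        ((Q.normalizerMonoidHom n)⁻¹ * φ * Q.normalizerMonoidHom n)) := by
  change (MonoidAlgebra.single (Q.normalizerMonoidHom n) (ι n : A) * x.1
    * MonoidAlgebra.single (Q.normalizerMonoidHom n⁻¹)
      (ι ((n⁻¹ : Subgroup.normalizer (Q : Set G)) : G) : A)).coeff φ = _
  rw [MonoidAlgebra.coeff_mul_single_apply, MonoidAlgebra.coeff_single_mul_apply,
    conjAction_apply]
  simp [mul_assoc]

theorem coeff_one_mem_fixed {ι : G →* Aˣ} {Q : Subgroup G} (x : extNum k ι Q) :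
    x.1.coeff 1 ∈ fixedSubalgebra (conjAction k ι) Q := by
  intro g hg
  rw [conjAction_apply, Units.mul_inv_eq_iff_eq_mul]
  exact x.2 1 ⟨g, hg⟩

end Extended

section ExtendedStructure

variable {k : Type*} [Field k] {G : Type*} [Group G] [Finite G] {A : Type*} [Ring A] [Algebra k A]

/-! ### A permutation basis of the extended Brauer quotient -/

/-- In degree `φ` the twisted action of `Q` permutes the bistable basis, and the quotient retains
the coordinates at its fixed elements, those with `φ(u) b = b u`. Conjugation by `N_G(Q)` permutes
the resulting elements, changing `φ` by conjugation. -/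
theorem exists_basis_extBrauerQuotient (p : ℕ) [Fact p.Prime] [CharP k p] {ι : G →* Aˣ}
    {Q : Subgroup G} (hQ : IsPGroup p Q) {κ : Type*} [Finite κ] (b : Module.Basis κ k A)
    (hb : ∀ g h i, ∃ j, (ι g : A) * b i * ι h = b j) :
    ∃ c : Module.Basis {z : Σ _ : MulAut Q, κ | ∀ u : Q, (ι (z.1 u) : A) * b z.2 = b z.2 * ι u} k
        (ExtBrauerQuotient k ι Q),
      (∀ x t, c.repr (extMk k ι Q x) t = b.repr (x.1.coeff t.1.1) t.1.2) ∧
      (∀ t h, c t = extMk k ι Q ⟨MonoidAlgebra.single t.1.1 (b t.1.2), h⟩) ∧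
      Permutes (conjAction k (extInterior k ι Q)) ⊤ c := by
  classical
  let B₀ : Module.Basis (Σ _ : MulAut Q, κ) k (MonoidAlgebra A (MulAut Q)) :=
    (Finsupp.basis (fun _ : MulAut Q => b)).map
      (MonoidAlgebra.coeffLinearEquiv k (S := A) (M := MulAut Q)).symm
  have hB₀ : ∀ z, B₀ z = MonoidAlgebra.single z.1 (b z.2) := by
    intro z
    simp only [B₀, Module.Basis.map_apply, Finsupp.coe_basis]
    rfl
  have hB₀r : ∀ x z, B₀.repr x z = b.repr (x.coeff z.1) z.2 := by
    intro x z
    simp only [B₀, Module.Basis.map_repr, LinearEquiv.trans_apply]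
    rw [Finsupp.basis_repr]
    rfl
  obtain ⟨c, hc1, hc2⟩ := exists_basis_of_coordinates B₀
    {z : Σ _ : MulAut Q, κ | ∀ u : Q, (ι (z.1 u) : A) * b z.2 = b z.2 * ι u}
    (extNum k ι Q).val.toLinearMap (extMk k ι Q).toLinearMap (extMk_surjective ι Q)
    (fun t ht => ⟨⟨MonoidAlgebra.single t.1 (b t.2), (mem_extNum_single_iff ι Q t.1 (b t.2)).2 ht⟩,
      (hB₀ t).symm⟩)
    (fun w => by
      change extMk k ι Q w = 0 ↔ _
      rw [extMk_eq_zero_iff]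
      have hperm : ∀ (φ : MulAut Q) (u : Q) (i : κ), ∃ j, twistRep k ι Q φ u (b i) = b j := by
        intro φ u i
        obtain ⟨j, hj⟩ := hb (φ u) u⁻¹ i
        exact ⟨j, by rw [twistRep_apply, ← hj, map_inv]⟩
      simp only [fun φ => mem_properTraces_iff p hQ b (twistRep k ι Q φ) (hperm φ)
        (coeff_fixed w φ), twistRep_eq_self_iff, hB₀r]
      exact ⟨fun h t ht => h t.1 t.2 ht, fun h φ i hi => h ⟨φ, i⟩ hi⟩)
  have hct : ∀ t h, c t = extMk k ι Q ⟨MonoidAlgebra.single t.1.1 (b t.1.2), h⟩ :=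
    fun t h => hc1 t _ (hB₀ t).symm
  refine ⟨c, fun x t => (hc2 x t).trans (hB₀r _ _), hct, fun n _ t => ?_⟩
  obtain ⟨j, hj⟩ := hb n (n : G)⁻¹ t.1.2
  have htm := (mem_extNum_single_iff (k := k) ι Q t.1.1 (b t.1.2)).2 t.2
  have hval : (extNormalizer k ι Q n * ⟨MonoidAlgebra.single t.1.1 (b t.1.2), htm⟩
      * extNormalizer k ι Q n⁻¹ : extNum k ι Q).1 = (MonoidAlgebra.single
        (Q.normalizerMonoidHom n * t.1.1 * Q.normalizerMonoidHom n⁻¹) (b j) :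
          MonoidAlgebra A (MulAut Q)) := by
    rw [← hj]
    change MonoidAlgebra.single (Q.normalizerMonoidHom n) (ι n : A)
      * MonoidAlgebra.single t.1.1 (b t.1.2)
      * MonoidAlgebra.single (Q.normalizerMonoidHom n⁻¹)
        (ι ((n⁻¹ : Subgroup.normalizer (Q : Set G)) : G) : A) = _
    rw [MonoidAlgebra.single_mul_single, MonoidAlgebra.single_mul_single]
    rfl
  have hm := (extNormalizer k ι Q n * ⟨MonoidAlgebra.single t.1.1 (b t.1.2), htm⟩
      * extNormalizer k ι Q n⁻¹ : extNum k ι Q).2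
  rw [hval] at hm
  refine ⟨⟨⟨_, j⟩, (mem_extNum_single_iff ι Q _ (b j)).1 hm⟩, ?_⟩
  rw [hct t htm, conjAction_extMk, hct _ hm]
  congr 1
  exact Subtype.ext hval

/-! ### The projection onto degree one -/

/-- The projection is only linear on `X`, as products of other degrees can land in degree one. On
the elements fixed by `Q` it becomes multiplicative (`degreeOneProj_mul`). -/
theorem exists_degreeOneProj (ι : G →* Aˣ) (Q : Subgroup G) :
    ∃ π : ExtBrauerQuotient k ι Q →ₗ[k] BrauerQuotient (conjAction k ι) Q,
      ∀ x, π (extMk k ι Q x) = br (conjAction k ι) Q ⟨x.1.coeff 1, coeff_one_mem_fixed x⟩ := by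
  let f : extNum k ι Q →ₗ[k] BrauerQuotient (conjAction k ι) Q :=
    { toFun := fun x => br (conjAction k ι) Q ⟨x.1.coeff 1, coeff_one_mem_fixed x⟩
      map_add' := fun x y => by rw [← map_add]; rfl
      map_smul' := fun r x => by rw [← map_smul]; rfl }
  have hf : ∀ x, extMk k ι Q x = 0 → f x = 0 := by
    intro x hx
    change br (conjAction k ι) Q _ = 0
    rw [br_eq_zero_iff]
    have h1 := (extMk_eq_zero_iff ι Q x).1 hx 1
    have h2 : twistRep k ι Q 1 = resRep (conjAction k ι) Q := by
      ext u a
      rw [twistRep_apply]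
      rfl
    rwa [h2] at h1
  obtain ⟨r, hr⟩ := (extMk k ι Q).toLinearMap.exists_rightInverse_of_surjective
    (LinearMap.range_eq_top.2 (extMk_surjective ι Q))
  refine ⟨f ∘ₗ r, fun x => ?_⟩
  change f (r (extMk k ι Q x)) = f x
  rw [← sub_eq_zero, ← map_sub]
  refine hf _ ?_
  rw [map_sub, sub_eq_zero]
  exact LinearMap.congr_fun hr (extMk k ι Q x)

/-- The projection of the extended Brauer quotient onto its degree one part `A(Q)`, as a linear
map. -/
def degreeOneHom (ι : G →* Aˣ) (Q : Subgroup G) :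
    ExtBrauerQuotient k ι Q →ₗ[k] BrauerQuotient (conjAction k ι) Q :=
  (exists_degreeOneProj ι Q).choose

/-- The projection of the extended Brauer quotient onto its degree one part `A(Q)`. -/
def degreeOneProj (ι : G →* Aˣ) (Q : Subgroup G) (x : ExtBrauerQuotient k ι Q) :
    BrauerQuotient (conjAction k ι) Q :=
  degreeOneHom ι Q x

theorem degreeOneProj_extMk (ι : G →* Aˣ) (Q : Subgroup G) (x : extNum k ι Q) :
    degreeOneProj ι Q (extMk k ι Q x)
      = br (conjAction k ι) Q ⟨x.1.coeff 1, coeff_one_mem_fixed x⟩ :=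
  (exists_degreeOneProj ι Q).choose_spec x

/-- The inclusion `A(Q) → X`. -/
abbrev ofBrauer (k : Type*) [Field k] {A : Type*} [Ring A] [Algebra k A] (ι : G →* Aˣ)
    (Q : Subgroup G) : BrauerQuotient (conjAction k ι) Q →ₐ[k] ExtBrauerQuotient k ι Q :=
  toExt ι Q (conjAction k ι) (AlgHom.id k A) (fun _ _ => rfl)

theorem ofBrauer_br (ι : G →* Aˣ) (Q : Subgroup G) (x : fixedSubalgebra (conjAction k ι) Q) :
    ofBrauer k ι Q (br (conjAction k ι) Q x)
      = extMk k ι Q (degreeOne ι Q (conjAction k ι) (AlgHom.id k A) (fun _ _ => rfl) x) := rfl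

theorem map_mem_fixed {C : Type*} [Ring C] [Algebra k C] (ι : G →* Aˣ) (ρ : G →* (C ≃ₐ[k] C))
    (j : C →ₐ[k] A) (hj : ∀ g x, j (ρ g x) = conjAction k ι g (j x)) {P : Subgroup G} {x : C}
    (hx : x ∈ fixedSubalgebra ρ P) : j x ∈ fixedSubalgebra (conjAction k ι) P :=
  fun g hg => by rw [← hj, hx g hg]

section ToExt

variable {C : Type*} [Ring C] [Algebra k C] (ι : G →* Aˣ) (Q : Subgroup G)
  (ρ : G →* (C ≃ₐ[k] C)) (j : C →ₐ[k] A) (hj : ∀ g x, j (ρ g x) = conjAction k ι g (j x))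

theorem toExt_br (x : fixedSubalgebra ρ Q) :
    toExt ι Q ρ j hj (br ρ Q x) = extMk k ι Q (degreeOne ι Q ρ j hj x) := rfl

theorem degreeOne_val (x : fixedSubalgebra ρ Q) :
    (degreeOne ι Q ρ j hj x : MonoidAlgebra A (MulAut Q)) = MonoidAlgebra.single 1 (j x) := rfl

theorem toExt_brauerAction (n : Subgroup.normalizer (Q : Set G)) (y : BrauerQuotient ρ Q) :
    toExt ι Q ρ j hj (brauerAction ρ Q n y)
      = conjAction k (extInterior k ι Q) n (toExt ι Q ρ j hj y) := by
  classical
  obtain ⟨x, rfl⟩ := br_surjective ρ Q y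
  rw [brauerAction_br, toExt_br, toExt_br, conjAction_extMk]
  congr 1
  refine Subtype.ext (MonoidAlgebra.ext (Finsupp.ext fun φ => ?_))
  rw [coeff_conj, degreeOne_val, degreeOne_val, MonoidAlgebra.coeff_single,
    MonoidAlgebra.coeff_single, Finsupp.single_apply, Finsupp.single_apply]
  have h1 : (1 = (Q.normalizerMonoidHom n)⁻¹ * φ * Q.normalizerMonoidHom n) ↔ 1 = φ := by
    rw [mul_assoc, eq_inv_mul_iff_mul_eq, mul_one, right_eq_mul, eq_comm]
  simp only [h1]
  split_ifs
  · exact hj n x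
  · exact (map_zero _).symm

end ToExt

theorem isPGroup_down {p : ℕ} {Q : Subgroup G} (hQ : IsPGroup p Q) : IsPGroup p (down Q Q) :=
  hQ.comap_subtype

variable (ι : G →* Aˣ) (Q : Subgroup G)

theorem ofBrauer_brauerAction (n : Subgroup.normalizer (Q : Set G))
    (y : BrauerQuotient (conjAction k ι) Q) :
    ofBrauer k ι Q (brauerAction (conjAction k ι) Q n y)
      = conjAction k (extInterior k ι Q) n (ofBrauer k ι Q y) :=
  toExt_brauerAction ι Q (conjAction k ι) (AlgHom.id k A) (fun _ _ => rfl) n y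

theorem degreeOneProj_ofBrauer (y : BrauerQuotient (conjAction k ι) Q) :
    degreeOneProj ι Q (ofBrauer k ι Q y) = y := by
  obtain ⟨x, rfl⟩ := br_surjective (conjAction k ι) Q y
  rw [ofBrauer_br, degreeOneProj_extMk]
  congr 1
  refine Subtype.ext ?_
  change (MonoidAlgebra.single (1 : MulAut Q) (x : A)).coeff 1 = x
  simp

theorem ofBrauer_injective : Function.Injective (ofBrauer k ι Q) :=
  Function.LeftInverse.injective (degreeOneProj_ofBrauer ι Q)

theorem degreeOneProj_conjAction (n : Subgroup.normalizer (Q : Set G))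
    (x : ExtBrauerQuotient k ι Q) :
    degreeOneProj ι Q (conjAction k (extInterior k ι Q) n x)
      = brauerAction (conjAction k ι) Q n (degreeOneProj ι Q x) := by
  obtain ⟨x, rfl⟩ := extMk_surjective ι Q x
  rw [conjAction_extMk, degreeOneProj_extMk, degreeOneProj_extMk, brauerAction_br]
  congr 1
  refine Subtype.ext ?_
  change (extNormalizer k ι Q n * x * extNormalizer k ι Q n⁻¹ : extNum k ι Q).1.coeff 1 = _
  rw [coeff_conj]
  simp only [mul_one, inv_mul_cancel]
  rfl

theorem brauerAction_down {B : Type*} [Ring B] [Algebra k B] (ρ : G →* (B ≃ₐ[k] B))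
    (y : BrauerQuotient ρ Q) : y ∈ fixedSubalgebra (brauerAction ρ Q) (down Q Q) := by
  intro n hn
  obtain ⟨x, rfl⟩ := br_surjective ρ Q y
  rw [brauerAction_br]
  congr 1
  exact Subtype.ext (x.2 n (Subgroup.mem_subgroupOf.1 hn))

/-- `Q` acts trivially on `A(Q)`, so the equivariant projection is an invariant map on `X` and kills
proper traces at `Q`. -/
theorem degreeOneProj_properTraces (p : ℕ) [Fact p.Prime] [CharP k p] (hQ : IsPGroup p Q)
    {x : ExtBrauerQuotient k ι Q}
    (hx : x ∈ properTraces (resRep (conjAction k (extInterior k ι Q)) (down Q Q))) :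
    degreeOneProj ι Q x = 0 :=
  map_properTraces_eq_zero p (isPGroup_down hQ) _ (degreeOneHom ι Q).toAddMonoidHom
    (fun s v => (degreeOneProj_conjAction ι Q s v).trans
      (brauerAction_down Q _ (degreeOneProj ι Q v) s s.2)) hx

variable {ι Q}

/-- A `Q`-fixed element of `X` agrees with its degree one part up to proper traces. -/
theorem sub_ofBrauer_mem_properTraces (p : ℕ) [Fact p.Prime] [CharP k p] (hQ : IsPGroup p Q)
    {κ : Type*} [Finite κ] (b : Module.Basis κ k A)
    (hb : ∀ g h i, ∃ j, (ι g : A) * b i * ι h = b j)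
    (hfree : ∀ u ∈ Q, ∀ i, (ι u : A) * b i = b i → u = 1) {x : ExtBrauerQuotient k ι Q}
    (hx : x ∈ fixedSubalgebra (conjAction k (extInterior k ι Q)) (down Q Q)) :
    x - ofBrauer k ι Q (degreeOneProj ι Q x)
      ∈ properTraces (resRep (conjAction k (extInterior k ι Q)) (down Q Q)) := by
  classical
  obtain ⟨c, hc, hct, hcp⟩ := exists_basis_extBrauerQuotient p hQ b hb
  have hfix : ofBrauer k ι Q (degreeOneProj ι Q x)
      ∈ fixedSubalgebra (conjAction k (extInterior k ι Q)) (down Q Q) := by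
    intro n hn
    rw [← ofBrauer_brauerAction, brauerAction_down Q _ _ n hn]
  rw [mem_properTraces_iff_of_permutes p (isPGroup_down hQ) (hcp.mono le_top) (sub_mem hx hfix)]
  intro t ht
  have htm := (mem_extNum_single_iff (k := k) ι Q t.1.1 (b t.1.2)).2 t.2
  -- A basis element fixed by conjugation with `u` satisfies `u b = b u = φ(u) b`, so `u⁻¹ φ(u)`
  -- fixes `b` from the left and is trivial by freeness. All `Q`-fixed basis elements of `X`
  -- therefore have degree one.
  have ht1 : t.1.1 = 1 := by
    ext u
    have h1 := ht ⟨u, Subgroup.le_normalizer u.2⟩ (Subgroup.mem_subgroupOf.2 u.2)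
    have h2 := DFunLike.congr_fun (congrArg c.repr h1) t
    rw [c.repr_self, Finsupp.single_eq_same, hct t htm, conjAction_extMk, hc, coeff_conj,
      MonoidAlgebra.coeff_single, Finsupp.single_apply] at h2
    have h3 : conjAction k ι (u : G) (b t.1.2) = b t.1.2 := by
      split_ifs at h2
      · obtain ⟨i, hi⟩ := hb u (u : G)⁻¹ t.1.2
        rw [map_inv] at hi
        change b.repr (ι (u : G) * b t.1.2 * ((ι (u : G))⁻¹ : Aˣ)) t.1.2 = 1 at h2
        rw [hi, b.repr_self, Finsupp.single_apply] at h2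
        split_ifs at h2 with h
        · rw [h] at hi
          exact hi
        · exact absurd h2 zero_ne_one
      · rw [map_zero, map_zero] at h2
        exact absurd h2 zero_ne_one
    rw [conjAction_apply, Units.mul_inv_eq_iff_eq_mul, ← t.2 u] at h3
    have h4 := hfree ((u : G)⁻¹ * (t.1.1 u : G)) (Q.mul_mem (Q.inv_mem u.2) (t.1.1 u).2) t.1.2 (by
      rw [map_mul, Units.val_mul, mul_assoc, ← h3, map_inv, Units.inv_mul_cancel_left])
    rw [inv_mul_eq_one] at h4
    exact h4.symm
  obtain ⟨x, rfl⟩ := extMk_surjective ι Q x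
  rw [degreeOneProj_extMk, ofBrauer_br, ← map_sub, hc]
  change b.repr (x.1.coeff t.1.1 - (MonoidAlgebra.single 1 (x.1.coeff 1)).coeff t.1.1) t.1.2 = 0
  rw [ht1]
  simp

/-- Homogeneous elements normalize the image of `Q`, so `u - 1` is in the radical for each `u` in
`Q`. Conjugation by `Q` is then trivial modulo the radical, and an invariant map kills proper
traces. -/
theorem properTraces_le_jacobson (p : ℕ) [Fact p.Prime] [CharP k p] (hQ : IsPGroup p Q)
    {x : ExtBrauerQuotient k ι Q}
    (hx : x ∈ properTraces (resRep (conjAction k (extInterior k ι Q)) (down Q Q))) :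
    x ∈ Ring.jacobson (ExtBrauerQuotient k ι Q) := by
  classical
  have hspan : AddSubgroup.closure {x : ExtBrauerQuotient k ι Q | ∀ u : down Q Q, ∃ u' : down Q Q,
      (((extInterior k ι Q).comp (down Q Q).subtype u : (ExtBrauerQuotient k ι Q)ˣ) :
        ExtBrauerQuotient k ι Q) * x = x * (extInterior k ι Q).comp (down Q Q).subtype u'} = ⊤ := by
    rw [eq_top_iff]
    rintro x -
    obtain ⟨x, rfl⟩ := extMk_surjective ι Q x
    have hm : ∀ φ, MonoidAlgebra.single φ (x.1.coeff φ) ∈ extNum k ι Q := fun φ =>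
      (mem_extNum_single_iff ι Q φ _).2 (x.2 φ)
    have hsum : x = ∑ φ ∈ x.1.coeff.support, ⟨_, hm φ⟩ := by
      refine Subtype.ext ?_
      rw [AddSubmonoidClass.coe_finsetSum]
      exact (MonoidAlgebra.sum_coeff_single _).symm
    rw [hsum, map_sum]
    refine sum_mem fun φ _ => AddSubgroup.subset_closure fun u => ?_
    -- An element `a` of degree `φ` satisfies `φ(v) a = a v`, so `u` passes through it as `φ⁻¹(u)`.
    let v : Q := φ⁻¹ ⟨u, Subgroup.mem_subgroupOf.1 u.2⟩
    have hφv : (φ v : G) = u := by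
      simp [v]
    refine ⟨⟨⟨v, Subgroup.le_normalizer v.2⟩, Subgroup.mem_subgroupOf.2 v.2⟩, ?_⟩
    simp only [MonoidHom.comp_apply, extInterior_val]
    rw [← map_mul, ← map_mul]
    congr 1
    refine Subtype.ext ?_
    change MonoidAlgebra.single (Q.normalizerMonoidHom u) (ι (u : G) : A)
      * MonoidAlgebra.single φ (x.1.coeff φ) = MonoidAlgebra.single φ (x.1.coeff φ)
      * MonoidAlgebra.single (Q.normalizerMonoidHom ⟨v, Subgroup.le_normalizer v.2⟩) (ι (v : G) : A)
    rw [MonoidAlgebra.single_mul_single, MonoidAlgebra.single_mul_single, ← x.2 φ v, hφv]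
    congr 1
    ext w
    change (u : G) * φ w * (u : G)⁻¹ = (φ ⟨(v : G) * w * (v : G)⁻¹, _⟩ : G)
    have : (⟨(v : G) * w * (v : G)⁻¹, Q.mul_mem (Q.mul_mem v.2 w.2) (Q.inv_mem v.2)⟩ : Q)
      = v * w * v⁻¹ := rfl
    rw [this, map_mul, map_mul, map_inv]
    simp [hφv]
  have hJ := sub_one_mem_jacobson (k := k) p (isPGroup_down hQ)
    ((extInterior k ι Q).comp (down Q Q).subtype) hspan
  have h0 := map_properTraces_eq_zero p (isPGroup_down hQ) _
    (Ring.jacobson (ExtBrauerQuotient k ι Q)).mkQ.toAddMonoidHom (fun u x => by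
      change Submodule.Quotient.mk _ = Submodule.Quotient.mk _
      rw [Submodule.Quotient.eq, resRep_apply, conjAction_apply]
      have h1 : (extInterior k ι Q u : ExtBrauerQuotient k ι Q) * x
          * ((extInterior k ι Q u)⁻¹ : (ExtBrauerQuotient k ι Q)ˣ) - x
          = (extInterior k ι Q u - 1) * (x * ((extInterior k ι Q u)⁻¹ : (ExtBrauerQuotient k ι Q)ˣ))
            + x * (((extInterior k ι Q u)⁻¹ : (ExtBrauerQuotient k ι Q)ˣ) - 1) := by
        noncomm_ring
      rw [h1]
      refine add_mem (Ideal.mul_mem_right _ _ (hJ u)) (Ideal.mul_mem_left _ _ ?_)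
      have := hJ u⁻¹
      rwa [map_inv] at this) hx
  exact (Submodule.Quotient.mk_eq_zero _).1 h0

end ExtendedStructure

/-! ### Blocks -/

section Blocks

variable {k : Type*} [Field k] {E : Type*} [Ring E] [Algebra k E]

/-- An idempotent commuting with `f` splits it as `g f + (f - g f)`, and primitivity kills one of
the two parts. -/
theorem IsPrimitiveIdempotent.mul_eq_zero_or {f g : E} (hf : IsPrimitiveIdempotent f)
    (hcomm : f * g = g * f) (hgi : IsIdempotentElem g) : g * f = 0 ∨ g * f = f := by
  have hff := hf.1.eq
  have hgf : g * f * (g * f) = g * f := by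
    rw [mul_assoc, ← mul_assoc f, hcomm, mul_assoc g f f, hff, ← mul_assoc, hgi.eq]
  have h1 : f * (g * f) = g * f := by rw [← mul_assoc, hcomm, mul_assoc, hff]
  have h2 : g * f * f = g * f := by rw [mul_assoc, hff]
  rcases hf.2.2 (g * f) (f - g * f) hgf (by
      change (f - g * f) * (f - g * f) = f - g * f
      rw [mul_sub, sub_mul, sub_mul, hff, h1, h2, hgf, sub_self, sub_zero])
    (by rw [mul_sub, h2, hgf, sub_self]) (by rw [sub_mul, h1, hgf, sub_self])
    (add_sub_cancel _ _) with h | h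
  · exact Or.inl h
  · exact Or.inr (sub_eq_zero.1 h).symm

theorem IsBlock.mul_eq_zero_or {f g : E} (hf : IsBlock f) (hg : g ∈ Subring.center E)
    (hgi : IsIdempotentElem g) : g * f = 0 ∨ g * f = f := by
  obtain ⟨hc, hf⟩ := hf
  rcases hf.mul_eq_zero_or (g := (⟨g, hg⟩ : Subring.center E)) (mul_comm _ _)
    (show (⟨g, hg⟩ : Subring.center E) * ⟨g, hg⟩ = ⟨g, hg⟩ from Subtype.ext hgi) with h | h
  · exact Or.inl (congrArg Subtype.val h)
  · exact Or.inr (congrArg Subtype.val h)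

theorem IsBlock.map_equiv {E' : Type*} [Ring E'] {f : E} (hf : IsBlock f) (σ : E ≃+* E') :
    IsBlock (σ f) := by
  obtain ⟨hc, hf⟩ := hf
  have hcen : ∀ (x : E'), x ∈ Subring.center E' → σ.symm x ∈ Subring.center E := by
    intro x hx
    rw [Subring.mem_center_iff] at hx ⊢
    intro g
    apply σ.injective
    rw [map_mul, map_mul, σ.apply_symm_apply, hx]
  refine ⟨?_, Subtype.ext ?_, fun h => hf.2.1 (Subtype.ext ?_), fun a b ha hb hab hba hsum => ?_⟩
  · rw [Subring.mem_center_iff] at hc ⊢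
    intro g
    apply σ.symm.injective
    rw [map_mul, map_mul, σ.symm_apply_apply, hc]
  · change σ f * σ f = σ f
    rw [← map_mul]
    exact congrArg σ (congrArg Subtype.val hf.1)
  · have h1 := congrArg Subtype.val h
    change σ f = 0 at h1
    exact (map_eq_zero_iff σ σ.injective).1 h1
  · have key : ∀ {x y : Subring.center E'} {z : E'}, (x : E') * y = z →
        σ.symm x * σ.symm y = σ.symm z := fun h => by rw [← map_mul, h]
    rcases hf.2.2 ⟨σ.symm a, hcen a a.2⟩ ⟨σ.symm b, hcen b b.2⟩
      (Subtype.ext (key (congrArg Subtype.val ha))) (Subtype.ext (key (congrArg Subtype.val hb)))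
      (Subtype.ext ((key (congrArg Subtype.val hab)).trans (map_zero _)))
      (Subtype.ext ((key (congrArg Subtype.val hba)).trans (map_zero _)))
      (Subtype.ext (by
        change σ.symm a + σ.symm b = f
        have h1 := congrArg Subtype.val hsum
        change (a : E') + b = σ f at h1
        rw [← map_add, h1, σ.symm_apply_apply])) with h | h
    · exact Or.inl (Subtype.ext ((map_eq_zero_iff σ.symm σ.symm.injective).1
        (congrArg Subtype.val h)))
    · exact Or.inr (Subtype.ext ((map_eq_zero_iff σ.symm σ.symm.injective).1
        (congrArg Subtype.val h)))

theorem IsBlock.isIdempotentElem {f : E} (hf : IsBlock f) : f * f = f := by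
  obtain ⟨_, hf⟩ := hf
  exact congrArg Subtype.val hf.1

theorem IsBlock.ne_zero {f : E} (hf : IsBlock f) : f ≠ 0 := by
  obtain ⟨_, hf⟩ := hf
  exact fun h => hf.2.1 (Subtype.ext h)

theorem IsBlock.mul_eq_zero {f g : E} (hf : IsBlock f) (hg : IsBlock g) (h : g ≠ f) :
    g * f = 0 := by
  obtain ⟨hfc, -⟩ := id hf
  obtain ⟨hgc, -⟩ := id hg
  rcases hf.mul_eq_zero_or hgc hg.isIdempotentElem with h1 | h1
  · exact h1
  rcases hg.mul_eq_zero_or hfc hf.isIdempotentElem with h2 | h2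
  · rw [Subring.mem_center_iff.1 hfc g, h2]
  · rw [← Subring.mem_center_iff.1 hfc g, h1] at h2
    exact absurd h2.symm h

end Blocks

section Points

variable {k : Type*} [Field k] {M : Type*} [Group M] {B : Type*} [Ring B] [Algebra k B]

/-! ### Points -/

/-- The conjugacy class of `i` under the units of `B^L`. -/
def pointOf (ρ : M →* (B ≃ₐ[k] B)) (L : Subgroup M) (i : fixedSubalgebra ρ L) : Set B :=
  {j | ∃ u : (fixedSubalgebra ρ L)ˣ,
      j = ((u * i * (u⁻¹ : (fixedSubalgebra ρ L)ˣ) : fixedSubalgebra ρ L) : B)}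

theorem isPoint_pointOf (ρ : M →* (B ≃ₐ[k] B)) {L : Subgroup M} {i : fixedSubalgebra ρ L}
    (hi : IsPrimitiveIdempotent i) : IsPoint ρ L (pointOf ρ L i) := ⟨i, hi, rfl⟩

theorem mem_pointOf (ρ : M →* (B ≃ₐ[k] B)) {L : Subgroup M} (i : fixedSubalgebra ρ L) :
    (i : B) ∈ pointOf ρ L i := ⟨1, by simp⟩

theorem isDefectGroupOfPoint_pointOf [Finite M] {ρ : M →* (B ≃ₐ[k] B)} {L D : Subgroup M}
    {i : fixedSubalgebra ρ L} (h : IsDefectGroup ρ L D i) :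
    IsDefectGroupOfPoint ρ L D (pointOf ρ L i) := by
  rintro _ ⟨u, rfl⟩
  obtain ⟨hDL, ⟨a, ha, hai⟩, hmin⟩ := h
  have hres : ∀ {R : Subgroup M}, R ≤ L → ∀ v : fixedSubalgebra ρ L,
      (v : B) ∈ fixedSubalgebra ρ R := fun hR v => fixedSubalgebra_anti ρ hR v.2
  refine ⟨hDL, ⟨u * a * (u⁻¹ : (fixedSubalgebra ρ L)ˣ),
    mul_mem (mul_mem (hres hDL u) ha) (hres hDL _), ?_⟩, ?_⟩
  · rw [← relTrace_mul ρ D (u⁻¹ : (fixedSubalgebra ρ L)ˣ).1.2, ← mul_relTrace ρ D u.1.2, hai]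
    rfl
  · rintro R hR ⟨b, hb, hbi⟩
    have hRL := hR.le.trans hDL
    refine hmin R hR ⟨(u⁻¹ : (fixedSubalgebra ρ L)ˣ) * b * u,
      mul_mem (mul_mem (hres hRL _) hb) (hres hRL u), ?_⟩
    rw [← relTrace_mul ρ R u.1.2, ← mul_relTrace ρ R (u⁻¹ : (fixedSubalgebra ρ L)ˣ).1.2, hbi]
    have : (u⁻¹ : (fixedSubalgebra ρ L)ˣ) * (u * i * (u⁻¹ : (fixedSubalgebra ρ L)ˣ)) * u = i := by
      simp [mul_assoc]
    exact congrArg Subtype.val this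

theorem IsPoint.mem_fixed {ρ : M →* (B ≃ₐ[k] B)} {L : Subgroup M} {α : Set B}
    (h : IsPoint ρ L α) {j : B} (hj : j ∈ α) : j ∈ fixedSubalgebra ρ L := by
  obtain ⟨i, -, rfl⟩ := h
  obtain ⟨u, rfl⟩ := hj
  exact (u * i * (u⁻¹ : (fixedSubalgebra ρ L)ˣ) : fixedSubalgebra ρ L).2

theorem IsPrimitiveIdempotent.conj {R : Type*} [Ring R] {e : R} (he : IsPrimitiveIdempotent e)
    (u : Rˣ) : IsPrimitiveIdempotent (u * e * (u⁻¹ : Rˣ)) := by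
  refine ⟨?_, fun h => he.2.1 ?_, fun a b ha hb hab hba hsum => ?_⟩
  · change _ * _ = _
    simp [mul_assoc, ← mul_assoc e e, he.1.eq]
  · simpa using h
  · have key : ∀ {x y z : R}, x * y = z → ((u⁻¹ : Rˣ) * x * u) * ((u⁻¹ : Rˣ) * y * u)
        = (u⁻¹ : Rˣ) * z * u := fun {x y z} h => by
      rw [← h]
      simp [mul_assoc]
    have h0 : ∀ {x : R}, (u⁻¹ : Rˣ) * x * u = 0 → x = 0 := fun {x} h => by simpa using h
    rcases he.2.2 _ _ (key ha) (key hb) ((key hab).trans (by simp)) ((key hba).trans (by simp))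
      (by rw [← add_mul, ← mul_add, hsum]; simp [mul_assoc]) with h | h
    · exact Or.inl (h0 h)
    · exact Or.inr (h0 h)

theorem IsPoint.isPrimitiveIdempotent {ρ : M →* (B ≃ₐ[k] B)} {L : Subgroup M} {α : Set B}
    (h : IsPoint ρ L α) {j : B} (hj : j ∈ α) :
    IsPrimitiveIdempotent (⟨j, h.mem_fixed hj⟩ : fixedSubalgebra ρ L) := by
  obtain ⟨i, hi, rfl⟩ := h
  obtain ⟨u, rfl⟩ := hj
  exact hi.conj u

/-- Idempotents that agree modulo nilpotents are conjugate. -/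
theorem exists_unit_conj {R : Type*} [Ring R] {e f : R} (he : IsIdempotentElem e)
    (hf : IsIdempotentElem f) (hn : IsNilpotent ((2 * e - 1) * (f - e))) :
    ∃ u : Rˣ, f = u * e * (u⁻¹ : Rˣ) := by
  -- The unit is `v = e f + (1 - e)(1 - f)`, which intertwines the two idempotents: `e v = e f = v
  -- f`.
  obtain ⟨v, hv⟩ := hn.isUnit_one_add
  have hve : e * v = v * f := by
    have h1 : 1 + (2 * e - 1) * (f - e) = e * f + (1 - e) * (1 - f) := by
      have : (2 * e - 1) * (f - e) = 2 * (e * f) - f - 2 * (e * e) + e := by noncomm_ring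
      rw [this, he.eq]
      noncomm_ring
    rw [hv, h1]
    have h2 : e * (e * f + (1 - e) * (1 - f)) = e * e * f + (e - e * e) * (1 - f) := by
      noncomm_ring
    have h3 : (e * f + (1 - e) * (1 - f)) * f = e * (f * f) + (1 - e) * (f - f * f) := by
      noncomm_ring
    rw [h2, h3, he.eq, hf.eq, sub_self, sub_self, zero_mul, mul_zero]
  refine ⟨v⁻¹, ?_⟩
  rw [inv_inv, mul_assoc, hve, Units.inv_mul_cancel_left]

theorem IsPoint.mem_of_nilpotent {ρ : M →* (B ≃ₐ[k] B)} {L : Subgroup M} {α : Set B}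
    (h : IsPoint ρ L α) {e f : B} (he : e ∈ α) (hf : f ∈ fixedSubalgebra ρ L)
    (hff : IsIdempotentElem f) (hn : IsNilpotent ((2 * e - 1) * (f - e))) : f ∈ α := by
  have hee := (h.isPrimitiveIdempotent he).1
  have heL := h.mem_fixed he
  obtain ⟨i, hi, rfl⟩ := h
  obtain ⟨u, hu⟩ := exists_unit_conj (e := (⟨e, heL⟩ : fixedSubalgebra ρ L))
    (f := ⟨f, hf⟩) hee (Subtype.ext hff) (by
      obtain ⟨n, hn⟩ := hn
      exact ⟨n, Subtype.ext hn⟩)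
  obtain ⟨v, hv⟩ := he
  refine ⟨u * v, ?_⟩
  have hv' : (⟨e, heL⟩ : fixedSubalgebra ρ L) = v * i * (v⁻¹ : (fixedSubalgebra ρ L)ˣ) :=
    Subtype.ext hv
  rw [hv'] at hu
  have := congrArg Subtype.val hu
  rw [show f = ((⟨f, hf⟩ : fixedSubalgebra ρ L) : B) from rfl, this, mul_inv_rev]
  simp [mul_assoc]

/-! ### Sums of orthogonal conjugates -/

/-- A translate of `l` by an element outside `H` lies under a translate of `f` orthogonal to `f`, so
only the trivial coset survives multiplication by `l`. -/
theorem relTrace_mul_self [Finite M] {ρ : M →* (B ≃ₐ[k] B)} {H L : Subgroup M}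
    {l f : B} (hl : l ∈ fixedSubalgebra ρ H) (hll : IsIdempotentElem l) (hfl : f * l = l)
    (hlf : l * f = l) (horth : ∀ n ∈ L, n ∉ H → ρ n f * f = 0)
    (horth' : ∀ n ∈ L, n ∉ H → f * ρ n f = 0) :
    relTrace ρ H L l * l = l ∧ l * relTrace ρ H L l = l := by
  classical
  have := Fintype.ofFinite (L ⧸ H.subgroupOf L)
  have hin : ∀ x : L ⧸ H.subgroupOf L, ((x.out : L) : M) ∈ H ↔ x = ((1 : L) : L ⧸ _) := by
    intro x
    constructor
    · intro h
      rw [← Quotient.out_eq x]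
      refine QuotientGroup.eq.2 (Subgroup.mem_subgroupOf.2 ?_)
      simpa using h
    · rintro rfl
      have h := QuotientGroup.eq.1 (Quotient.out_eq ((1 : L) : L ⧸ H.subgroupOf L))
      simpa [Subgroup.mem_subgroupOf] using h
  rw [relTrace, finsum_eq_sum_of_fintype, Finset.sum_mul, Finset.mul_sum]
  constructor
  · rw [Finset.sum_eq_single ((1 : L) : L ⧸ H.subgroupOf L)]
    · rw [hl _ ((hin _).2 rfl), hll.eq]
    · intro x _ hx
      have h1 := horth _ (x.out : L).2 (fun h => hx ((hin x).1 h))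
      rw [← hlf, map_mul, hlf]
      conv_lhs => rw [← hfl]
      rw [mul_assoc, ← mul_assoc _ f, h1, zero_mul, mul_zero]
    · simp
  · rw [Finset.sum_eq_single ((1 : L) : L ⧸ H.subgroupOf L)]
    · rw [hl _ ((hin _).2 rfl), hll.eq]
    · intro x _ hx
      have h1 := horth' _ (x.out : L).2 (fun h => hx ((hin x).1 h))
      rw [← hfl, map_mul, hfl]
      conv_lhs => rw [← hlf]
      rw [mul_assoc, ← mul_assoc f, h1, zero_mul, mul_zero]
    · simp

theorem isIdempotentElem_relTrace [Finite M] {ρ : M →* (B ≃ₐ[k] B)} {H L : Subgroup M}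
    {l : B} (hl : l ∈ fixedSubalgebra ρ H) (h : relTrace ρ H L l * l = l) :
    IsIdempotentElem (relTrace ρ H L l) := by
  change _ * _ = _
  rw [mul_relTrace ρ H (relTrace_mem ρ L hl), h]

end Points

/-! ### Lifting idempotents through the Brauer homomorphism -/

section Lifting

variable {k : Type*} [Field k] {M : Type*} [Group M] [Finite M] {B : Type*} [Ring B] [Algebra k B]
  [FiniteDimensional k B]

/-- An idempotent of `B(Q)` that is a relative trace from `P` lifts, when only elements of
`N_M(Q)` conjugate `Q` into `P`. -/
theorem exists_primitive_of_relTrace (p : ℕ) [Fact p.Prime] [CharP k p]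
    {ρ : M →* (B ≃ₐ[k] B)} {Q : Subgroup M} (hQ : IsPGroup p Q)
    {P : Subgroup (Subgroup.normalizer (Q : Set M))} (hP : IsPGroup p P) (hQP : Q ≤ up Q P)
    (hconj : ∀ g : M, (∀ s ∈ Q, g⁻¹ * s * g ∈ up Q P) → g ∈ Subgroup.normalizer (Q : Set M))
    {κ : Type*} [Finite κ] {b : Module.Basis κ k B} (hb : Permutes ρ (up Q P) b)
    {a T : BrauerQuotient ρ Q} (ha : a ∈ fixedSubalgebra (brauerAction ρ Q) P)
    (hT : relTrace (brauerAction ρ Q) P ⊤ a = T) (hTT : IsIdempotentElem T)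
    (hTP : T ∉ properTraces (resRep (brauerAction ρ Q) P)) {c : B}
    (hc : c ∈ fixedSubalgebra ρ ⊤) (hcc : IsIdempotentElem c) (hcQ : c ∈ fixedSubalgebra ρ Q)
    (hcT : br ρ Q ⟨c, hcQ⟩ * T = T) (hTc : T * br ρ Q ⟨c, hcQ⟩ = T) :
    ∃ i : fixedSubalgebra ρ ⊤, ∃ hiQ : (i : B) ∈ fixedSubalgebra ρ Q,
      IsPrimitiveIdempotent i ∧ IsDefectGroup ρ ⊤ (up Q P) i ∧
      (i : B) ∉ properTraces (resRep ρ (up Q P)) ∧ c * i = i ∧ i * c = i ∧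
      T * br ρ Q ⟨i, hiQ⟩ = br ρ Q ⟨i, hiQ⟩ ∧ br ρ Q ⟨i, hiQ⟩ * T = br ρ Q ⟨i, hiQ⟩ := by
  obtain ⟨x, hxP, hxa⟩ := exists_br_eq p hQ hQP hb ha
  have hcP : c ∈ fixedSubalgebra ρ (up Q P) := fixedSubalgebra_anti ρ le_top hc
  have htm := relTrace_mem ρ ⊤ hxP
  have hdown : down Q (up Q P) = P :=
    Subgroup.comap_map_eq_self_of_injective (Subgroup.subtype_injective _) P
  have hbrx : br ρ Q ⟨relTrace ρ (up Q P) ⊤ x, fixedSubalgebra_anti ρ le_top htm⟩ = T := by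
    rw [br_relTrace ρ hQP le_top (fun g _ => hconj g) hxP x.2, hdown, ← hT, ← hxa]
    congr 1
  let c' : fixedSubalgebra ρ ⊤ := ⟨c, hc⟩
  let incl : fixedSubalgebra ρ ⊤ →ₐ[k] fixedSubalgebra ρ Q :=
    Subalgebra.inclusion (fixedSubalgebra_anti ρ le_top)
  let t : fixedSubalgebra ρ ⊤ := c' * ⟨relTrace ρ (up Q P) ⊤ x, htm⟩ * c'
  let β : fixedSubalgebra ρ ⊤ →ₐ[k] BrauerQuotient ρ Q := (br ρ Q).comp incl
  have hcc' : c' * c' = c' := Subtype.ext hcc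
  have hct : c' * t = t := by simp only [t, ← mul_assoc, hcc']
  have htc : t * c' = t := by simp only [t, mul_assoc, hcc']
  have hβt : β t = T := by
    change (br ρ Q) (⟨c, hcQ⟩ * ⟨relTrace ρ (up Q P) ⊤ x,
      fixedSubalgebra_anti ρ le_top htm⟩ * ⟨c, hcQ⟩) = T
    rw [map_mul, map_mul, hbrx, hcT, hTc]
  -- The Fitting idempotent of `t` maps to that of `T`, which is `T` itself because `T` is
  -- idempotent. This lifts `T` exactly, without any surjectivity of `B^M → B(Q)`.
  obtain ⟨n, q, hcomm, hid, hn⟩ := exists_fitting_idempotent (k := k) t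
  set e := t * q with he
  have hβe : β e = T := by
    have h1 : T ^ n * (1 - β e) = 0 := by
      rw [← hβt, ← map_pow, ← map_one β, ← map_sub, ← map_mul, hn, map_zero]
    have h2 : T * β e = T := by
      have h3 : T * (T ^ n * (1 - β e)) = 0 := by rw [h1, mul_zero]
      rw [← mul_assoc, ← pow_succ', hTT.pow_succ_eq, mul_sub, mul_one, sub_eq_zero] at h3
      exact h3.symm
    have h4 : T * β e = β e := by rw [he, map_mul, hβt, ← mul_assoc, hTT.eq]
    rw [← h4, h2]
  have hce : c' * e = e := by rw [he, ← mul_assoc, hct]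
  have hec : e * c' = e := by rw [he, hcomm.eq, mul_assoc, htc]
  have hePt : (e : B) ∉ properTraces (resRep ρ (up Q P)) := by
    intro h
    have h1 := (mem_properTraces_iff_br p hQ hP hQP hb (x := incl e)
      (fixedSubalgebra_anti ρ le_top e.2)).1 h
    change β e ∈ _ at h1
    rw [hβe] at h1
    exact hTP h1
  let βP : fixedSubalgebra ρ ⊤ →ₐ[k] BrauerQuotient ρ (up Q P) :=
    (br ρ (up Q P)).comp (Subalgebra.inclusion (fixedSubalgebra_anti ρ le_top))
  have hβP : ∀ y, βP y = 0 ↔ (y : B) ∈ properTraces (resRep ρ (up Q P)) :=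
    fun y => br_eq_zero_iff ρ (up Q P) _
  obtain ⟨i, hi, hei, hie, hi0⟩ := exists_primitive_le (k := k) βP.toLinearMap.toAddMonoidHom hid
    (fun h => hePt ((hβP e).1 h))
  have hiP : (i : B) ∉ properTraces (resRep ρ (up Q P)) := fun h => hi0 ((hβP i).2 h)
  have hTi : T * β i = β i := by rw [← hβe, ← map_mul, hei]
  have hiT : β i * T = β i := by rw [← hβe, ← map_mul, hie]
  have hci : c' * i = i := by rw [← hei, ← mul_assoc, hce]
  have hic : i * c' = i := by rw [← hie, mul_assoc, hec]
  refine ⟨i, fixedSubalgebra_anti ρ le_top i.2, hi, ⟨le_top, ?_, ?_⟩, hiP,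
    congrArg Subtype.val hci, congrArg Subtype.val hic, hTi, hiT⟩
  -- As `i` lies under `e = t q`, it is a multiple of the trace of `x`. All the other factors are
  -- fixed by the whole group and can be moved inside the trace.
  · have hi' : i = c' * ⟨relTrace ρ (up Q P) ⊤ x, htm⟩ * (c' * q * i) := by
      conv_lhs => rw [← hei, he]
      simp only [t, mul_assoc]
    refine ⟨c * x * (c' * q * i : fixedSubalgebra ρ ⊤), mul_mem (mul_mem hcP hxP)
      (fixedSubalgebra_anti ρ le_top (c' * q * i : fixedSubalgebra ρ ⊤).2), ?_⟩
    rw [← relTrace_mul ρ _ (c' * q * i : fixedSubalgebra ρ ⊤).2, ← mul_relTrace ρ _ hc]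
    exact (congrArg Subtype.val hi').symm
  · rintro R hR ⟨y, hy, hyi⟩
    refine hiP ?_
    rw [← hyi]
    refine relTrace_mem_properTraces_of_card_lt ρ le_top hy ?_
    exact Set.ncard_lt_ncard (s := (R : Set M)) (t := (up Q P : Set M)) hR (Set.toFinite _)

/-- A primitive idempotent of `B^M` that lies under `c` and is not killed by the Brauer
homomorphism at the defect group `Q` of `c` in `N` covers `c`. -/
theorem covers_of_notMem {ρ : M →* (B ≃ₐ[k] B)} {N Q : Subgroup M} (hQN : Q ≤ N) {c a : B}
    (ha : a ∈ fixedSubalgebra ρ Q) (hac : relTrace ρ Q N a = c) {i : fixedSubalgebra ρ ⊤}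
    (hi : IsIdempotentElem i) (hci : c * i = i) (hic : i * c = i)
    (hiQ : (i : B) ∉ properTraces (resRep ρ Q)) :
    Covers ρ N Q (pointOf ρ ⊤ i) c := by
  let β : fixedSubalgebra ρ N →ₐ[k] BrauerQuotient ρ Q :=
    (br ρ Q).comp (Subalgebra.inclusion (fixedSubalgebra_anti ρ hQN))
  have hβ : ∀ y, β y = 0 ↔ (y : B) ∈ properTraces (resRep ρ Q) :=
    fun y => br_eq_zero_iff ρ Q _
  let i' : fixedSubalgebra ρ N := ⟨i, fixedSubalgebra_anti ρ le_top i.2⟩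
  have hi' : IsIdempotentElem i' := Subtype.ext (show (i : B) * i = i from congrArg Subtype.val hi.eq)
  -- A primitive constituent `f` of `i` in `B^N` not killed by `Br_Q` also lies under `c`. Hence `f
  -- = c f` is a trace of `a f` from `Q`, and a trace from a smaller group would be killed by
  -- `Br_Q`. The same `f` witnesses both conditions on the point of `N`.
  obtain ⟨f, hf, hif, hfi, hf0⟩ := exists_primitive_le (k := k) β.toLinearMap.toAddMonoidHom hi'
    (fun h => hiQ ((hβ i').1 h))
  have hfQ : (f : B) ∉ properTraces (resRep ρ Q) := fun h => hf0 ((hβ f).2 h)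
  have hif' : (i : B) * f = f := congrArg Subtype.val hif
  have hfi' : (f : B) * i = f := congrArg Subtype.val hfi
  have hcf : c * f = f := by rw [← hif', ← mul_assoc, hci]
  have hfc : f * c = f := by rw [← hfi', mul_assoc, hic]
  refine ⟨i, mem_pointOf ρ i, hci, hic, pointOf ρ N f, isPoint_pointOf ρ hf,
    isDefectGroupOfPoint_pointOf ⟨hQN, ?_, ?_⟩, ⟨f, mem_pointOf ρ f, hif', hfi'⟩,
    ⟨f, mem_pointOf ρ f, hcf, hfc⟩⟩
  · refine ⟨a * f, mul_mem ha (fixedSubalgebra_anti ρ hQN f.2), ?_⟩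
    rw [← relTrace_mul ρ _ f.2, hac, hcf]
  · rintro R hR ⟨y, hy, hyf⟩
    refine hfQ ?_
    rw [← hyf]
    refine relTrace_mem_properTraces_of_card_lt ρ hQN hy ?_
    exact Set.ncard_lt_ncard (s := (R : Set M)) (t := (Q : Set M)) hR (Set.toFinite _)

end Lifting

section Representative

variable {k : Type*} [Field k] {G : Type*} [Group G] [Finite G] {A : Type*} [Ring A] [Algebra k A]

/-! ### Points of the extended Brauer quotient -/

theorem degreeOneProj_sub (ι : G →* Aˣ) (Q : Subgroup G) (x y : ExtBrauerQuotient k ι Q) :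
    degreeOneProj ι Q (x - y) = degreeOneProj ι Q x - degreeOneProj ι Q y :=
  map_sub (degreeOneHom ι Q) x y

theorem ofBrauer_mem_fixed (ι : G →* Aˣ) (Q : Subgroup G)
    {L : Subgroup (Subgroup.normalizer (Q : Set G))} {y : BrauerQuotient (conjAction k ι) Q}
    (hy : y ∈ fixedSubalgebra (brauerAction (conjAction k ι) Q) L) :
    ofBrauer k ι Q y ∈ fixedSubalgebra (conjAction k (extInterior k ι Q)) L :=
  fun n hn => by rw [← ofBrauer_brauerAction, hy n hn]

theorem degreeOneProj_mem_fixed (ι : G →* Aˣ) (Q : Subgroup G)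
    {L : Subgroup (Subgroup.normalizer (Q : Set G))} {x : ExtBrauerQuotient k ι Q}
    (hx : x ∈ fixedSubalgebra (conjAction k (extInterior k ι Q)) L) :
    degreeOneProj ι Q x ∈ fixedSubalgebra (brauerAction (conjAction k ι) Q) L :=
  fun n hn => by rw [← degreeOneProj_conjAction, hx n hn]

variable {ι : G →* Aˣ} {Q : Subgroup G}

/-- On `X^Q` the projection is reduction modulo the ideal of proper traces, followed by the
identification of the quotient with `A(Q)`. -/
theorem degreeOneProj_mul (p : ℕ) [Fact p.Prime] [CharP k p] (hQ : IsPGroup p Q)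
    {κ : Type*} [Finite κ] (b : Module.Basis κ k A)
    (hb : ∀ g h i, ∃ j, (ι g : A) * b i * ι h = b j)
    (hfree : ∀ u ∈ Q, ∀ i, (ι u : A) * b i = b i → u = 1) {x y : ExtBrauerQuotient k ι Q}
    (hx : x ∈ fixedSubalgebra (conjAction k (extInterior k ι Q)) (down Q Q))
    (hy : y ∈ fixedSubalgebra (conjAction k (extInterior k ι Q)) (down Q Q)) :
    degreeOneProj ι Q (x * y) = degreeOneProj ι Q x * degreeOneProj ι Q y := by
  have h1 := sub_ofBrauer_mem_properTraces p hQ b hb hfree hx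
  have h2 := sub_ofBrauer_mem_properTraces p hQ b hb hfree hy
  have hx' := ofBrauer_mem_fixed ι Q (brauerAction_down Q _ (degreeOneProj ι Q x))
  have h3 := add_mem (properTraces_mul_mem _ hy h1) (mul_mem_properTraces _ hx' h2)
  have h4 : (x - ofBrauer k ι Q (degreeOneProj ι Q x)) * y
      + ofBrauer k ι Q (degreeOneProj ι Q x) * (y - ofBrauer k ι Q (degreeOneProj ι Q y))
      = x * y - ofBrauer k ι Q (degreeOneProj ι Q x * degreeOneProj ι Q y) := by
    rw [map_mul]
    noncomm_ring
  rw [h4] at h3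
  have h5 := degreeOneProj_properTraces ι Q p hQ h3
  rwa [degreeOneProj_sub, degreeOneProj_ofBrauer, sub_eq_zero] at h5

/-- A point of `X` has a representative in degree one. -/
theorem exists_ofBrauer_mem [FiniteDimensional k A] (p : ℕ) [Fact p.Prime] [CharP k p]
    (hQ : IsPGroup p Q) {κ : Type*} [Finite κ] (b : Module.Basis κ k A)
    (hb : ∀ g h i, ∃ j, (ι g : A) * b i * ι h = b j)
    (hfree : ∀ u ∈ Q, ∀ i, (ι u : A) * b i = b i → u = 1)
    {H : Subgroup (Subgroup.normalizer (Q : Set G))} (hQH : down Q Q ≤ H)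
    {γ : Set (ExtBrauerQuotient k ι Q)} (hγ : IsPoint (conjAction k (extInterior k ι Q)) H γ)
    {i : ExtBrauerQuotient k ι Q} (hi : i ∈ γ) {f : BrauerQuotient (conjAction k ι) Q}
    (hfi : ofBrauer k ι Q f * i = i) (hif : i * ofBrauer k ι Q f = i) :
    ∃ l : BrauerQuotient (conjAction k ι) Q, ofBrauer k ι Q l ∈ γ ∧
      l ∈ fixedSubalgebra (brauerAction (conjAction k ι) Q) H ∧ IsIdempotentElem l ∧
      f * l = l ∧ l * f = l := by
  have hiH := hγ.mem_fixed hi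
  have hiQ := fixedSubalgebra_anti _ hQH hiH
  have hfQ := ofBrauer_mem_fixed ι Q (brauerAction_down Q _ f)
  have hmul := fun {x y} hx hy => degreeOneProj_mul (x := x) (y := y) p hQ b hb hfree hx hy
  have hid : i * i = i := congrArg Subtype.val (hγ.isPrimitiveIdempotent hi).1
  have hll : degreeOneProj ι Q i * degreeOneProj ι Q i = degreeOneProj ι Q i := by
    rw [← hmul hiQ hiQ, hid]
  have hlH := degreeOneProj_mem_fixed ι Q hiH
  refine ⟨degreeOneProj ι Q i, ?_, hlH, hll, ?_, ?_⟩
  · refine hγ.mem_of_nilpotent hi (ofBrauer_mem_fixed ι Q hlH) ?_ ?_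
    · change _ * _ = _
      rw [← map_mul, hll]
    -- The member `i` and its degree one part differ by proper traces, hence by an element of the
    -- radical, which is nilpotent since `X` is finite-dimensional; such idempotents are conjugate
    -- in `X^H`.
    · have h1 := properTraces_le_jacobson p hQ
        (sub_ofBrauer_mem_properTraces p hQ b hb hfree hiQ)
      have h2 := Ideal.mul_mem_left _ (-(2 * i - 1)) h1
      rw [neg_mul, ← mul_neg, neg_sub] at h2
      have : IsArtinianRing (ExtBrauerQuotient k ι Q) := IsArtinianRing.of_finite k _
      obtain ⟨n, hn⟩ := IsSemiprimaryRing.isNilpotent (R := ExtBrauerQuotient k ι Q)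
      refine ⟨n, ?_⟩
      have h3 := Ideal.pow_mem_pow h2 n
      rw [hn] at h3
      exact h3
  · have h1 := hmul hfQ hiQ
    rwa [hfi, degreeOneProj_ofBrauer, eq_comm] at h1
  · have h1 := hmul hiQ hfQ
    rwa [hif, degreeOneProj_ofBrauer, eq_comm] at h1

/-- A defect group of a point of `X` contains `Q`. -/
theorem down_le_of_defectGroup (p : ℕ) [Fact p.Prime] [CharP k p] (hQ : IsPGroup p Q)
    {H P : Subgroup (Subgroup.normalizer (Q : Set G))} (hQH : down Q Q ≤ H)
    {l : BrauerQuotient (conjAction k ι) Q} (hl : l ≠ 0)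
    (hP : IsDefectGroup (conjAction k (extInterior k ι Q)) H P (ofBrauer k ι Q l)) :
    down Q Q ≤ P := by
  by_contra hcon
  obtain ⟨-, ⟨a, ha, hal⟩, -⟩ := hP
  refine hl ?_
  rw [← degreeOneProj_ofBrauer ι Q l]
  refine degreeOneProj_properTraces ι Q p hQ ?_
  rw [← hal]
  -- `Q` is normal in `N_G(Q)`, so if `P` does not contain it then `P` contains none of its
  -- conjugates. A trace from `P` would then be a proper trace at `Q`, with degree one part zero.
  refine relTrace_mem_properTraces _ hQH ha fun g _ hg => hcon fun s hs => ?_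
  have h1 : g * s * g⁻¹ ∈ down Q Q :=
    Subgroup.mem_subgroupOf.2 ((Subgroup.mem_normalizer_iff.1 g.2 s).1 (Subgroup.mem_subgroupOf.1 hs))
  have h2 := hg _ h1
  simpa [mul_assoc] using h2

/-- A defect group of a point of `X` meets `N` in `Q`. -/
theorem inf_le_of_defectGroup [FiniteDimensional k A] (p : ℕ) [Fact p.Prime] [CharP k p]
    (hQ : IsPGroup p Q) {κ : Type*} [Finite κ] (b : Module.Basis κ k A)
    (hb : ∀ g h i, ∃ j, (ι g : A) * b i * ι h = b j)
    {H P K : Subgroup (Subgroup.normalizer (Q : Set G))} {z y l : ExtBrauerQuotient k ι Q}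
    (hy : y ∈ fixedSubalgebra (conjAction k (extInterior k ι Q)) (down Q Q))
    (hyz : relTrace (conjAction k (extInterior k ι Q)) (down Q Q) K y = z)
    (hQK : down Q Q ≤ K) (hQP : down Q Q ≤ P)
    {hlH : l ∈ fixedSubalgebra (conjAction k (extInterior k ι Q)) H}
    (hl : IsPrimitiveIdempotent
      (⟨l, hlH⟩ : fixedSubalgebra (conjAction k (extInterior k ι Q)) H))
    (hP : IsDefectGroup (conjAction k (extInterior k ι Q)) H P l) (hzl : z * l = l) :
    P ⊓ K ≤ down Q Q := by
  obtain ⟨c, -, -, hc⟩ := exists_basis_extBrauerQuotient p hQ b hb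
  have hPp : IsPGroup p P := hP.isPGroup p
  by_contra hcon
  have hle : down Q Q ≤ P ⊓ K := le_inf hQP hQK
  have hlt : down Q Q < P ⊓ K := lt_of_le_not_ge hle hcon
  -- If `P ∩ K` were larger than `Q`, then `z`, a trace from `Q` to `K`, would be a proper trace at
  -- `P ∩ K`. So would `l = z l`, and with the permutation basis `l` would be a proper trace at `P`,
  -- impossible for its defect group.
  have h1 : z ∈ properTraces (resRep (conjAction k (extInterior k ι Q)) (P ⊓ K)) := by
    rw [← hyz]
    refine relTrace_mem_properTraces_of_card_lt _ inf_le_right hy ?_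
    exact Set.ncard_lt_ncard (s := (down Q Q : Set (Subgroup.normalizer (Q : Set G))))
      (t := ((P ⊓ K : Subgroup _) : Set (Subgroup.normalizer (Q : Set G)))) hlt (Set.toFinite _)
  have hlP := fixedSubalgebra_anti _ hP.1 hlH
  have h2 := properTraces_mul_mem _ (fixedSubalgebra_anti _ inf_le_left hlP) h1
  rw [hzl] at h2
  exact hP.notMem_properTraces hl
    (properTraces_mono_of_permutes p hPp inf_le_left (hc.mono le_top) hlP h2)

end Representative

section Identifications

variable {k : Type*} [Field k] {M : Type*} [Group M] [Finite M] {B : Type*} [Ring B] [Algebra k B]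

/-! ### Identifications of iterated Brauer quotients -/

instance finiteDimensional_brauerQuotient [FiniteDimensional k B] (ρ : M →* (B ≃ₐ[k] B))
    (Q : Subgroup M) : FiniteDimensional k (BrauerQuotient ρ Q) :=
  Module.Finite.of_surjective (br ρ Q).toLinearMap (br_surjective ρ Q)

/-- The identification of `B(P)` with `B(Q)(P)`. -/
theorem exists_brauerQuotient_equiv (p : ℕ) [Fact p.Prime] [CharP k p]
    {ρ : M →* (B ≃ₐ[k] B)} {Q : Subgroup M} (hQ : IsPGroup p Q)
    {P : Subgroup (Subgroup.normalizer (Q : Set M))} (hP : IsPGroup p P) (hQP : Q ≤ up Q P)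
    {κ : Type*} [Finite κ] {b : Module.Basis κ k B} (hb : Permutes ρ (up Q P) b) :
    ∃ σ : BrauerQuotient ρ (up Q P) ≃+* BrauerQuotient (brauerAction ρ Q) P,
      ∀ (x : B) (hx : x ∈ fixedSubalgebra ρ (up Q P)) (hxQ : x ∈ fixedSubalgebra ρ Q)
        (h : br ρ Q ⟨x, hxQ⟩ ∈ fixedSubalgebra (brauerAction ρ Q) P),
        σ (br ρ (up Q P) ⟨x, hx⟩) = br (brauerAction ρ Q) P ⟨br ρ Q ⟨x, hxQ⟩, h⟩ := by
  let incl : fixedSubalgebra ρ (up Q P) →ₐ[k] fixedSubalgebra ρ Q :=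
    Subalgebra.inclusion (fixedSubalgebra_anti ρ hQP)
  let f₀ : fixedSubalgebra ρ (up Q P) →ₐ[k] fixedSubalgebra (brauerAction ρ Q) P :=
    ((br ρ Q).comp incl).codRestrict _ (fun x => br_mem_fixed ρ (x := incl x) x.2)
  let f : fixedSubalgebra ρ (up Q P) →ₐ[k] BrauerQuotient (brauerAction ρ Q) P :=
    (br (brauerAction ρ Q) P).comp f₀
  have hf : ∀ x, f x = 0 ↔ br ρ (up Q P) x = 0 := by
    intro x
    have h := mem_properTraces_iff_br p hQ hP hQP hb (x := incl x) x.2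
    exact (br_eq_zero_iff _ P (f₀ x)).trans (h.symm.trans (br_eq_zero_iff ρ (up Q P) x).symm)
  let F : BrauerQuotient ρ (up Q P) →ₐ[k] BrauerQuotient (brauerAction ρ Q) P :=
    RingCon.liftₐ (brauerIdeal ρ (up Q P)).ringCon f (span_ringCon_le _ fun x hx =>
      (hf x).2 (br_eq_zero ρ _ (TwoSidedIdeal.subset_span hx)))
  have hF : ∀ x, F (br ρ (up Q P) x) = f x := fun _ => rfl
  have hbij : Function.Bijective F := by
    constructor
    · rw [injective_iff_map_eq_zero]
      intro y hy
      obtain ⟨x, rfl⟩ := br_surjective ρ (up Q P) y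
      rwa [hF, hf] at hy
    · intro y
      obtain ⟨y, rfl⟩ := br_surjective (brauerAction ρ Q) P y
      obtain ⟨x, hx, hxy⟩ := exists_br_eq p hQ hQP hb y.2
      refine ⟨br ρ (up Q P) ⟨x, hx⟩, ?_⟩
      rw [hF]
      exact congrArg (br (brauerAction ρ Q) P) (Subtype.ext hxy : f₀ ⟨x, hx⟩ = y)
  exact ⟨RingEquiv.ofBijective F hbij, fun x hx hxQ h => rfl⟩

/-- The identification of `B(Q)` with `B(Q)(Q)`. -/
theorem exists_brauerQuotient_down_equiv (p : ℕ) [Fact p.Prime] [CharP k p]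
    (ρ : M →* (B ≃ₐ[k] B)) {Q : Subgroup M} (hQ : IsPGroup p Q) :
    ∃ σ : BrauerQuotient ρ Q ≃+* BrauerQuotient (brauerAction ρ Q) (down Q Q),
      ∀ y h, σ y = br (brauerAction ρ Q) (down Q Q) ⟨y, h⟩ := by
  let f₀ : BrauerQuotient ρ Q →ₐ[k] fixedSubalgebra (brauerAction ρ Q) (down Q Q) :=
    (AlgHom.id k _).codRestrict _ (brauerAction_down Q ρ)
  let f := (br (brauerAction ρ Q) (down Q Q)).comp f₀
  -- `Q` acts trivially on `B(Q)`, so every element is fixed and, in characteristic `p`, all proper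
  -- traces are zero.
  have hbij : Function.Bijective f := by
    constructor
    · rw [injective_iff_map_eq_zero]
      intro y hy
      have h1 := (br_eq_zero_iff (brauerAction ρ Q) (down Q Q) (f₀ y)).1 hy
      exact map_properTraces_eq_zero p (isPGroup_down hQ) _ (AddMonoidHom.id _)
        (fun s v => brauerAction_down Q ρ v s s.2) h1
    · intro y
      obtain ⟨y, rfl⟩ := br_surjective (brauerAction ρ Q) (down Q Q) y
      exact ⟨y, rfl⟩
  exact ⟨RingEquiv.ofBijective f hbij, fun _ _ => rfl⟩

end Identifications

/-! ### Conjugation into a finite subgroup, and free actions on bistable bases. -/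

section Group

variable {G : Type*} [Group G] [Finite G]

theorem mem_normalizer_of_conj_le {Q : Subgroup G} {g : G} (h : ∀ s ∈ Q, g⁻¹ * s * g ∈ Q) :
    g ∈ Subgroup.normalizer (Q : Set G) := by
  rw [← inv_mem_iff]
  refine Subgroup.mem_normalizer_fintype fun n hn => ?_
  simpa using h n hn

end Group

/-- A `p`-subgroup of `N` acts freely on a bistable basis of an algebra that is projective
over `kN`. -/
theorem exists_bistable_basis {k : Type*} [Field k] (p : ℕ) [Fact p.Prime] [CharP k p]
    {G : Type*} [Group G] [Finite G] {N Q : Subgroup G} {A : Type*} [Ring A] [Algebra k A]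
    [FiniteDimensional k A] {ι : G →* Aˣ} (hA : HasBistableBasis k ι)
    (hAl : Module.Projective (MonoidAlgebra k N) (leftRep k ι N).asModule)
    (hQp : IsPGroup p Q) (hQN : Q ≤ N) :
    ∃ (s : Set A) (_ : Finite s) (b : Module.Basis s k A),
      (∀ g h i, ∃ j, (ι g : A) * b i * ι h = b j) ∧
      ∀ u ∈ Q, ∀ i, (ι u : A) * b i = b i → u = 1 := by
  obtain ⟨s, hli, hsp, hst⟩ := hA
  have hbi : ∀ i : s, Module.Basis.mk (v := fun i : s => (i : A)) hli (by simp [hsp]) i = i :=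
    fun i => Module.Basis.mk_apply _ _ _
  generalize Module.Basis.mk (v := fun i : s => (i : A)) hli (by simp [hsp]) = b at hbi
  have hb : ∀ g h i, ∃ j, (ι g : A) * b i * ι h = b j := fun g h i =>
    ⟨⟨_, hst g h i i.2⟩, by rw [hbi, hbi]⟩
  refine ⟨s, Module.Finite.finite_basis b, b, hb, fun u hu i hi => ?_⟩
  -- `D` is the stabilizer in `N` of a basis element under left multiplication; its intersection
  -- with `Q` is a `p`-group, so projectivity makes it trivial.
  let D : Subgroup N :=
    { carrier := {n | leftRep k ι N n (b i) = b i}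
      one_mem' := by simp
      mul_mem' := fun {m n} hm hn => by
        change leftRep k ι N (m * n) (b i) = b i
        rw [map_mul, Module.End.mul_apply, hn, hm]
      inv_mem' := fun {m} hm => by
        change leftRep k ι N m⁻¹ (b i) = b i
        conv_lhs => rw [← show leftRep k ι N m (b i) = b i from hm]
        rw [apply_inv_apply] }
  have h1 := eq_one_of_projective p (leftRep k ι N) hAl b (fun n i => by
      obtain ⟨j, hj⟩ := hb n 1 i
      refine ⟨j, ?_⟩
      rw [← hj]
      simp [leftRep])
    (D := D ⊓ Q.subgroupOf N) ((hQp.comap_subtype (K := N)).to_le inf_le_right) (i := i)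
    (fun n hn => hn.1) (s := ⟨u, hQN hu⟩) ⟨hi, Subgroup.mem_subgroupOf.2 hu⟩
  exact congrArg Subtype.val h1

section BrauerPairs

variable {k : Type*} [Field k] {M : Type*} [Group M] [Finite M] {B : Type*} [Ring B] [Algebra k B]

/-! ### Extension of Brauer pairs -/

/-- A block `f` with `Br_Q(c) f ≠ 0` that is primitive in a fixed point algebra lies under
`Br_Q(c)`. -/
theorem IsBrauerPair.br_mul_eq {p : ℕ} {ρ : M →* (B ≃ₐ[k] B)} {c : B} (hc : ∀ g, ρ g c = c)
    (hcc : c * c = c) {Q : Subgroup M} {f : BrauerQuotient ρ Q} (hf : IsBrauerPair p ρ ⊤ c Q f)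
    {D : Subgroup (Subgroup.normalizer (Q : Set M))}
    (hfD : IsPrimitiveIn (fixedSubalgebra (brauerAction ρ Q) D) f) :
    br ρ Q ⟨c, fun g _ => hc g⟩ * f = f := by
  obtain ⟨h, hprim⟩ := hfD
  obtain ⟨-, -, ⟨hfc, -⟩, _, hne⟩ := hf
  let c' : fixedSubalgebra ρ Q := ⟨c, fun g _ => hc g⟩
  have hcD : br ρ Q c' ∈ fixedSubalgebra (brauerAction ρ Q) D := fun m _ => by
    rw [brauerAction_br]
    exact congrArg _ (Subtype.ext (hc m))
  have hcc' : br ρ Q c' * br ρ Q c' = br ρ Q c' := by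
    rw [← map_mul]
    exact congrArg _ (Subtype.ext hcc)
  rcases hprim.mul_eq_zero_or (g := ⟨_, hcD⟩)
    (Subtype.ext (Subring.mem_center_iff.1 hfc (br ρ Q c')).symm) (Subtype.ext hcc') with h1 | h1
  · exact absurd (congrArg Subtype.val h1) hne
  · exact congrArg Subtype.val h1

variable [FiniteDimensional k B]

/-- A Brauer pair `(Q, f)` extends to `P ≤ N(Q, f)` if `Br_P(f) ≠ 0`, both for `B` and for
`B(Q)`. -/
theorem exists_brauerPairLE (p : ℕ) [Fact p.Prime] [CharP k p] {ρ : M →* (B ≃ₐ[k] B)}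
    (hB : IsPPermutation p ρ) {c : B} (hc : ∀ g, ρ g c = c) {Q : Subgroup M} (hQ : IsPGroup p Q)
    {f : BrauerQuotient ρ Q} (hf : IsBrauerPair p ρ ⊤ c Q f)
    (hcf : br ρ Q ⟨c, fun g _ => hc g⟩ * f = f)
    {H P : Subgroup (Subgroup.normalizer (Q : Set M))} (hP : IsPGroup p P) (hQP : down Q Q ≤ P)
    (hPH : P ≤ H) (hfH : f ∈ fixedSubalgebra (brauerAction ρ Q) H)
    (hfP : f ∉ properTraces (resRep (brauerAction ρ Q) P)) :
    ∃ (fP : BrauerQuotient ρ (up Q P)) (fP' : BrauerQuotient (brauerAction ρ Q) P)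
      (fQ' : BrauerQuotient (brauerAction ρ Q) (down Q Q)),
      Corresponds ρ Q P fP fP' ∧
      (∃ h : f ∈ fixedSubalgebra (brauerAction ρ Q) (down Q Q),
        br (brauerAction ρ Q) (down Q Q) ⟨f, h⟩ = fQ') ∧
      BrauerPairLE p ρ ⊤ c Q f (up Q P) fP ∧
      BrauerPairLE p (brauerAction ρ Q) H f (down Q Q) fQ' P fP' := by
  have hQP' : Q ≤ up Q P := fun g hg =>
    ⟨⟨g, Subgroup.le_normalizer hg⟩, hQP (Subgroup.mem_subgroupOf.2 hg), rfl⟩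
  have hff := hf.2.2.1.isIdempotentElem
  have hfP' := fixedSubalgebra_anti _ hPH hfH
  obtain ⟨s, b, hb⟩ := hB.exists_basis (hP.map (Subgroup.normalizer (Q : Set M)).subtype)
  have : Finite s := Module.Finite.finite_basis b
  obtain ⟨σ, hσ⟩ := exists_brauerQuotient_equiv p hQ hP hQP' hb
  obtain ⟨τ, hτ⟩ := exists_brauerQuotient_down_equiv p ρ hQ
  have hσm : ∀ x y, σ (x * y) = σ x * σ y := σ.map_mul'
  have hσ0 : ∀ x, σ x = 0 ↔ x = 0 := fun x => RingEquiv.map_eq_zero_iff σ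
  have hτm : ∀ x y, τ (x * y) = τ x * τ y := τ.map_mul'
  have hτ0 : ∀ x, τ x = 0 ↔ x = 0 := fun x => RingEquiv.map_eq_zero_iff τ
  let e := br (brauerAction ρ Q) P ⟨f, hfP'⟩
  have he : e * e = e := by
    rw [← map_mul]
    exact congrArg _ (Subtype.ext hff)
  have hec : e ∈ Subring.center (BrauerQuotient (brauerAction ρ Q) P) := by
    rw [Subring.mem_center_iff]
    intro y
    obtain ⟨y, rfl⟩ := br_surjective (brauerAction ρ Q) P y
    rw [← map_mul, ← map_mul]
    obtain ⟨hfc, -⟩ := hf.2.2.1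
    exact congrArg _ (Subtype.ext (Subring.mem_center_iff.1 hfc y))
  -- `Br_P(f)` is a non-zero central idempotent, so it has a block `f'` beneath it. That block is
  -- the required one in `B(Q)(P)`, and its preimage under `σ` is the one in `B(P)`.
  obtain ⟨f', hf', hef'⟩ := exists_block_le (k := k) he hec
    (fun h => hfP ((br_eq_zero_iff _ P ⟨f, hfP'⟩).1 h))
  -- Because `f' = Br_P(f) f'`, multiplying by `f'` after `Br_P` sees only `y f`. In particular
  -- `Br_Q(i) f = 0` forces `Br_P(i) f' = 0`, the contrapositive of both inclusions of pairs.
  have hmul : ∀ y (hy : y ∈ fixedSubalgebra (brauerAction ρ Q) P) z,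
      y * f = z → ∀ hz : z ∈ fixedSubalgebra (brauerAction ρ Q) P,
      br (brauerAction ρ Q) P ⟨y, hy⟩ * f' = br (brauerAction ρ Q) P ⟨z, hz⟩ * f' := by
    intro y hy z hyz hz
    rw [← hef', ← mul_assoc, ← mul_assoc, ← map_mul, ← map_mul]
    have h1 : (⟨y, hy⟩ * ⟨f, hfP'⟩ : fixedSubalgebra (brauerAction ρ Q) P)
        = ⟨z, hz⟩ * ⟨f, hfP'⟩ := Subtype.ext (by
      change y * f = z * f
      rw [← hyz, mul_assoc, hff])
    rw [h1]
  have hmul0 : ∀ y (hy : y ∈ fixedSubalgebra (brauerAction ρ Q) P), y * f = 0 →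
      br (brauerAction ρ Q) P ⟨y, hy⟩ * f' = 0 := by
    intro y hy hyf
    rw [hmul y hy 0 hyf (zero_mem _)]
    exact (congrArg (· * f') (map_zero (br (brauerAction ρ Q) P))).trans (zero_mul f')
  have hσmul : ∀ x (hx : x ∈ fixedSubalgebra ρ (up Q P)) (hxQ : x ∈ fixedSubalgebra ρ Q)
      (h : br ρ Q ⟨x, hxQ⟩ ∈ fixedSubalgebra (brauerAction ρ Q) P),
      br (brauerAction ρ Q) P ⟨br ρ Q ⟨x, hxQ⟩, h⟩ * f' = σ (br ρ (up Q P) ⟨x, hx⟩ * σ.symm f') := by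
    intro x hx hxQ h
    rw [hσm, σ.apply_symm_apply, hσ]
  have hτf : τ f = br (brauerAction ρ Q) (down Q Q) ⟨f, brauerAction_down Q ρ f⟩ := hτ f _
  refine ⟨σ.symm f', f', τ f, ?_, ⟨brauerAction_down Q ρ f, hτf.symm⟩,
    ⟨hf, ⟨le_top, hP.map _, hf'.map_equiv σ.symm, fun g _ => hc g, fun h => ?_⟩, hQP',
      fun i hiP hiQ _ hne h => hne ?_⟩,
    ⟨⟨hQP.trans hPH, isPGroup_down hQ, hf.2.2.1.map_equiv τ, brauerAction_down Q ρ f, ?_⟩,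
      ⟨hPH, hP, hf', hfP', fun h => ?_⟩, hQP, fun i hiP hiQ _ hne h => hne ?_⟩⟩
  · obtain ⟨x, hx⟩ := br_surjective ρ (up Q P) (σ.symm f')
    have hxQ := fixedSubalgebra_anti ρ hQP' x.2
    refine ⟨x, x.2, hxQ, br_mem_fixed ρ (x := ⟨x, hxQ⟩) x.2, hx, ?_⟩
    rw [← hσ x x.2]
    exact (congrArg σ hx).trans (σ.apply_symm_apply f')
  · have h1 := hσmul c (fun g _ => hc g) (fun g _ => hc g)
      (br_mem_fixed ρ (x := ⟨c, fun g _ => hc g⟩) fun g _ => hc g)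
    rw [h, (hσ0 0).2 rfl, hmul _ _ f hcf hfP'] at h1
    exact hf'.ne_zero (hef'.symm.trans h1)
  · have h1 := hσmul i hiP hiQ (br_mem_fixed ρ (x := ⟨i, hiQ⟩) hiP)
    rw [hmul0 _ _ h] at h1
    exact (hσ0 _).1 h1.symm
  · rw [← hτf, ← hτm, hff]
    exact (hf.2.2.1.map_equiv τ).ne_zero
  · exact hf'.ne_zero (hef'.symm.trans h)
  · rw [← hτ, ← hτm, hτ0] at h
    exact hmul0 i hiP h

end BrauerPairs

end

end BrauerPoints

/-! ### The main theorem. -/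

open BrauerPoints in
theorem proposition6p2
    {k : Type*} [Field k] (p : ℕ) [Fact p.Prime] [CharP k p]
    {G : Type*} [Group G] [Finite G] (N : Subgroup G) [N.Normal]
    -- `A` is an interior `G`-algebra with a `G × G`-stable basis, projective on both sides over `kN`
    {A : Type*} [Ring A] [Algebra k A] [FiniteDimensional k A] (ι : G →* Aˣ)
    (hA : HasBistableBasis k ι)
    (hAl : Module.Projective (MonoidAlgebra k N) (leftRep k ι N).asModule)
    (hAr : Module.Projective (MonoidAlgebra k N) (rightRep k ι N).asModule)
    -- `C` is a `p`-permutation `N`-interior `G`-algebra contained in `A`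
    {C : Type*} [Ring C] [Algebra k C] (ρ : G →* (C ≃ₐ[k] C)) (ιC : N →* Cˣ)
    (hC : IsPPermutation p ρ)
    (j : C →ₐ[k] A) (hj : Function.Injective j)
    (hjG : ∀ g x, j (ρ g x) = conjAction k ι g (j x))
    (hjN : ∀ n : N, j (ιC n) = ι n)
    -- `c` is a `G`-invariant primitive idempotent of `C^N` with defect group `Q` in `N`
    (c : C) (hcG : ∀ g, ρ g c = c) (hcN : IsPrimitiveIn (fixedSubalgebra ρ N) c)
    (Q : Subgroup G) (hQp : IsPGroup p Q) (hQ : IsDefectGroup ρ N Q c)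
    -- `(Q, fQ)` is a `(C, c, G)`-Brauer pair with `fQ` primitive in `C(Q)^{C_N(Q)}`
    (fQ : BrauerQuotient ρ Q) (hfQ : IsBrauerPair p ρ ⊤ c Q fQ)
    (hfQprim : IsPrimitiveIn
      (fixedSubalgebra (brauerAction ρ Q) (down Q (Subgroup.centralizer (Q : Set G) ⊓ N))) fQ)
    -- `H = N_G(Q, fQ)`
    (H : Subgroup (Subgroup.normalizer (Q : Set G)))
    (hH : H = elemStabilizer (brauerAction ρ Q) fQ)
    -- `γ` is a point of `H` on `X` with defect group `P` that covers `fQ`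
    (γ : Set (ExtBrauerQuotient k ι Q))
    (hγ : IsPoint (conjAction k (extInterior k ι Q)) H γ)
    (P : Subgroup (Subgroup.normalizer (Q : Set G)))
    (hP : IsDefectGroupOfPoint (conjAction k (extInterior k ι Q)) H P γ)
    (hcov : Covers (conjAction k (extInterior k ι Q))
      (down Q (Q ⊔ (Subgroup.centralizer (Q : Set G) ⊓ N))) (down Q Q) γ (toExt ι Q ρ j hjG fQ)) :
    -- a point `α` of `G` on `A` with defect group `P` that covers `c` and lies over `γ`
    (∃ α : Set A, IsPoint (conjAction k ι) ⊤ α ∧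
      IsDefectGroupOfPoint (conjAction k ι) ⊤ (up Q P) α ∧
      Covers (conjAction k ι) N Q α (j c) ∧
      ∃ l ∈ γ, toExt ι Q ρ j hjG fQ * l = l ∧ l * toExt ι Q ρ j hjG fQ = l ∧
        ∃ i ∈ α, ∃ hi : i ∈ fixedSubalgebra (conjAction k ι) Q,
          relTrace (conjAction k (extInterior k ι Q)) H ⊤ l * extBr k ι Q ⟨i, hi⟩
            = extBr k ι Q ⟨i, hi⟩ ∧
          extBr k ι Q ⟨i, hi⟩ * relTrace (conjAction k (extInterior k ι Q)) H ⊤ l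
            = extBr k ι Q ⟨i, hi⟩) ∧
    -- a block `fP` of `C(P) = C(Q)(P)` with `(Q, fQ) ≤ (P, fP)` in both senses
    ∃ (fP : BrauerQuotient ρ (up Q P)) (fP' : BrauerQuotient (brauerAction ρ Q) P)
      (fQ' : BrauerQuotient (brauerAction ρ Q) (down Q Q)),
      Corresponds ρ Q P fP fP' ∧
      (∃ h : fQ ∈ fixedSubalgebra (brauerAction ρ Q) (down Q Q),
        br (brauerAction ρ Q) (down Q Q) ⟨fQ, h⟩ = fQ') ∧
      BrauerPairLE p ρ ⊤ c Q fQ (up Q P) fP ∧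
      BrauerPairLE p (brauerAction ρ Q) H fQ (down Q Q) fQ' P fP' := by
  have hQN := hQ.1
  have : FiniteDimensional k C := Module.Finite.of_injective j.toLinearMap hj
  obtain ⟨s, _, b, hb, hfree⟩ := exists_bistable_basis p hA hAl hQp hQN
  have hbP : ∀ R : Subgroup G, Permutes (conjAction k ι) R b := fun R g _ i => by
    obtain ⟨t, ht⟩ := hb g g⁻¹ i
    refine ⟨t, ?_⟩
    rw [← ht, map_inv]
    rfl
  have hfB := hfQ.2.2.1
  have hcc : c * c = c := by
    obtain ⟨_, hcN⟩ := hcN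
    exact congrArg Subtype.val hcN.1
  have hcf := hfQ.br_mul_eq hcG hcc hfQprim
  have hfc : fQ * br ρ Q ⟨c, fun g _ => hcG g⟩ = fQ := by
    obtain ⟨hfcen, -⟩ := hfB
    rw [← Subring.mem_center_iff.1 hfcen, hcf]
  have hfH : fQ ∈ fixedSubalgebra (brauerAction ρ Q) H := by
    subst hH
    exact fun n hn => hn
  have hQH : down Q Q ≤ H := by
    subst hH
    exact fun n hn => brauerAction_down Q ρ fQ n hn
  let g := toExt ι Q ρ j hjG
  have hg : ∀ n y, g (brauerAction ρ Q n y) = conjAction k (extInterior k ι Q) n (g y) :=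
    toExt_brauerAction ι Q ρ j hjG
  -- `F` is the image of `fQ` in `A(Q)`, so that the relations between `fQ` and `l` can be stated
  -- there.
  obtain ⟨F, hF⟩ : ∃ F, ofBrauer k ι Q F = g fQ := by
    obtain ⟨x, rfl⟩ := br_surjective ρ Q fQ
    exact ⟨br (conjAction k ι) Q ⟨j x, map_mem_fixed ι ρ j hjG x.2⟩, rfl⟩
  obtain ⟨i₀, hi₀, hfi, hif, -⟩ := hcov
  obtain ⟨l, hlγ, hlH, hll, hFl, hlF⟩ := exists_ofBrauer_mem p hQp b hb hfree hQH hγ hi₀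
    (by rw [hF]; exact hfi) (by rw [hF]; exact hif)
  have hfl : g fQ * ofBrauer k ι Q l = ofBrauer k ι Q l := by rw [← hF, ← map_mul, hFl]
  have hlf : ofBrauer k ι Q l * g fQ = ofBrauer k ι Q l := by rw [← hF, ← map_mul, hlF]
  have hLH := ofBrauer_mem_fixed ι Q hlH
  have hLL : ofBrauer k ι Q l * ofBrauer k ι Q l = ofBrauer k ι Q l := by rw [← map_mul, hll.eq]
  have hDP := hP _ hlγ
  have hprim := hγ.isPrimitiveIdempotent hlγ
  have hPp : IsPGroup p P := hDP.isPGroup p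
  have hLfix := fixedSubalgebra_anti _ hDP.1 hLH
  have hLP := hDP.notMem_properTraces hprim
  have hl0 : l ≠ 0 := by
    rintro rfl
    exact hprim.2.1 (Subtype.ext (map_zero _))
  have hQP := down_le_of_defectGroup p hQp hQH hl0 hDP
  have hQP' : Q ≤ up Q P := fun x hx =>
    ⟨⟨x, Subgroup.le_normalizer hx⟩, hQP (Subgroup.mem_subgroupOf.2 hx), rfl⟩
  obtain ⟨-, ⟨a, ha, hac⟩, -⟩ := id hQ
  -- Since `c` is a trace from `Q` to `N`, Mackey's formula at `Q` itself makes `Br_Q(c)` a trace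
  -- from `Q` to `N_N(Q)`, first in `C(Q)` and then in `X`.
  have hz : relTrace (conjAction k (extInterior k ι Q)) (down Q Q) (down Q N) (g (br ρ Q ⟨a, ha⟩))
      = g (br ρ Q ⟨c, fun x _ => hcG x⟩) := by
    have h1 := br_relTrace ρ le_rfl hQN (fun x _ hx => mem_normalizer_of_conj_le hx) ha ha
      (fixedSubalgebra_anti ρ hQN (relTrace_mem ρ N ha))
    have h2 : (⟨c, fun x _ => hcG x⟩ : fixedSubalgebra ρ Q)
      = ⟨relTrace ρ Q N a, fixedSubalgebra_anti ρ hQN (relTrace_mem ρ N ha)⟩ :=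
      Subtype.ext hac.symm
    rw [h2, h1]
    exact (map_relTrace (brauerAction ρ Q) (conjAction k (extInterior k ι Q))
      (AddMonoidHomClass.toAddMonoidHom g) (down Q N) (fun n _ y => hg n y) (down Q Q)
      (br ρ Q ⟨a, ha⟩)).symm
  have hcl : g (br ρ Q ⟨c, fun x _ => hcG x⟩) * ofBrauer k ι Q l = ofBrauer k ι Q l := by
    rw [← hfl, ← mul_assoc, ← map_mul, hcf]
  have hlc : ofBrauer k ι Q l * g (br ρ Q ⟨c, fun x _ => hcG x⟩) = ofBrauer k ι Q l := by
    rw [← hlf, mul_assoc, ← map_mul, hfc]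
  -- The result is `P ∩ N ≤ Q`, using that `Br_Q(c)` acts as the identity on `l`.
  have hinf := inf_le_of_defectGroup p hQp b hb
    (fun n hn => by rw [← hg, brauerAction_down Q ρ _ n hn]) hz
    (fun n hn => Subgroup.mem_subgroupOf.2 (hQN (Subgroup.mem_subgroupOf.1 hn))) hQP hprim hDP hcl
  -- A conjugate of `Q` contained in `P` is also contained in the normal subgroup `N`, hence in `P ∩
  -- N ≤ Q`.
  have hconj : ∀ x : G, (∀ u ∈ Q, x⁻¹ * u * x ∈ up Q P) → x ∈ Subgroup.normalizer (Q : Set G) := by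
    refine fun x hx => mem_normalizer_of_conj_le fun u hu => ?_
    obtain ⟨m, hm, hmu⟩ := hx u hu
    have hmN : (m : G) ∈ N := by
      have h1 := ‹N.Normal›.conj_mem u (hQN hu) x⁻¹
      rw [inv_inv] at h1
      rw [← hmu] at h1
      exact h1
    rw [← hmu]
    exact Subgroup.mem_subgroupOf.1 (hinf ⟨hm, Subgroup.mem_subgroupOf.2 hmN⟩)
  refine ⟨?_, exists_brauerPairLE p hC hcG hQp hfQ hcf hPp hQP hDP.1 hfH fun h => hLP ?_⟩
  · have hne : ∀ n, n ∉ H → brauerAction ρ Q n fQ ≠ fQ := by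
      subst hH
      exact fun n hn => hn
    have hblk := fun n => hfB.map_equiv (brauerAction ρ Q n).toRingEquiv
    -- An element outside `H` moves `fQ` to a different block of `C(Q)`, and different blocks are
    -- orthogonal.
    obtain ⟨h1, h2⟩ := relTrace_mul_self (L := ⊤) (f := g fQ) hLH hLL hfl hlf
      (fun n _ hn => by
        rw [← hg, ← map_mul]
        exact (congrArg g (hfB.mul_eq_zero (hblk n) (hne n hn))).trans (map_zero g))
      (fun n _ hn => by
        rw [← hg, ← map_mul]
        exact (congrArg g ((hblk n).mul_eq_zero hfB (hne n hn).symm)).trans (map_zero g))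
    let T := relTrace (brauerAction (conjAction k ι) Q) H ⊤ l
    have hT : ofBrauer k ι Q T
        = relTrace (conjAction k (extInterior k ι Q)) H ⊤ (ofBrauer k ι Q l) :=
      map_relTrace (brauerAction (conjAction k ι) Q) (conjAction k (extInterior k ι Q))
        (AddMonoidHomClass.toAddMonoidHom (ofBrauer k ι Q)) _
        (fun n _ y => ofBrauer_brauerAction ι Q n y) _ _
    have hTT : IsIdempotentElem T := ofBrauer_injective ι Q (by
      rw [map_mul, hT]
      exact isIdempotentElem_relTrace hLH h1)
    obtain ⟨-, ⟨a', ha', hal⟩, -⟩ := id hDP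
    -- The element with trace `l` may be taken in `A(Q)`, as the projection to degree one commutes
    -- with the action of `N_G(Q)` and fixes `l`.
    have ha'l : relTrace (brauerAction (conjAction k ι) Q) P H (degreeOneProj ι Q a') = l := by
      rw [← degreeOneProj_ofBrauer ι Q l, ← hal]
      exact (map_relTrace _ _ (degreeOneHom ι Q).toAddMonoidHom _
        (fun n _ y => degreeOneProj_conjAction ι Q n y) _ _).symm
    have haf := degreeOneProj_mem_fixed ι Q ha'
    have hTa : relTrace (brauerAction (conjAction k ι) Q) P ⊤ (degreeOneProj ι Q a') = T := by
      rw [← relTrace_trans _ hDP.1 le_top haf, ha'l]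
    -- Otherwise `l = T l` would be a proper trace at its defect group `P`.
    have hTP : T ∉ properTraces (resRep (brauerAction (conjAction k ι) Q) P) := by
      intro h
      have h3 := map_mem_properTraces (resRep (brauerAction (conjAction k ι) Q) P) (resRep (conjAction k (extInterior k ι Q)) P)
        (AddMonoidHomClass.toAddMonoidHom (ofBrauer k ι Q)) (fun n y => ofBrauer_brauerAction ι Q n y) h
      have h4 := properTraces_mul_mem _ hLfix h3
      change ofBrauer k ι Q T * _ ∈ _ at h4
      rw [hT, h1] at h4
      exact hLP h4
    have hcX : g (br ρ Q ⟨c, fun x _ => hcG x⟩)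
        ∈ fixedSubalgebra (conjAction k (extInterior k ι Q)) ⊤ := fun n _ => by
      rw [← hg, brauerAction_br]
      exact congrArg g (congrArg (br ρ Q) (Subtype.ext (hcG n)))
    have hjc : ∀ R, j c ∈ fixedSubalgebra (conjAction k ι) R := fun R =>
      map_mem_fixed ι ρ j hjG fun x _ => hcG x
    have hcg : ofBrauer k ι Q (br (conjAction k ι) Q ⟨j c, hjc Q⟩)
        = g (br ρ Q ⟨c, fun x _ => hcG x⟩) := rfl
    obtain ⟨i, hiQ, hi, hiD, hiP, hci, hic, hTi, hiT⟩ := exists_primitive_of_relTrace p hQp hPp hQP'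
      hconj (hbP _) haf hTa hTT hTP (hjc ⊤) (by rw [IsIdempotentElem, ← map_mul, hcc]) (hjc Q)
      (ofBrauer_injective ι Q (by rw [map_mul, hcg, hT, mul_relTrace _ _ hcX, hcl]))
      (ofBrauer_injective ι Q (by rw [map_mul, hcg, hT, relTrace_mul _ _ hcX, hlc]))
    refine ⟨pointOf _ ⊤ i, isPoint_pointOf _ hi, isDefectGroupOfPoint_pointOf hiD,
      covers_of_notMem hQN (a := j a) (map_mem_fixed ι ρ j hjG ha) ?_ hi.1 hci hic fun h => hiP ?_,
      ofBrauer k ι Q l, hlγ, hfl, hlf, i, mem_pointOf _ i, hiQ, ?_, ?_⟩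
    · rw [← hac]
      exact (map_relTrace ρ _ (j : C →+ A) N (fun x _ y => hjG x y) Q a).symm
    -- From `Br_P(i) ≠ 0` and `Q ≤ P` it follows that `Br_Q(i) ≠ 0`, which is what covering needs.
    · exact properTraces_mono_of_permutes p (hPp.map _) hQP' (hbP _)
        (fixedSubalgebra_anti _ le_top i.2) h
    · rw [← hT]
      exact (map_mul (ofBrauer k ι Q) _ _).symm.trans (congrArg _ hTi)
    · rw [← hT]
      exact (map_mul (ofBrauer k ι Q) _ _).symm.trans (congrArg _ hiT)
  -- If `fQ` were a proper trace at `P` in `C(Q)`, so would be its image in `X`, and hence `l = fQ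
  -- l`, against `P` being the defect group of `l`.
  · have h1 := map_mem_properTraces (resRep (brauerAction ρ Q) P)
      (resRep (conjAction k (extInterior k ι Q)) P)
      (AddMonoidHomClass.toAddMonoidHom g) (fun n y => hg n y) h
    have h2 := properTraces_mul_mem _ hLfix h1
    change g fQ * _ ∈ _ at h2
    rwa [hfl] at h2
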